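/- **Conventions.** Words are finite $0/1$-strings, $|s|$ is the length of $s$, and $\mathbb R^d$ carries the maximum norm, $d,e\ge 1$. Dyadic vectors are coded by words in the usual way (each coordinate $a/2^m$ by a self-delimiting pair of a binary numeral of $a$, possibly zero-padded, and $0^m$), and $\phi(q,0^n)$ stands for the value of a function $\phi:\{0,1\}^*\to\{0,1\}^*$ at the pair of a code of $q$ and $0^n$, for any code of $q$. Functions are paired by $\langle\phi,\psi\rangle(\varepsilon)=\varepsilon$, $\langle\phi,\psi\rangle(0s)=0^{|\psi(s)|}1\phi(s)$, $\langle\phi,\psi\rangle(1s)=0^{|\phi(s)|}1\psi(s)$, and $\langle\phi_1,\dots,\phi_k\rangle=\langle\langle\phi_1,\dots,\phi_{k-1}\rangle,\phi_k\rangle$. A function $\Phi$ on words is *length-monotone* if $|s|\le|t|$ implies $|\Phi(s)|\le|\Phi(t)|$; its length is $|\Phi|(m)=|\Phi(0^m)|$. Second-order polynomials $P(L,n)$ are built from natural constants and $n$ by $+$, $\cdot$ and $Q\mapsto L(Q)$. Machines are deterministic multi-tape Turing machines with a function oracle, where a query is answered in one step. **Names.** Let $f:\subseteq\mathbb R^d\to\mathbb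 R^e$ be a partial function with compact domain. A length-monotone $\langle\phi,\overline\mu,\underline\mu\rangle$, where a function $\mu:\mathbb N\to\mathbb N$ is identified with $s\mapsto 0^{\mu(|s|)}$, is a *name of $f$* if $\overline\mu,\underline\mu:\mathbb N\to\mathbb N$ are strictly increasing; $\|x-x'\|\le2^{-\overline\mu(n)}$ implies $\|f(x)-f(x')\|\le2^{-n}$, and $\|f(x)-f(x')\|\le2^{-\underline\mu(n)}$ implies $\|x-x'\|\le2^{-n}$, for all $x,x'\in\operatorname{dom}f$ and $n\in\mathbb N$; and for every dyadic $q\in\mathbb R^d$ and $n\in\mathbb N$ such that $\operatorname{dom}(f)$ meets the closed ball $\overline B(q,2^{-\overline\mu(n+1)})$, $\phi(q,0^n)$ codes a dyadic vector $v$ with $\|v-f(x)\|\le 2^{-(n+1)}$ for some $x\in\operatorname{dom}(f)\cap\overline B(q,2^{-\overline\mu(n+1)})$. A *grid-name* of a nonempty compact $S\subset\mathbb R^d$ is a $\psi$ such that $\psi(\varepsilon)$ codes in unary an integer $b$ with $S\subseteq\overline B(0,2^b)$, and $\psi(q,0^n)=\chi_{B_n}(q)$ for sets $B_n\subset 2^{-n}\mathbb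 Z^d$ of Hausdorff distance at most $2^{-n}$ to $S$. A length-monotone $\Phi=\langle\phi,\overline\mu,\underline\mu,\psi\rangle$ is a *name of $(f,S)$* if $S\subseteq\operatorname{dom}f$, $\psi$ is a grid-name of $S$ and $\langle\phi,\overline\mu,\underline\mu\rangle$ is a name of $f$. **Theorem.** For all $d,e\ge1$ there are an oracle machine $M$, a second-order polynomial $P$, a constant $c\in\mathbb N$ and a function $\tau:\mathbb N\to\mathbb N$ such that for every $(f,S)$ and every name $\Phi=\langle\phi,\overline\mu,\underline\mu,\psi\rangle$ of $(f,S)$, with outer radius parameter $b$ and $b^+=\max(b,0)$, the following hold. 1. *(Computability)* $M^\Phi$ halts on every word, and $s\mapsto M^\Phi(s)$ is a name $\langle\phi',\overline\mu',\underline\mu'\rangle$ of the partial function $(f|_S)^{-1}:\subseteq\mathbb R^e\to\mathbb R^d$ with domain $f[S]$. 2. *(General bound)* On every input $s$ that asks for a value $\phi'(\cdot,0^n)$ (and, with $n:=|s|$, on every word $s$), $M^\Phi$ halts within $$P(|\Phi|,|s|)\cdot 2^{\,c\,(\overline\mu(\underline\mu(\overline\mu(n+c)))+b^++1)}$$ steps.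 3. *(Bi-Hölder functions)* Let $0<\alpha,\beta\le1$ and $k\in\mathbb N$ be such that $f$ is $(\alpha,2^k)$-Hölder and its inverse is $(\beta,2^k)$-Hölder, and let the moduli in $\Phi$ be at most the corresponding Hölder moduli, $\overline\mu(n)\le\lceil(n+k)/\alpha\rceil$ and $\underline\mu(n)\le\lceil(n+k)/\beta\rceil$ for all $n$. Then for $s$ and $n$ as in 2, $M^\Phi$ halts within $$P(|\Phi|,|s|)\cdot 2^{\,c\,((n+k+1)/(\alpha^2\beta)+b^+)}$$ steps, which is still exponential in $n$. 4. *(Bi-Lipschitz functions)* If $f$ and its inverse are Lipschitz with constant $2^k$, $k\in\mathbb N$, and the moduli in $\Phi$ satisfy $\overline\mu(n)\le n+k$ and $\underline\mu(n)\le n+k$ for all $n$, then on every word $s$, $M^\Phi$ halts within $$\tau(k+b^+)\cdot P(|\Phi|,|s|)$$ steps; that is, the time is parameterized polynomial with parameters $k$ and $b$. -/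

import Mathlib

/-! ## Words, string functions and pairing

Words over `{0,1}` are lists of Booleans (`false` is the letter `0`, `true` the letter `1`). -/

abbrev Word : Type := List Bool

abbrev StrFun : Type := Word → Word

/-- The unary word `0^n`. -/
def unary (n : ℕ) : Word := List.replicate n false

/-- Self-delimiting pairing of words: `⟨s₁…s_k, t⟩ = 1 s₁ 1 s₂ … 1 s_k 0 t`. -/
def wpair : Word → Word → Word
  | [], t => false :: t
  | b :: s, t => true :: b :: wpair s t

/-- Pairing of string functions:
`⟨φ,ψ⟩(ε) = ε`, `⟨φ,ψ⟩(0s) = 0^{|ψ(s)|} 1 φ(s)`, `⟨φ,ψ⟩(1s) = 0^{|φ(s)|} 1 ψ(s)`. -/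
def fpair (φ ψ : StrFun) : StrFun
  | [] => []
  | false :: s => unary (ψ s).length ++ true :: φ s
  | true :: s => unary (φ s).length ++ true :: ψ s

/-- Length-monotone string functions. -/
def LengthMonotone (φ : StrFun) : Prop :=
  ∀ s t : Word, s.length ≤ t.length → (φ s).length ≤ (φ t).length

/-- The length `|φ|(m) = |φ(0^m)|` of a (length-monotone) string function. -/
def fnLength (φ : StrFun) (m : ℕ) : ℕ := (φ (unary m)).length

/-- Second-order polynomials in a function variable `L : ℕ → ℕ` and a number variable `n`. -/
inductive SecondOrderPoly : Type
  | const (m : ℕ) : SecondOrderPoly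
  | var : SecondOrderPoly
  | add (P Q : SecondOrderPoly) : SecondOrderPoly
  | mul (P Q : SecondOrderPoly) : SecondOrderPoly
  | app (P : SecondOrderPoly) : SecondOrderPoly

def SecondOrderPoly.eval : SecondOrderPoly → (ℕ → ℕ) → ℕ → ℕ
  | .const m, _, _ => m
  | .var, _, n => n
  | .add P Q, L, n => P.eval L n + Q.eval L n
  | .mul P Q, L, n => P.eval L n * Q.eval L n
  | .app P, L, n => L (P.eval L n)

/-! ## Function-oracle Turing machines

Deterministic multi-tape machines with two-way infinite tapes over `{0,1,blank}` (`none` is the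
blank). There are `m + 3` tapes: tape `0` holds the input, tape `1` is the query tape, tape `2` is
the output tape, and the remaining `m` are work tapes. -/

/-- What a machine does in a given control state: halt, query the oracle and continue in state
`next`, or make an ordinary step. An ordinary step reads the scanned symbols of all tapes and
determines the next state and, for each tape, the symbol to write and the head movement after
writing (`none` means that the head stays). -/
inductive OracleTM.Action (Q : Type) (m : ℕ) : Type
  | halt : OracleTM.Action Q m
  | query (next : Q) : OracleTM.Action Q m
  | act (δ : (Fin (m + 3) → Option Bool) →
      Q × (Fin (m + 3) → Option Bool × Option Turing.Dir)) : OracleTM.Action Q m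

structure OracleTM : Type 1 where
  /-- control states -/
  Q : Type
  finite : Finite Q
  /-- number of additional work tapes -/
  m : ℕ
  start : Q
  action : Q → OracleTM.Action Q m

namespace OracleTM

/-- The word that starts at the head of a tape and extends to the right up to the first blank. -/
def readWord (T : Turing.Tape (Option Bool)) : Word :=
  T.right₀.liftOn (fun l => (l.takeWhile Option.isSome).reduceOption) (by
    rintro a _ ⟨n, rfl⟩
    congr 1
    induction a with
    | nil => cases n <;> rfl
    | cons x a ih => cases x <;> simp [ih])

/-- The tape that contains exactly the word `w`, with the head on its first letter. -/
def wordTape (w : Word) : Turing.Tape (Option Bool) := Turing.Tape.mk₁ (w.map some)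

/-- Write a symbol, then move. -/
def tapeStep (T : Turing.Tape (Option Bool)) (a : Option Bool × Option Turing.Dir) :
    Turing.Tape (Option Bool) :=
  match a.2 with
  | none => T.write a.1
  | some dir => (T.write a.1).move dir

structure Cfg (M : OracleTM) : Type where
  state : M.Q
  tape : Fin (M.m + 3) → Turing.Tape (Option Bool)

variable (M : OracleTM)

def init (s : Word) : M.Cfg where
  state := M.start
  tape := fun i => wordTape (if i = 0 then s else [])

/-- One step with oracle `φ`. A query replaces the word on the query tape by the oracle's answer
in a single step. Halting configurations are left unchanged. -/
def step (φ : StrFun) (c : M.Cfg) : M.Cfg :=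
  match M.action c.state with
  | .halt => c
  | .query next =>
      { state := next
        tape := Function.update c.tape 1 (wordTape (φ (readWord (c.tape 1)))) }
  | .act δ =>
      { state := (δ fun i => (c.tape i).head).1
        tape := fun i => tapeStep (c.tape i) ((δ fun i => (c.tape i).head).2 i) }

/-- The configuration after `t` steps with oracle `φ` on input `s`. -/
def run (φ : StrFun) (s : Word) (t : ℕ) : M.Cfg := (M.step φ)^[t] (M.init s)

/-- With oracle `φ` on input `s` the machine has halted after at most `t` steps. -/
def HaltsIn (φ : StrFun) (s : Word) (t : ℕ) : Prop :=
  M.action (M.run φ s t).state = .halt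

/-- With oracle `φ` on input `s` the machine halts with the word `w` on its output tape. -/
def Outputs (φ : StrFun) (s w : Word) : Prop :=
  ∃ t, M.HaltsIn φ s t ∧ readWord ((M.run φ s t).tape 2) = w

end OracleTM

/-- Second-order (multi-)representations: `ρ Φ x` says that `Φ` is a `ρ`-name of `x`. -/
abbrev SORep (X : Type) : Type := StrFun → X → Prop

/-- `M` computes a `(ρ,ρ')`-realizer of the operator `F` (whose domain consists of all objects
that have a `ρ`-name). -/
def OracleTM.Realizes {X Y : Type} (M : OracleTM) (ρ : SORep X) (ρ' : SORep Y)
    (F : X → Y) : Prop :=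
  ∀ (Φ : StrFun) (x : X), ρ Φ x → ∃ Ψ : StrFun, (∀ s, M.Outputs Φ s (Ψ s)) ∧ ρ' Ψ (F x)

/-! ## Codes of dyadic vectors -/

/-- The integer with a given sign-magnitude numeral: a sign letter followed by the binary digits of
the absolute value, least significant digit first; padding with zeros is allowed. -/
def intVal : Word → ℤ
  | [] => 0
  | false :: w => (w.foldr Nat.bit 0 : ℕ)
  | true :: w => -(w.foldr Nat.bit 0 : ℕ)

/-- `w` is a code `⟨a, 0^n⟩` of the dyadic rational `x = a / 2^n`. -/
def IsDyadicCode₁ (w : Word) (x : ℝ) : Prop :=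
  ∃ (u : Word) (n : ℕ), w = wpair u (unary n) ∧ x = (intVal u : ℝ) / 2 ^ n

/-- `w` is a code of the dyadic vector `q`: the code of `(q₁,…,q_d)` is
`⟨code of q₁, code of (q₂,…,q_d)⟩` for `d ≥ 2`. -/
def IsDyadicCode : (d : ℕ) → Word → (Fin d → ℝ) → Prop
  | 0, w, _ => w = []
  | 1, w, q => IsDyadicCode₁ w (q 0)
  | d + 2, w, q => ∃ u v : Word, w = wpair u v ∧ IsDyadicCode₁ u (q 0) ∧
      IsDyadicCode (d + 1) v (fun i => q i.succ)

/-- The grid of vectors whose coordinates are integer multiples of `2^{-n}`. -/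
def dyadicGrid (d n : ℕ) : Set (Fin d → ℝ) := {q | ∀ i, ∃ a : ℤ, q i = (a : ℝ) / 2 ^ n}

/-! ## Partial functions, moduli, Hölder classes

The norm on `Fin d → ℝ` is the maximum norm. -/

section Functions

variable {d e : ℕ}

/-- `μ` is a modulus of uniform continuity of the partial function `f`. -/
def IsModulusOfContinuity (f : (Fin d → ℝ) →. (Fin e → ℝ)) (μ : ℕ → ℕ) : Prop :=
  ∀ (n : ℕ) (x x' : Fin d → ℝ) (y y' : Fin e → ℝ), y ∈ f x → y' ∈ f x' →
    ‖x - x'‖ ≤ (1 / 2 : ℝ) ^ μ n → ‖y - y'‖ ≤ (1 / 2 : ℝ) ^ n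

/-- `μ` is a modulus of uniform unicity of the partial function `f`. -/
def IsModulusOfUnicity (f : (Fin d → ℝ) →. (Fin e → ℝ)) (μ : ℕ → ℕ) : Prop :=
  ∀ (n : ℕ) (x x' : Fin d → ℝ) (y y' : Fin e → ℝ), y ∈ f x → y' ∈ f x' →
    ‖y - y'‖ ≤ (1 / 2 : ℝ) ^ μ n → ‖x - x'‖ ≤ (1 / 2 : ℝ) ^ n

/-- `f` is `(α,C)`-Hölder on its domain. -/
def IsHolder (α C : ℝ) (f : (Fin d → ℝ) →. (Fin e → ℝ)) : Prop :=
  0 < α ∧ α ≤ 1 ∧ 0 < C ∧ ∀ (x x' : Fin d → ℝ) (y y' : Fin e → ℝ), y ∈ f x → y' ∈ f x' →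
    ‖y - y'‖ ≤ C * ‖x - x'‖ ^ α

/-- The inverse of the restriction of `f` to `S`. Its domain is `f[S]`, and it sends `y` to the
point `x ∈ S` with `f x = y` (unique if `f` is injective on `S`). -/
noncomputable def inversion (f : (Fin d → ℝ) →. (Fin e → ℝ)) (S : Set (Fin d → ℝ)) :
    (Fin e → ℝ) →. (Fin d → ℝ) :=
  fun y => ⟨∃ x ∈ S, y ∈ f x, fun h => h.choose⟩

theorem mem_inversion {f : (Fin d → ℝ) →. (Fin e → ℝ)} {S : Set (Fin d → ℝ)}
    (hf : ∀ x ∈ S, ∀ x' ∈ S, ∀ y, y ∈ f x → y ∈ f x' → x = x')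
    {x : Fin d → ℝ} {y : Fin e → ℝ} : x ∈ inversion f S y ↔ x ∈ S ∧ y ∈ f x := by
  constructor
  · rintro ⟨h, rfl⟩
    exact h.choose_spec
  · rintro ⟨hx, hy⟩
    have h : ∃ x ∈ S, y ∈ f x := ⟨x, hx, hy⟩
    exact ⟨h, hf _ h.choose_spec.1 _ hx y h.choose_spec.2 hy⟩

/-- `f` is bi-Hölder: `f` is `(α,C)`-Hölder and injective, and its inverse is `(β,D)`-Hölder. -/
def IsBiHolder (α C β D : ℝ) (f : (Fin d → ℝ) →. (Fin e → ℝ)) : Prop :=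
  IsHolder α C f ∧ (∀ x x' y, y ∈ f x → y ∈ f x' → x = x') ∧ IsHolder β D (inversion f f.Dom)

/-- `f` is bi-Lipschitz: both Hölder exponents are `1`. -/
def IsBiLipschitz (C D : ℝ) (f : (Fin d → ℝ) →. (Fin e → ℝ)) : Prop :=
  IsBiHolder 1 C 1 D f

/-- The string function `s ↦ 0^{μ(|s|)}` that encodes a modulus. -/
def modulusFun (μ : ℕ → ℕ) : StrFun := fun s => unary (μ s.length)

/-- The string function `⟨φ, μ̄, μ̲⟩ = ⟨⟨φ, μ̄⟩, μ̲⟩`. -/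
def parName (φ : StrFun) (μc μu : ℕ → ℕ) : StrFun :=
  fpair (fpair φ (modulusFun μc)) (modulusFun μu)

/-- `⟨φ, μc, μu⟩` is a name of the partial function `f` with compact domain: `μc` and `μu` are
(strictly increasing) moduli of continuity and of unicity, and `φ(q,0^n)` approximates a value of
`f` near `q` whenever `q` is close enough to the domain of `f`. -/
structure IsParInvName (f : (Fin d → ℝ) →. (Fin e → ℝ)) (φ : StrFun) (μc μu : ℕ → ℕ) :
    Prop where
  compact_dom : IsCompact f.Dom
  continuity : IsModulusOfContinuity f μc
  unicity : IsModulusOfUnicity f μu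
  strict_continuity : StrictMono μc
  strict_unicity : StrictMono μu
  approx : ∀ (w : Word) (q : Fin d → ℝ) (n : ℕ), IsDyadicCode d w q →
    (f.Dom ∩ Metric.closedBall q ((1 / 2 : ℝ) ^ μc (n + 1))).Nonempty →
    ∃ v : Fin e → ℝ, IsDyadicCode e (φ (wpair w (unary n))) v ∧
      ∃ x ∈ f.Dom ∩ Metric.closedBall q ((1 / 2 : ℝ) ^ μc (n + 1)), ∃ y ∈ f x,
        ‖v - y‖ ≤ (1 / 2 : ℝ) ^ (n + 1)
  lengthMonotone : LengthMonotone (parName φ μc μu)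

/-- The outer radius parameter `b ∈ ℤ` stored in a grid name: the word `ψ(ε)` is read as a unary
code of a natural number, which in turn codes an integer. -/
def outerRadius (ψ : StrFun) : ℤ := Equiv.intEquivNat.symm (ψ []).length

/-- `ψ` is a grid name of the nonempty compact set `S`: `S ⊆ closedBall 0 (2^b)`, and `ψ` is the
characteristic function of a sequence of subsets `B n` of the grids of width `2^{-n}` whose
Hausdorff distance to `S` is at most `2^{-n}`. -/
structure IsGridName (S : Set (Fin d → ℝ)) (ψ : StrFun) : Prop where
  nonempty : S.Nonempty
  compact : IsCompact S
  bounded : S ⊆ Metric.closedBall 0 ((2 : ℝ) ^ outerRadius ψ)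
  grid : ∃ B : ℕ → Set (Fin d → ℝ),
    (∀ n, B n ⊆ dyadicGrid d n) ∧
    (∀ (w : Word) (q : Fin d → ℝ) (n : ℕ), IsDyadicCode d w q →
      (q ∈ B n → ψ (wpair w (unary n)) = [true]) ∧
      (q ∉ B n → ψ (wpair w (unary n)) = [false])) ∧
    (∀ n, ∀ x ∈ S, ∃ q ∈ B n, ‖q - x‖ ≤ (1 / 2 : ℝ) ^ n) ∧
    (∀ n, ∀ q ∈ B n, ∃ x ∈ S, ‖q - x‖ ≤ (1 / 2 : ℝ) ^ n)

/-- The string function `⟨φ, μ̄, μ̲, ψ⟩ = ⟨⟨φ, μ̄, μ̲⟩, ψ⟩`. -/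
def setName (φ : StrFun) (μc μu : ℕ → ℕ) (ψ : StrFun) : StrFun :=
  fpair (parName φ μc μu) ψ

/-- `⟨φ, μc, μu, ψ⟩` is a name of the pair `(f,S)` with `S ⊆ dom f`. -/
structure IsSetInvName (f : (Fin d → ℝ) →. (Fin e → ℝ)) (S : Set (Fin d → ℝ))
    (φ : StrFun) (μc μu : ℕ → ℕ) (ψ : StrFun) : Prop where
  subset_dom : S ⊆ f.Dom
  gridName : IsGridName S ψ
  parInvName : IsParInvName f φ μc μu
  lengthMonotone : LengthMonotone (setName φ μc μu ψ)

end Functions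

/-- The representation of partial functions with compact domain. -/
def parInvRep (d e : ℕ) : SORep ((Fin d → ℝ) →. (Fin e → ℝ)) :=
  fun Φ f => ∃ φ μc μu, Φ = parName φ μc μu ∧ IsParInvName f φ μc μu

/-- The representation of pairs `(f,S)`. -/
def setInvRep (d e : ℕ) :
    SORep (((Fin d → ℝ) →. (Fin e → ℝ)) × Set (Fin d → ℝ)) :=
  fun Φ p => ∃ φ μc μu ψ, Φ = setName φ μc μu ψ ∧ IsSetInvName p.1 p.2 φ μc μu ψ

/-- The word `s`, given as input to a machine that computes a name `⟨⟨φ', μ̄'⟩, μ̲'⟩`, asks for the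
value `φ'(u)` at a word of the form `u = ⟨w, 0^n⟩`, that is, for an approximation with
precision `n`. -/
def IsQueryOfPrecision (s : Word) (n : ℕ) : Prop :=
  ∃ w : Word, s = false :: false :: wpair w (unary n)

/-! ## Stack programs

Every register of a stack program holds a word, of which only the first letter is accessible. -/

namespace StackProg

/-! The inverse is computed by a search from coarse to fine. Write `j r = μc (μu r + 4)`, let `b` be
the positive part of the outer radius parameter, and let the query point `q` be close to some `y = f
x` with `x ∈ S`. Before level `r` a centre is known whose distance to `x` is at most `2 ^ (b + 2 -
r)`. Level `r` tries points with spacing `2 ^ (-j r)` around this centre. A trial point is accepted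
if `ψ` puts it into the grid set of level `j r` and if `φ`, evaluated there with precision `m = μu r
+ 3`, differs from `q` by at most four units of `2 ^ (-m)`. Membership in the grid set ensures that
the domain of `f` meets the ball on which `φ` is specified.

Completeness (`accepts_complete`): the grid point next to `x` passes, since its error is at most 5/2
units. Soundness (`accepts_sound`): at an accepted point `φ` describes a value of `f` within 11/2
units of `y`, hence within `2 ^ (-μu r)`; the modulus of unicity then puts the point within `2 ^
(-r) + 2 ^ (-j r) ≤ 2 ^ (1 - r)` of `x`. So any accepted point is a valid centre for level `r + 1`
(`refineCentre_near`), and after level `n + 2` the error is at most `2 ^ (-(n + 1))` (`solve_near`).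

A trial point is described by a sign, a direction and `b + j r + 4 - r` digits for each coordinate,
so level `r` makes `2 ^ (d * (b + j r - r + 6))` trials, each of second-order polynomial cost.
Estimating `j r` for `r ≤ n + 2` gives the general and the Hölder bound. For Lipschitz moduli `j r ≤
r + 2 * k + 4`, the level cancels, and the exponent depends on `k` and `b` only; this is why the
centre is refined step by step instead of searching the finest grid at once.

All centres share one denominator and one number of digits, both determined by the length of the
input. Hence the result is length-monotone, and the padding in the paired name can be written
without running the search. The moduli of `f` exchange their roles for the inverse
(`isParInvName_inversion`).

The algorithm is not written as a Turing machine. Stack programs are compiled to oracle machines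
step by step (`run_compile`, `machine_halts`). On top of them stand the classes `PT` (second-order
polynomial time) and `XT W` (the same times `2 ^ W`), with closure under pairing, branching and
iteration with controlled growth, and suitable rules for composition. The search belongs to `XT`
(`XT.solve`, `XT.mainFun`). -/

/-- Stack programs. `ifTop` and `loop` remove the first letter of a register and branch on it, and
`loop` repeats until the register is empty. The instruction `put` overwrites the scanned cell; it is
only the second half of `push`. -/
inductive Prog : Type
  | nop : Prog
  | push (i : ℕ) (b : Bool) : Prog
  | put (i : ℕ) (b : Bool) : Prog
  | query : Prog
  | seq (p q : Prog) : Prog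
  | ifTop (i : ℕ) (pn p0 p1 : Prog) : Prog
  | loop (i : ℕ) (p0 p1 : Prog) : Prog

abbrev Store : Type := ℕ → Word

open Function Prog

/-- `Run Φ p σ σ' t`: with oracle `Φ` the program `p` takes `σ` to `σ'` in `t` machine steps. -/
inductive Run (Φ : StrFun) : Prog → Store → Store → ℕ → Prop
  | nop (σ) : Run Φ nop σ σ 1
  | push (i b σ) : Run Φ (push i b) σ (update σ i (b :: σ i)) 2
  | query (σ) : Run Φ query σ (update σ 1 (Φ (σ 1))) 1
  | seq {p q σ σ' σ'' t t'} : Run Φ p σ σ' t → Run Φ q σ' σ'' t' →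
      Run Φ (seq p q) σ σ'' (t + t' + 1)
  | ifNil {i pn p0 p1 σ σ' t} : σ i = [] → Run Φ pn σ σ' t → Run Φ (ifTop i pn p0 p1) σ σ' (t + 1)
  | ifCons {i pn p0 p1 σ σ' t b w} : σ i = b :: w →
      Run Φ (cond b p1 p0) (update σ i w) σ' t → Run Φ (ifTop i pn p0 p1) σ σ' (t + 1)
  | loopNil {i p0 p1 σ} : σ i = [] → Run Φ (loop i p0 p1) σ σ 1
  | loopCons {i p0 p1 σ σ' σ'' t u b w} : σ i = b :: w →
      Run Φ (cond b p1 p0) (update σ i w) σ' t → Run Φ (loop i p0 p1) σ' σ'' u →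
      Run Φ (loop i p0 p1) σ σ'' (t + u + 1)

/-- All registers of the program are smaller than this number. -/
def Prog.bound : Prog → ℕ
  | nop => 0
  | push i _ => i + 1
  | put i _ => i + 1
  | query => 2
  | seq p q => max p.bound q.bound
  | ifTop i pn p0 p1 => max (i + 1) (max pn.bound (max p0.bound p1.bound))
  | loop i p0 p1 => max (i + 1) (max p0.bound p1.bound)

/-- The store that agrees with `σ` below `K` and continues with `ρ`. -/
def glue (K : ℕ) (σ ρ : Store) : Store := fun r => if r < K then σ r else ρ (r - K)

theorem glue_of_lt {K r : ℕ} (h : r < K) (σ ρ : Store) : glue K σ ρ r = σ r := if_pos h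

theorem glue_of_le {K r : ℕ} (h : K ≤ r) (σ ρ : Store) : glue K σ ρ r = ρ (r - K) :=
  if_neg (by omega)

theorem glue_update {K i : ℕ} (h : i < K) (σ ρ : Store) (w : Word) :
    glue K (update σ i w) ρ = update (glue K σ ρ) i w := by
  funext r
  by_cases hr : r = i
  · subst hr; simp [glue, h]
  · simp [glue, hr]

/-- Registers that do not occur in a program are left alone. -/
theorem Run.frame {Φ : StrFun} {p : Prog} {σ σ' : Store} {t K : ℕ} (h : Run Φ p σ σ' t)
    (hK : p.bound ≤ K) (ρ : Store) : Run Φ p (glue K σ ρ) (glue K σ' ρ) t := by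
  induction h with
  | nop => exact .nop _
  | push i b σ =>
    have hi : i < K := hK
    rw [glue_update hi, ← glue_of_lt hi σ ρ]
    exact .push ..
  | query σ =>
    have hi : 1 < K := hK
    rw [glue_update hi, ← glue_of_lt hi σ ρ]
    exact .query _
  | seq _ _ ih1 ih2 =>
    simp only [bound, max_le_iff] at hK
    exact .seq (ih1 hK.1) (ih2 hK.2)
  | ifNil h _ ih =>
    simp only [bound, max_le_iff] at hK
    exact .ifNil (by rw [glue_of_lt hK.1, h]) (ih hK.2.1)
  | @ifCons i pn p0 p1 σ σ' t b w h _ ih =>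
    simp only [bound, max_le_iff] at hK
    refine .ifCons (by rw [glue_of_lt hK.1, h]) ?_
    rw [← glue_update hK.1]
    exact ih (by cases b; exacts [hK.2.2.1, hK.2.2.2])
  | loopNil h =>
    simp only [bound, max_le_iff] at hK
    exact .loopNil (by rw [glue_of_lt hK.1, h])
  | @loopCons i p0 p1 σ σ' σ'' t t' b w h _ _ ih ih' =>
    refine .loopCons (b := b) (w := w) ?_ ?_ (ih' hK)
    · simp only [bound, max_le_iff] at hK
      rw [glue_of_lt hK.1, h]
    · simp only [bound, max_le_iff] at hK
      rw [← glue_update hK.1]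
      exact ih (by cases b; exacts [hK.2.1, hK.2.2])

/-! ### Compilation to oracle machines -/

section Compile

open OracleTM Turing

theorem readWord_wordTape (w : Word) : readWord (wordTape w) = w := by
  have : (wordTape w).right₀ = ListBlank.mk (w.map some) := by
    simp [wordTape, Tape.mk₁, Tape.mk₂]
  rw [readWord, this]
  change ((w.map some).takeWhile Option.isSome).reduceOption = w
  induction w with
  | nil => rfl
  | cons b w ih =>
    simp only [List.map_cons, List.takeWhile_cons, Option.isSome_some, if_true,
      List.reduceOption_cons_of_some, List.cons.injEq, true_and]
    exact ih (by simp [wordTape, Tape.mk₁, Tape.mk₂])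

theorem wordTape_eq (w : Word) :
    wordTape w = Tape.mk' (ListBlank.mk []) (ListBlank.mk (w.map some)) := rfl

theorem wordTape_head_nil : (wordTape []).head = none := rfl

theorem wordTape_head_cons (b : Bool) (w : Word) : (wordTape (b :: w)).head = some b := rfl

theorem wordTape_pop (b : Bool) (w : Word) :
    tapeStep (wordTape (b :: w)) (none, some Dir.right) = wordTape w := by
  simp only [tapeStep, wordTape_eq, Tape.write_mk', Tape.move_right_mk', List.map_cons]
  congr 1
  -- The popped cell leaves a blank to the left of the head, and `ListBlank` identifies one blank
  -- with the empty tape.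
  · refine Quotient.sound' (Or.inr ⟨1, rfl⟩)

/-- A machine step writes before it moves, so pushing takes two steps: rewrite the scanned symbol
and go left, then write the new letter. This is the purpose of `put`. -/
theorem wordTape_push (b : Bool) (w : Word) :
    tapeStep (tapeStep (wordTape w) ((wordTape w).head, some Dir.left)) (some b, none) =
      wordTape (b :: w) := by
  simp only [tapeStep, Tape.write_self]
  simp only [wordTape_eq, Tape.move_left_mk', Tape.write_mk', List.map_cons]
  rfl

/-- The head moves of an instruction that only changes tape `i`. -/
def onTape {m : ℕ} (i : ℕ) (a : Option Bool × Option Dir) (h : Fin (m + 3) → Option Bool) :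
    Fin (m + 3) → Option Bool × Option Dir := fun j => if j.val = i then a else (h j, none)

def topOf {m : ℕ} (i : ℕ) (h : Fin (m + 3) → Option Bool) : Option Bool :=
  if hi : i < m + 3 then h ⟨i, hi⟩ else none

/-- The action of a list of programs that are to be executed one after the other. -/
def listAction (m : ℕ) : List Prog → Action (List Prog) m
  | [] => .halt
  | nop :: k => .act fun h => (k, fun j => (h j, none))
  | push i b :: k => .act fun h => (put i b :: k, onTape i (topOf i h, some Dir.left) h)
  | put i b :: k => .act fun h => (k, onTape i (some b, none) h)
  | query :: k => .query k
  | seq p q :: k => .act fun h => (p :: q :: k, fun j => (h j, none))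
  | ifTop i pn p0 p1 :: k => .act fun h =>
      match topOf i h with
      | none => (pn :: k, fun j => (h j, none))
      | some b => (cond b p1 p0 :: k, onTape i (none, some Dir.right) h)
  | loop i p0 p1 :: k => .act fun h =>
      match topOf i h with
      | none => (k, fun j => (h j, none))
      | some b => (cond b p1 p0 :: loop i p0 p1 :: k, onTape i (none, some Dir.right) h)

/-- The lists of programs that can occur during the execution of `p` followed by `k`. -/
def conts : Prog → List Prog → List (List Prog)
  | nop, k => [nop :: k]
  | push i b, k => [push i b :: k, put i b :: k]
  | put i b, k => [put i b :: k]
  | query, k => [query :: k]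
  | seq p q, k => (seq p q :: k) :: (conts p (q :: k) ++ conts q k)
  | ifTop i pn p0 p1, k =>
      (ifTop i pn p0 p1 :: k) :: (conts pn k ++ (conts p0 k ++ conts p1 k))
  | loop i p0 p1, k =>
      (loop i p0 p1 :: k) :: (conts p0 (loop i p0 p1 :: k) ++ conts p1 (loop i p0 p1 :: k))

theorem cons_mem_conts (p : Prog) (k : List Prog) : p :: k ∈ conts p k := by
  cases p <;> simp [conts]

def mapAction {Q Q' : Type} {m : ℕ} (f : Q → Q') : Action Q m → Action Q' m
  | .halt => .halt
  | .query q => .query (f q)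
  | .act δ => .act fun h => (f (δ h).1, (δ h).2)

open Classical in
/-- The state that corresponds to a list of programs. -/
noncomputable def toState (R : List (List Prog)) (l : List Prog) : {l // l ∈ [] :: R} :=
  if h : l ∈ [] :: R then ⟨l, h⟩ else ⟨[], by simp⟩

theorem toState_val {R : List (List Prog)} {l : List Prog} (h : l ∈ [] :: R) :
    (toState R l).1 = l := by
  unfold toState
  rw [dif_pos h]

/-- The oracle machine that executes `p`. -/
noncomputable def machine (p : Prog) : OracleTM where
  Q := {l // l ∈ [] :: conts p []}
  finite := List.finite_toSet _
  m := p.bound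
  start := toState _ [p]
  action q := mapAction (toState _) (listAction p.bound q.1)

variable {p₀ : Prog}

noncomputable def cfg (p₀ : Prog) (l : List Prog) (σ : Store) : (machine p₀).Cfg where
  state := toState _ l
  tape i := wordTape (σ i.val)

theorem topOf_head {m i : ℕ} (hi : i < m + 3) (σ : Store) :
    topOf i (fun j : Fin (m + 3) => (wordTape (σ j.val)).head) = (wordTape (σ i)).head := by
  simp [topOf, hi]

theorem step_act {Φ : StrFun} {l : List Prog} (hl : l ∈ [] :: conts p₀ []) {σ : Store} {δ}
    (h : listAction p₀.bound l = .act δ) :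
    (machine p₀).step Φ (cfg p₀ l σ) =
      { state := toState _ (δ fun i => (wordTape (σ i.val)).head).1
        tape := fun i => tapeStep (wordTape (σ i.val))
          ((δ fun i => (wordTape (σ i.val)).head).2 i) } := by
  have : (machine p₀).action (cfg p₀ l σ).state = mapAction (toState _) (.act δ) := by
    change mapAction _ (listAction p₀.bound (toState _ l).1) = _
    rw [toState_val hl, h]
  simp only [OracleTM.step, this]
  rfl

theorem tapeStep_stay (T : Tape (Option Bool)) : tapeStep T (T.head, none) = T := by
  simp [tapeStep]

theorem step_stay {Φ : StrFun} {l : List Prog} (hl : l ∈ [] :: conts p₀ []) {σ : Store} {δ} {l'}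
    (h : listAction p₀.bound l = .act δ)
    (hδ : δ (fun i => (wordTape (σ i.val)).head) =
      (l', fun j => ((wordTape (σ j.val)).head, none))) :
    (machine p₀).step Φ (cfg p₀ l σ) = cfg p₀ l' σ := by
  rw [step_act hl h, hδ]
  simp only [tapeStep_stay]
  rfl

theorem step_pop {Φ : StrFun} {l : List Prog} (hl : l ∈ [] :: conts p₀ []) {σ : Store} {δ} {l'}
    {i : ℕ} {b : Bool} {w : Word} (h : listAction p₀.bound l = .act δ) (hσ : σ i = b :: w)
    (hδ : δ (fun i => (wordTape (σ i.val)).head) =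
      (l', onTape i (none, some Dir.right) fun j => (wordTape (σ j.val)).head)) :
    (machine p₀).step Φ (cfg p₀ l σ) = cfg p₀ l' (update σ i w) := by
  rw [step_act hl h, hδ]
  refine congrArg (Cfg.mk _) (funext fun j => ?_)
  by_cases hj : j.val = i
  · simp only [onTape, hj, if_true, update_self, hσ, wordTape_pop]
  · simp only [onTape, hj, if_false, tapeStep_stay, ne_eq, not_false_eq_true, update_of_ne]

/-- Register `i` lives on tape `i` with the head on its first letter, so each instruction is
simulated in exactly the number of steps that `Run` charges. The continuation `k` is arbitrary
because `seq` and `loop` put further programs on the list; the membership hypotheses keep every list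
inside the finite state set, where `toState` is faithful. -/
theorem run_compile {Φ : StrFun} {p : Prog} {σ σ' : Store} {t : ℕ} (h : Run Φ p σ σ' t) :
    p.bound ≤ p₀.bound + 3 → ∀ k, k ∈ [] :: conts p₀ [] → conts p k ⊆ conts p₀ [] →
    ((machine p₀).step Φ)^[t] (cfg p₀ (p :: k) σ) = cfg p₀ k σ' := by
  induction h with
  | nop σ =>
    intro _ k _ hs
    exact step_stay (List.mem_cons_of_mem _ (hs (cons_mem_conts _ _))) rfl rfl
  | push i b σ =>
    intro hb k _ hs
    have h1 : push i b :: k ∈ [] :: conts p₀ [] := List.mem_cons_of_mem _ (hs (by simp [conts]))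
    have h2 : put i b :: k ∈ [] :: conts p₀ [] := List.mem_cons_of_mem _ (hs (by simp [conts]))
    rw [iterate_succ_apply, iterate_one, step_act h1 rfl]
    have ha : (machine p₀).action (toState _ (put i b :: k)) =
        mapAction (toState _) (listAction p₀.bound (put i b :: k)) := by
      change mapAction _ (listAction p₀.bound (toState _ _).1) = _
      rw [toState_val h2]
    simp only [listAction, OracleTM.step, ha, mapAction, cfg]
    refine congrArg (Cfg.mk _) (funext fun j => ?_)
    have hi : i < p₀.bound + 3 := hb
    by_cases hj : j.val = i
    · subst hj
      simp only [onTape, if_true, topOf_head hi, update_self, wordTape_push]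
    · simp only [onTape, hj, if_false, tapeStep_stay, ne_eq, not_false_eq_true, update_of_ne]
  | query σ =>
    intro _ k _ hs
    have hl : Prog.query :: k ∈ [] :: conts p₀ [] :=
      List.mem_cons_of_mem _ (hs (cons_mem_conts _ _))
    have ha : (machine p₀).action (cfg p₀ (Prog.query :: k) σ).state =
        .query (toState _ k) := by
      change mapAction _ (listAction p₀.bound (toState _ _).1) = _
      rw [toState_val hl]; rfl
    simp only [iterate_one, OracleTM.step, ha]
    refine congrArg (Cfg.mk _) (funext fun j => ?_)
    by_cases hj : j = 1
    · subst hj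
      rw [update_self]
      change _ = wordTape (update σ 1 _ 1)
      rw [update_self]
      change wordTape (Φ (readWord (wordTape (σ 1)))) = _
      rw [readWord_wordTape]
    · have hj' : j.val ≠ 1 := fun h => hj (Fin.ext h)
      rw [update_of_ne hj, update_of_ne hj']
      rfl
  | @seq p q σ σ' σ'' t t' _ _ ih1 ih2 =>
    intro hb k hk hs
    simp only [bound, max_le_iff] at hb
    simp only [conts, List.cons_subset, List.append_subset] at hs
    have hq := List.mem_cons_of_mem [] (hs.2.2 (cons_mem_conts q k))
    rw [iterate_succ_apply, step_stay (List.mem_cons_of_mem _ hs.1) rfl rfl, add_comm t t',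
      iterate_add_apply, ih1 hb.1 _ hq hs.2.1, ih2 hb.2 _ hk hs.2.2]
  | @ifNil i pn p0 p1 σ σ' t h _ ih =>
    intro hb k hk hs
    simp only [bound, max_le_iff] at hb
    simp only [conts, List.cons_subset, List.append_subset] at hs
    rw [iterate_succ_apply, step_stay (l' := pn :: k) (List.mem_cons_of_mem _ hs.1) rfl,
      ih hb.2.1 _ hk hs.2.1]
    simp only [topOf_head (show i < p₀.bound + 3 from hb.1), h, wordTape_head_nil]
  | @ifCons i pn p0 p1 σ σ' t b w h _ ih =>
    intro hb k hk hs
    simp only [bound, max_le_iff] at hb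
    simp only [conts, List.cons_subset, List.append_subset] at hs
    rw [iterate_succ_apply, step_pop (l' := cond b p1 p0 :: k) (List.mem_cons_of_mem _ hs.1) rfl h,
      ih (by cases b; exacts [hb.2.2.1, hb.2.2.2]) _ hk
        (by cases b; exacts [hs.2.2.1, hs.2.2.2])]
    simp only [topOf_head (show i < p₀.bound + 3 from hb.1), h, wordTape_head_cons]
  | @loopNil i p0 p1 σ h =>
    intro hb k hk hs
    simp only [bound, max_le_iff] at hb
    simp only [conts, List.cons_subset, List.append_subset] at hs
    refine step_stay (l' := k) (List.mem_cons_of_mem _ hs.1) rfl ?_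
    simp only [topOf_head (show i < p₀.bound + 3 from hb.1), h, wordTape_head_nil]
  | @loopCons i p0 p1 σ σ' σ'' t t' b w h _ _ ih ih' =>
    intro hb k hk hs
    have ih'' := ih' hb k hk hs
    simp only [bound, max_le_iff] at hb
    simp only [conts, List.cons_subset, List.append_subset] at hs
    rw [iterate_succ_apply, step_pop (l' := cond b p1 p0 :: loop i p0 p1 :: k)
      (List.mem_cons_of_mem _ hs.1) rfl h, add_comm t t', iterate_add_apply,
      ih (by cases b; exacts [hb.2.1, hb.2.2]) _ (List.mem_cons_of_mem _ hs.1)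
        (by cases b; exacts [hs.2.1, hs.2.2]), ih'']
    simp only [topOf_head (show i < p₀.bound + 3 from hb.1), h, wordTape_head_cons]

/-- A terminating program gives a halting computation of the machine. -/
theorem machine_halts {Φ : StrFun} {p : Prog} {s : Word} {σ' : Store} {t : ℕ}
    (h : Run Φ p (fun r => if r = 0 then s else []) σ' t) :
    (machine p).HaltsIn Φ s t ∧ readWord (((machine p).run Φ s t).tape 2) = σ' 2 := by
  have hinit : (machine p).init s = cfg p [p] (fun r => if r = 0 then s else []) := by
    refine congrArg (Cfg.mk _) (funext fun j => congrArg wordTape ?_)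
    by_cases hj : j = 0
    · simp [hj]
    · rw [if_neg hj]
      exact (if_neg fun h => hj (Fin.ext h)).symm
  have hrun := run_compile (p₀ := p) h (by omega) [] (by simp) (fun _ h => h)
  unfold HaltsIn OracleTM.run
  rw [hinit, hrun]
  constructor
  · change mapAction (toState (conts p [])) (listAction p.bound (toState (conts p []) []).1) = _
    rw [toState_val (by simp)]; rfl
  · exact readWord_wordTape _

end Compile

end StackProg

namespace StackProg

open Function Prog

/-! ### Copying registers -/

theorem Run.congr {Φ : StrFun} {p : Prog} {σ σ' σ'' : Store} {t t' : ℕ} (h : Run Φ p σ σ' t)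
    (hσ : σ' = σ'') (ht : t = t') : Run Φ p σ σ'' t' := hσ ▸ ht ▸ h

/-- Moves the letters of register `i` to register `j`, in reverse order. -/
def moveRev (i j : ℕ) : Prog := loop i (push j false) (push j true)

theorem run_moveRev (Φ : StrFun) {i j : ℕ} (hij : i ≠ j) (w : Word) : ∀ σ : Store, σ i = w →
    Run Φ (moveRev i j) σ (update (update σ i []) j (w.reverse ++ σ j)) (3 * w.length + 1) := by
  induction w with
  | nil =>
    intro σ h
    have e : update σ i [] = σ := by rw [← h, update_eq_self]
    exact (Run.loopNil h).congr (by simp [e]) rfl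
  | cons b w ih =>
    intro σ h
    have hb : Run Φ (cond b (push j true) (push j false)) (update σ i w)
        (update (update σ i w) j (b :: (update σ i w) j)) 2 := by
      cases b <;> exact .push ..
    refine (Run.loopCons h hb (ih _ ?_)).congr ?_ ?_
    · simp [hij]
    · funext r
      by_cases hj : r = j
      · subst hj; simp [hij.symm]
      · by_cases hi : r = i
        · subst hi; simp [hij]
        · simp [hj, hi]
    · simp only [List.length_cons]; omega

/-- Moves the letters of register `i` to registers `j` and `k`, in reverse order. -/
def moveRev₂ (i j k : ℕ) : Prog :=
  loop i (seq (push j false) (push k false)) (seq (push j true) (push k true))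

theorem run_moveRev₂ (Φ : StrFun) {i j k : ℕ} (hij : i ≠ j) (hik : i ≠ k) (hjk : j ≠ k) (w : Word) :
    ∀ σ : Store, σ i = w → Run Φ (moveRev₂ i j k) σ
      (update (update (update σ i []) j (w.reverse ++ σ j)) k (w.reverse ++ σ k))
      (6 * w.length + 1) := by
  induction w with
  | nil =>
    intro σ h
    have e : update σ i [] = σ := by rw [← h, update_eq_self]
    exact (Run.loopNil h).congr (by simp [e]) rfl
  | cons b w ih =>
    intro σ h
    have hb : Run Φ (cond b (seq (push j true) (push k true)) (seq (push j false) (push k false)))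
        (update σ i w) (update (update (update σ i w) j (b :: (update σ i w) j)) k
          (b :: (update (update σ i w) j (b :: (update σ i w) j)) k)) 5 := by
      cases b <;> exact .seq (.push ..) (.push ..)
    refine (Run.loopCons h hb (ih _ ?_)).congr ?_ ?_
    · simp [hij, hik]
    · funext r
      by_cases hk : r = k
      · subst hk; simp [hjk.symm, hik.symm]
      by_cases hj : r = j
      · subst hj; simp [hij.symm, hjk]
      by_cases hi : r = i
      · subst hi; simp [hij, hik]
      · simp [hj, hi, hk]
    · simp only [List.length_cons]; omega

def clear (i : ℕ) : Prog := loop i nop nop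

theorem run_clear (Φ : StrFun) {i : ℕ} (w : Word) : ∀ σ : Store, σ i = w →
    Run Φ (clear i) σ (update σ i []) (2 * w.length + 1) := by
  induction w with
  | nil =>
    intro σ h
    have e : update σ i [] = σ := by rw [← h, update_eq_self]
    exact (Run.loopNil h).congr (by simp [e]) rfl
  | cons b w ih =>
    intro σ h
    have hb : Run Φ (cond b nop nop) (update σ i w) (update σ i w) 1 := by
      cases b <;> exact .nop _
    refine (Run.loopCons h hb (ih _ (by simp))).congr (by simp) ?_
    simp only [List.length_cons]; omega

/-- Copies register `i` to the front of register `j`, with the help of the empty register `k`. -/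
def copyReg (i j k : ℕ) : Prog := seq (moveRev i k) (moveRev₂ k i j)

theorem run_copyReg (Φ : StrFun) {i j k : ℕ} (hij : i ≠ j) (hik : i ≠ k) (hjk : j ≠ k) (σ : Store)
    (hk : σ k = []) : Run Φ (copyReg i j k) σ (update σ j (σ i ++ σ j))
      (9 * (σ i).length + 3) := by
  refine (Run.seq (run_moveRev Φ hik _ _ rfl)
    (run_moveRev₂ Φ hik.symm hjk.symm hij ((σ i).reverse) _ (by simp [hk]))).congr ?_ ?_
  · funext r
    by_cases h1 : r = j
    · subst h1; simp [hij.symm, hjk]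
    by_cases h2 : r = i
    · subst h2; simp [hij, hik]
    by_cases h3 : r = k
    · subst h3; simp [hik.symm, hjk.symm, hk]
    · simp [h1, h2, h3]
  · simp only [List.length_reverse]; omega

/-! ### Rewiring of registers -/

def seqN (p : ℕ → Prog) : ℕ → Prog
  | 0 => nop
  | n + 1 => seq (seqN p n) (p n)

theorem run_seqN {Φ : StrFun} {p : ℕ → Prog} {S : ℕ → Store} {T : ℕ} (N : ℕ)
    (h : ∀ k < N, ∃ t ≤ T, Run Φ (p k) (S k) (S (k + 1)) t) :
    ∃ t ≤ N * (T + 1) + 1, Run Φ (seqN p N) (S 0) (S N) t := by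
  induction N with
  | zero => exact ⟨1, by omega, .nop _⟩
  | succ N ih =>
    obtain ⟨t, ht, h1⟩ := ih fun k hk => h k (by omega)
    obtain ⟨t', ht', h2⟩ := h N (by omega)
    exact ⟨_, by rw [Nat.succ_mul]; omega, .seq h1 h2⟩

def storeSize (N : ℕ) (σ : Store) : ℕ := ∑ r ∈ Finset.range N, (σ r).length

theorem length_le_storeSize {N r : ℕ} (h : r < N) (σ : Store) : (σ r).length ≤ storeSize N σ :=
  Finset.single_le_sum (f := fun r => (σ r).length) (fun _ _ => Nat.zero_le _)
    (Finset.mem_range.2 h)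

/-- Registers can be permuted, copied and erased in linear time. -/
theorem exists_rewire (N : ℕ) (ρ : ℕ → ℕ) : ∃ (p : Prog) (C : ℕ), ∀ (Φ : StrFun) (σ : Store),
    (∀ r, N ≤ r → σ r = []) → ∃ t ≤ C * (storeSize N σ + 1),
      Run Φ p σ (fun r => if r < N then σ (ρ r) else []) t := by
  -- Three passes: copy the sources into the scratch bank `N, …, 2N - 1`, clear the registers below
  -- `N`, and copy the bank back while clearing it. Register `2N` is the auxiliary register of the
  -- copies, and a source outside the first `N` registers is empty, so nothing is copied for it.
  refine ⟨seq (seqN (fun r => if ρ r < N then copyReg (ρ r) (N + r) (2 * N) else nop) N)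
    (seq (seqN clear N) (seqN (fun r => seq (copyReg (N + r) r (2 * N)) (clear (N + r))) N)),
    36 * N + 20, fun Φ σ hσ => ?_⟩
  have hle : ∀ r, (σ r).length ≤ storeSize N σ := fun r => by
    by_cases h : r < N
    · exact length_le_storeSize h σ
    · rw [hσ r (by omega)]; exact Nat.zero_le _
  set L := storeSize N σ
  obtain ⟨t1, ht1, h1⟩ := run_seqN (Φ := Φ)
    (p := fun r => if ρ r < N then copyReg (ρ r) (N + r) (2 * N) else nop)
    (S := fun k s => if N ≤ s ∧ s < N + k then σ (ρ (s - N)) else σ s) (T := 9 * L + 3) N (by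
      intro k hk
      by_cases hρ : ρ k < N
      · simp only [hρ, if_true]
        refine ⟨_, ?_, (run_copyReg Φ (i := ρ k) (j := N + k) (k := 2 * N) (by omega) (by omega)
          (by omega) _ ?_).congr ?_ rfl⟩
        · have := hle (ρ k)
          rw [if_neg (by omega)]
          omega
        · rw [if_neg (by omega), hσ _ (by omega)]
        · funext s
          by_cases hs : s = N + k
          · subst hs
            rw [update_self, if_neg (by omega), if_neg (by omega), if_pos (by omega),
              hσ (N + k) (by omega)]
            simp
          · rw [update_of_ne hs]
            congr 1
            exact propext ⟨fun h => by omega, fun h => by omega⟩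
      · simp only [hρ, if_false]
        refine ⟨1, by omega, (Run.nop _).congr ?_ rfl⟩
        funext s
        by_cases hs : s = N + k
        · subst hs
          rw [if_neg (by omega), if_pos (by omega), hσ _ (by omega), hσ _ (by
            rw [Nat.add_sub_cancel_left]; omega)]
        · congr 1
          exact propext ⟨fun h => by omega, fun h => by omega⟩)
  obtain ⟨t2, ht2, h2⟩ := run_seqN (Φ := Φ) (p := clear)
    (S := fun k s => if s < k then [] else if N ≤ s ∧ s < N + N then σ (ρ (s - N)) else σ s)
    (T := 2 * L + 1) N (by
      intro k hk
      refine ⟨_, ?_, (run_clear Φ _ _ rfl).congr ?_ rfl⟩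
      · have := hle k
        rw [if_neg (by omega), if_neg (by omega)]
        omega
      · funext s
        by_cases hs : s = k
        · subst hs
          rw [update_self, if_pos (by omega)]
        · rw [update_of_ne hs]
          congr 1
          exact propext ⟨fun h => by omega, fun h => by omega⟩)
  obtain ⟨t3, ht3, h3⟩ := run_seqN (Φ := Φ)
    (p := fun r => seq (copyReg (N + r) r (2 * N)) (clear (N + r)))
    (S := fun k s => if s < k then σ (ρ s) else if N + k ≤ s ∧ s < 2 * N then σ (ρ (s - N)) else [])
    (T := 11 * L + 5) N (by
      intro k hk
      refine ⟨_, ?_, (Run.seq (run_copyReg Φ (i := N + k) (j := k) (k := 2 * N) (by omega) (by omega)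
        (by omega) _ ?_) (run_clear Φ _ _ rfl)).congr ?_ rfl⟩
      · have := hle (ρ k)
        rw [update_of_ne (by omega), if_neg (by omega), if_pos (by omega), Nat.add_sub_cancel_left]
        omega
      · rw [if_neg (by omega), if_neg (by omega)]
      · funext s
        by_cases hs : s = k
        · subst hs
          rw [update_of_ne (by omega), update_self, if_neg (by omega), if_pos (by omega),
            if_neg (by omega), if_neg (by omega), if_pos (by omega), Nat.add_sub_cancel_left]
          simp
        by_cases hs' : s = N + k
        · subst hs'
          rw [update_self, if_neg (by omega), if_neg (by omega)]
        · rw [update_of_ne hs', update_of_ne hs]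
          by_cases h1 : s < k
          · rw [if_pos h1, if_pos (by omega)]
          · rw [if_neg h1, if_neg (c := s < k + 1) (by omega)]
            congr 1
            exact propext ⟨fun h => by omega, fun h => by omega⟩)
  have e1 : (fun s => if N ≤ s ∧ s < N + 0 then σ (ρ (s - N)) else σ s) = σ :=
    funext fun s => if_neg (by omega)
  have e2 : (fun s => if s < 0 then [] else if N ≤ s ∧ s < N + N then σ (ρ (s - N)) else σ s) =
      (fun s => if N ≤ s ∧ s < N + N then σ (ρ (s - N)) else σ s) :=
    funext fun s => if_neg (by omega)
  have e3 : (fun s => if s < 0 then σ (ρ s) else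
      if N + 0 ≤ s ∧ s < 2 * N then σ (ρ (s - N)) else []) =
      (fun s => if s < N then [] else if N ≤ s ∧ s < N + N then σ (ρ (s - N)) else σ s) := by
    funext s
    rw [if_neg (by omega)]
    by_cases h1 : s < N
    · rw [if_pos h1, if_neg (by omega)]
    · rw [if_neg h1]
      by_cases h2 : s < 2 * N
      · rw [if_pos (by omega), if_pos (by omega)]
      · rw [if_neg (by omega), if_neg (by omega), hσ _ (by omega)]
  have e4 : (fun s => if s < N then σ (ρ s) else
      if N + N ≤ s ∧ s < 2 * N then σ (ρ (s - N)) else []) =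
      (fun s => if s < N then σ (ρ s) else []) := by
    funext s
    by_cases h1 : s < N
    · rw [if_pos h1, if_pos h1]
    · rw [if_neg h1, if_neg h1, if_neg (by omega)]
  simp only [e1] at h1
  simp only [e2] at h2
  simp only [e3, e4] at h3
  refine ⟨_, ?_, .seq h1 (.seq h2 h3)⟩
  have : t1 + (t2 + t3 + 1) + 1 ≤ N * (9 * L + 3 + 1) + 1 + (N * (2 * L + 1 + 1) + 1) +
    (N * (11 * L + 5 + 1) + 1) + 2 := by omega
  nlinarith [Nat.zero_le (N * L)]

/-! ### Data types stored in registers -/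

/-- Types whose elements are stored in a fixed number of registers. -/
class Data (α : Type) where
  regs : ℕ
  store : α → Store
  store_of_le : ∀ x r, regs ≤ r → store x r = []

open Data

def size {α : Type} [Data α] (x : α) : ℕ := storeSize (regs α) (store x)

instance : Data Word where
  regs := 1
  store w r := if r = 0 then w else []
  store_of_le _ r h := if_neg (by omega)

/-- The unary representation makes the size of a number equal to its value, and repeating something
`n` times becomes a fold over the letters of its register. -/
instance : Data ℕ where
  regs := 1
  store n r := if r = 0 then unary n else []
  store_of_le _ r h := if_neg (by omega)

instance : Data Bool where
  regs := 1
  store b r := if r = 0 then [b] else []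
  store_of_le _ r h := if_neg (by omega)

instance : Data Unit where
  regs := 0
  store _ _ := []
  store_of_le _ _ _ := rfl

instance {α β : Type} [Data α] [Data β] : Data (α × β) where
  regs := regs α + regs β
  store x := glue (regs α) (store x.1) (store x.2)
  store_of_le x r h := by rw [glue_of_le (by omega), store_of_le _ _ (by omega)]

variable {α β γ : Type} [Data α] [Data β] [Data γ]

@[simp] theorem size_word (w : Word) : size w = w.length := by
  simp [size, storeSize, regs, store]

@[simp] theorem size_nat (n : ℕ) : size n = n := by
  simp [size, storeSize, regs, store, unary]

@[simp] theorem size_bool (b : Bool) : size b = 1 := by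
  simp [size, storeSize, regs, store]

@[simp] theorem size_prod (x : α × β) : size x = size x.1 + size x.2 := by
  simp only [size, storeSize, regs, store]
  rw [Finset.sum_range_add]
  congr 1
  · exact Finset.sum_congr rfl fun r hr => by rw [glue_of_lt (Finset.mem_range.1 hr)]
  · exact Finset.sum_congr rfl fun r hr => by
      rw [glue_of_le (Nat.le_add_right _ _), Nat.add_sub_cancel_left]

theorem storeSize_store {N : ℕ} (x : α) (h : regs α ≤ N) : storeSize N (store x) = size x := by
  obtain ⟨k, rfl⟩ := Nat.exists_eq_add_of_le h
  simp only [storeSize, size]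
  rw [Finset.sum_range_add, Finset.sum_eq_zero (s := Finset.range k), add_zero]
  intro r _
  rw [store_of_le _ _ (Nat.le_add_right _ _)]
  rfl

theorem storeSize_glue {K : ℕ} (x : α) (y : β) (h : regs α ≤ K) (h' : regs β ≤ K) :
    storeSize (2 * K) (glue K (store x) (store y)) = size x + size y := by
  simp only [storeSize, two_mul]
  rw [Finset.sum_range_add, ← storeSize_store x h, ← storeSize_store y h']
  congr 1
  · exact Finset.sum_congr rfl fun r hr => by rw [glue_of_lt (Finset.mem_range.1 hr)]
  · exact Finset.sum_congr rfl fun r hr => by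
      rw [glue_of_le (Nat.le_add_right _ _), Nat.add_sub_cancel_left]

/-- The function `f`, which may depend on the oracle, is computed by a stack program that needs at
most `T` steps whenever the oracle is length-monotone. -/
def Comp (f : StrFun → α → β) (T : StrFun → α → ℕ) : Prop :=
  ∃ p : Prog, ∀ Φ, LengthMonotone Φ → ∀ x, ∃ t ≤ T Φ x, Run Φ p (store x) (store (f Φ x)) t

namespace Comp

theorem mono {f : StrFun → α → β} {T T' : StrFun → α → ℕ} (h : Comp f T)
    (hT : ∀ Φ, LengthMonotone Φ → ∀ x, T Φ x ≤ T' Φ x) : Comp f T' := by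
  obtain ⟨p, hp⟩ := h
  refine ⟨p, fun Φ hΦ x => ?_⟩
  obtain ⟨t, ht, hr⟩ := hp Φ hΦ x
  exact ⟨t, ht.trans (hT Φ hΦ x), hr⟩

theorem comp {g : StrFun → β → γ} {f : StrFun → α → β} {T U} (hg : Comp g U) (hf : Comp f T) :
    Comp (fun Φ x => g Φ (f Φ x)) (fun Φ x => T Φ x + U Φ (f Φ x) + 1) := by
  obtain ⟨p, hp⟩ := hf
  obtain ⟨q, hq⟩ := hg
  refine ⟨.seq p q, fun Φ hΦ x => ?_⟩
  obtain ⟨t, ht, hr⟩ := hp Φ hΦ x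
  obtain ⟨u, hu, hs⟩ := hq Φ hΦ (f Φ x)
  exact ⟨_, by change t + u + 1 ≤ T Φ x + U Φ (f Φ x) + 1; omega, .seq hr hs⟩

/-- Functions that only rearrange registers. -/
theorem wire (f : StrFun → α → β) (ρ : ℕ → ℕ)
    (h : ∀ Φ x, ∀ r < regs β, store (f Φ x) r = store x (ρ r)) :
    ∃ C, Comp f fun _ x => C * (size x + 1) := by
  obtain ⟨p, C, hp⟩ := exists_rewire (regs α + regs β)
    (fun r => if r < regs β then ρ r else regs α)
  refine ⟨C, p, fun Φ _ x => ?_⟩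
  obtain ⟨t, ht, hr⟩ := hp Φ (store x) fun r hr => store_of_le _ _ (by omega)
  rw [storeSize_store x (by omega)] at ht
  refine ⟨t, ht, hr.congr (funext fun r => ?_) rfl⟩
  by_cases h1 : r < regs β
  · rw [if_pos (by omega), if_pos h1, h Φ x r h1]
  · rw [if_neg h1, store_of_le x _ le_rfl, store_of_le _ _ (by omega), ite_self]

/-- The argument is duplicated into a bank of registers starting at `K`, beyond the reach of both
programs. By `Run.frame` the second copy survives the program for `f`; then the banks are swapped,
the program for `g` runs, and the two results are wired together. -/
theorem pair {f : StrFun → α → β} {g : StrFun → α → γ} {T U} (hf : Comp f T) (hg : Comp g U) :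
    ∃ C, Comp (fun Φ x => (f Φ x, g Φ x)) fun Φ x =>
      T Φ x + U Φ x + C * (size x + size (f Φ x) + size (g Φ x) + 1) := by
  obtain ⟨p, hp⟩ := hf
  obtain ⟨q, hq⟩ := hg
  obtain ⟨K, hK⟩ : ∃ K, K = p.bound + q.bound + regs α + regs β + regs γ := ⟨_, rfl⟩
  obtain ⟨p1, C1, h1⟩ := exists_rewire (2 * K) (fun r => if r < K then r else r - K)
  obtain ⟨p2, C2, h2⟩ := exists_rewire (2 * K) (fun r => if r < K then r + K else r - K)
  obtain ⟨p3, C3, h3⟩ := exists_rewire (2 * K) (fun r => if r < regs β then K + r else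
    if r < regs β + regs γ then r - regs β else 2 * K)
  refine ⟨C1 + C2 + C3 + 4, .seq p1 (.seq p (.seq p2 (.seq q p3))), fun Φ hΦ x => ?_⟩
  obtain ⟨t, ht, hr⟩ := hp Φ hΦ x
  obtain ⟨u, hu, hs⟩ := hq Φ hΦ x
  obtain ⟨t1, ht1, hr1⟩ := h1 Φ (store x) fun r hr => store_of_le _ _ (by omega)
  obtain ⟨t2, ht2, hr2⟩ := h2 Φ (glue K (store (f Φ x)) (store x)) fun r hr => by
    rw [glue_of_le (by omega), store_of_le _ _ (by omega)]
  obtain ⟨t3, ht3, hr3⟩ := h3 Φ (glue K (store (g Φ x)) (store (f Φ x))) fun r hr => by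
    rw [glue_of_le (by omega), store_of_le _ _ (by omega)]
  rw [storeSize_store x (by omega)] at ht1
  rw [storeSize_glue _ _ (by omega) (by omega)] at ht2 ht3
  have e1 : (fun r => if r < 2 * K then store x (if r < K then r else r - K) else []) =
      glue K (store x) (store x) := by
    funext r
    by_cases h : r < K
    · rw [if_pos (by omega), if_pos h, glue_of_lt h]
    · rw [if_neg h, glue_of_le (by omega)]
      by_cases h' : r < 2 * K
      · rw [if_pos h']
      · rw [if_neg h', store_of_le _ _ (by omega)]
  have e2 : (fun r => if r < 2 * K then glue K (store (f Φ x)) (store x)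
      (if r < K then r + K else r - K) else []) = glue K (store x) (store (f Φ x)) := by
    funext r
    by_cases h : r < K
    · rw [if_pos (by omega), if_pos h, glue_of_lt h, glue_of_le (by omega), Nat.add_sub_cancel]
    · rw [if_neg h, glue_of_le (K := K) (r := r) (by omega) (store x)]
      by_cases h' : r < 2 * K
      · rw [if_pos h', glue_of_lt (by omega)]
      · rw [if_neg h', store_of_le _ _ (by omega)]
  have e3 : (fun r => if r < 2 * K then glue K (store (g Φ x)) (store (f Φ x))
      (if r < regs β then K + r else if r < regs β + regs γ then r - regs β else 2 * K) else []) =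
      store (f Φ x, g Φ x) := by
    funext r
    change _ = glue (regs β) (store (f Φ x)) (store (g Φ x)) r
    by_cases h : r < regs β
    · rw [if_pos (by omega), if_pos h, glue_of_lt h, glue_of_le (by omega), Nat.add_sub_cancel_left]
    · rw [if_neg h, glue_of_le (K := regs β) (by omega)]
      by_cases h' : r < regs β + regs γ
      · rw [if_pos (by omega), if_pos h', glue_of_lt (by omega)]
      · rw [if_neg h', glue_of_le (by omega), store_of_le _ _ (by omega), ite_self,
          store_of_le _ _ (by omega)]
  rw [e1] at hr1
  rw [e2] at hr2
  rw [e3] at hr3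
  refine ⟨_, ?_, .seq hr1 (.seq (hr.frame (by omega) _) (.seq hr2
    (.seq (hs.frame (by omega) _) hr3)))⟩
  have a1 : C1 * (size x + 1) ≤ C1 * (size x + size (f Φ x) + size (g Φ x) + 1) :=
    Nat.mul_le_mul_left _ (by omega)
  have a2 : C2 * (size (f Φ x) + size x + 1) ≤ C2 * (size x + size (f Φ x) + size (g Φ x) + 1) :=
    Nat.mul_le_mul_left _ (by omega)
  have a3 : C3 * (size (g Φ x) + size (f Φ x) + 1) ≤
      C3 * (size x + size (f Φ x) + size (g Φ x) + 1) :=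
    Nat.mul_le_mul_left _ (by omega)
  change _ ≤ T Φ x + U Φ x + (C1 + C2 + C3 + 4) * _
  rw [Nat.add_mul, Nat.add_mul, Nat.add_mul]
  omega

/-- Popping and branching on the first letter. -/
theorem uncons {fn f0 f1 : StrFun → Word × α → β} {Tn T0 T1} (hn : Comp fn Tn) (h0 : Comp f0 T0)
    (h1 : Comp f1 T1) :
    Comp (fun Φ (x : Word × α) => match x.1 with
      | [] => fn Φ ([], x.2)
      | false :: w => f0 Φ (w, x.2)
      | true :: w => f1 Φ (w, x.2)) (fun Φ (x : Word × α) => (match x.1 with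
      | [] => Tn Φ ([], x.2)
      | false :: w => T0 Φ (w, x.2)
      | true :: w => T1 Φ (w, x.2)) + 1) := by
  obtain ⟨pn, hn⟩ := hn
  obtain ⟨p0, h0⟩ := h0
  obtain ⟨p1, h1⟩ := h1
  refine ⟨.ifTop 0 pn p0 p1, fun Φ hΦ x => ?_⟩
  obtain ⟨w, x⟩ := x
  have key : ∀ (b : Bool) (w : Word), update (store (b :: w, x)) 0 w = store (w, x) := by
    intro b w
    change update (glue 1 _ _) 0 _ = glue 1 _ _
    rw [← glue_update (by omega)]
    congr 1
    funext r
    by_cases hr : r = 0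
    · subst hr; simp [store]
    · simp [store, hr]
  match w with
  | [] =>
    obtain ⟨t, ht, hr⟩ := hn Φ hΦ ([], x)
    exact ⟨t + 1, by simpa using ht, .ifNil rfl hr⟩
  | false :: w =>
    obtain ⟨t, ht, hr⟩ := h0 Φ hΦ (w, x)
    exact ⟨t + 1, by simpa using ht, .ifCons (b := false) (w := w) rfl (by rw [key]; exact hr)⟩
  | true :: w =>
    obtain ⟨t, ht, hr⟩ := h1 Φ hΦ (w, x)
    exact ⟨t + 1, by simpa using ht, .ifCons (b := true) (w := w) rfl (by rw [key]; exact hr)⟩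

theorem cons (b : Bool) : Comp (fun _ (w : Word) => b :: w) fun _ _ => 2 := by
  refine ⟨.push 0 b, fun Φ _ w => ⟨2, le_rfl, (Run.push ..).congr ?_ rfl⟩⟩
  funext r
  by_cases hr : r = 0
  · subst hr; simp [store]
  · simp [store, hr]

/-- A query acts on register `1`, whereas arguments and results start in register `0`; hence one
rewiring before the query and one after it. -/
theorem oracle : ∃ C, Comp (fun Φ (w : Word) => Φ w) fun Φ w =>
    C * (w.length + (Φ w).length + 1) := by
  obtain ⟨p1, C1, h1⟩ := exists_rewire 3 (fun r => if r = 1 then 0 else 2)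
  obtain ⟨p2, C2, h2⟩ := exists_rewire 3 (fun r => if r = 0 then 1 else 2)
  refine ⟨C1 + C2 + 3, .seq p1 (.seq .query p2), fun Φ _ w => ?_⟩
  have hs : ∀ w : Word, (∀ r, 3 ≤ r → update (fun _ => [] : Store) 1 w r = []) := fun w r hr => by
    rw [update_of_ne (by omega)]
  obtain ⟨t1, ht1, hr1⟩ := h1 Φ (store w) fun r hr => if_neg (by omega)
  obtain ⟨t2, ht2, hr2⟩ := h2 Φ (update (fun _ => []) 1 (Φ w)) (hs _)
  have e1 : (fun r => if r < 3 then store w (if r = 1 then 0 else 2) else []) =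
      update (fun _ => []) 1 w := by
    funext r
    by_cases hr : r = 1
    · subst hr; simp [store]
    · simp [store, hr]
  have e2 : (fun r => if r < 3 then update (fun _ => [] : Store) 1 (Φ w) (if r = 0 then 1 else 2)
      else []) = store (Φ w) := by
    funext r
    by_cases hr : r = 0
    · subst hr; simp [store]
    · simp [store, hr]
  rw [e1] at hr1
  rw [e2] at hr2
  have hq := Run.query (Φ := Φ) (update (fun _ => []) 1 w)
  rw [update_self, update_idem] at hq
  refine ⟨_, ?_, .seq hr1 (.seq hq hr2)⟩
  have s1 : storeSize 3 (store w) = w.length := by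
    simp [storeSize, Finset.sum_range_succ, store]
  have s2 : storeSize 3 (update (fun _ => [] : Store) 1 (Φ w)) = (Φ w).length := by
    simp [storeSize, Finset.sum_range_succ]
  rw [s1] at ht1
  rw [s2] at ht2
  have a1 : C1 * (w.length + 1) ≤ C1 * (w.length + (Φ w).length + 1) :=
    Nat.mul_le_mul_left _ (by omega)
  have a2 : C2 * ((Φ w).length + 1) ≤ C2 * (w.length + (Φ w).length + 1) :=
    Nat.mul_le_mul_left _ (by omega)
  change _ ≤ (C1 + C2 + 3) * _
  rw [Nat.add_mul, Nat.add_mul]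
  omega

/-- The cost of the iterations of a fold. -/
def foldCost (f : StrFun → Bool → α → α) (T : StrFun → Bool → α → ℕ) (Φ : StrFun) :
    Word → α → ℕ
  | [], _ => 1
  | b :: w, x => T Φ b x + foldCost f T Φ w (f Φ b x) + 1

/-- The word to be consumed is moved to register `K`, above all registers of the two loop bodies, so
that the bodies run on the state alone and `Run.frame` protects the remaining letters. -/
theorem foldl {f : StrFun → Bool → α → α} {T : StrFun → Bool → α → ℕ}
    (h : ∀ b, Comp (fun Φ => f Φ b) (fun Φ => T Φ b)) :
    ∃ C, Comp (fun Φ (x : Word × α) => x.1.foldl (fun a b => f Φ b a) x.2) fun Φ x =>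
      C * (size x + 1) + foldCost f T Φ x.1 x.2 := by
  obtain ⟨p0, h0⟩ := h false
  obtain ⟨p1, h1⟩ := h true
  obtain ⟨K, hK⟩ : ∃ K, K = p0.bound + p1.bound + regs α := ⟨_, rfl⟩
  obtain ⟨p, C, hp⟩ := exists_rewire (K + 2)
    (fun r => if r < K then r + 1 else if r = K then 0 else K + 2)
  refine ⟨C + 1, .seq p (.loop K p0 p1), fun Φ hΦ x => ?_⟩
  obtain ⟨w, x⟩ := x
  obtain ⟨t, ht, hr⟩ := hp Φ (store (w, x)) fun r hr => store_of_le _ _ (by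
    change 1 + regs α ≤ r; omega)
  rw [storeSize_store _ (by change 1 + regs α ≤ K + 2; omega)] at ht
  have e : (fun r => if r < K + 2 then store (w, x)
      (if r < K then r + 1 else if r = K then 0 else K + 2) else []) =
      glue K (store x) (store w) := by
    funext r
    change (if r < K + 2 then glue 1 (store w) (store x) _ else []) = _
    by_cases h : r < K
    · rw [if_pos (by omega), if_pos h, glue_of_lt h, glue_of_le (by omega), Nat.add_sub_cancel]
    · rw [if_neg h, glue_of_le (K := K) (by omega) (store x)]
      by_cases h' : r = K
      · rw [if_pos (by omega), if_pos h', h', Nat.sub_self, glue_of_lt (by omega)]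
      · rw [if_neg h', glue_of_le (by omega), store_of_le _ _ (by omega), ite_self,
          store_of_le _ _ (by change 1 ≤ r - K; omega)]
  rw [e] at hr
  have loop : ∀ (w : Word) (x : α), ∃ t ≤ foldCost f T Φ w x, Run Φ (.loop K p0 p1)
      (glue K (store x) (store w)) (store (w.foldl (fun a b => f Φ b a) x)) t := by
    intro w
    induction w with
    | nil =>
      intro x
      refine ⟨1, le_rfl, (Run.loopNil ?_).congr ?_ rfl⟩
      · rw [glue_of_le le_rfl]; simp [store]
      · funext r
        by_cases h : r < K
        · rw [glue_of_lt h]; rfl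
        · rw [glue_of_le (by omega), List.foldl_nil, store_of_le _ r (by omega)]
          simp [store]
    | cons b w ih =>
      intro x
      obtain ⟨t', ht', hr'⟩ := ih (f Φ b x)
      have hb : ∃ t ≤ T Φ b x, Run Φ (cond b p1 p0) (store x) (store (f Φ b x)) t := by
        cases b
        · exact h0 Φ hΦ x
        · exact h1 Φ hΦ x
      obtain ⟨t, ht, hr⟩ := hb
      refine ⟨t + t' + 1, by simp only [foldCost]; omega, .loopCons (b := b) (w := w) ?_ ?_ hr'⟩
      · rw [glue_of_le le_rfl, Nat.sub_self]; rfl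
      · have hb : (cond b p1 p0).bound ≤ K := by cases b <;> simp only [cond] <;> omega
        convert hr.frame hb (store w) using 1
        funext r
        by_cases h : r = K
        · rw [h, update_self, glue_of_le le_rfl, Nat.sub_self]; rfl
        · rw [update_of_ne h]
          by_cases h' : r < K
          · rw [glue_of_lt h', glue_of_lt h']
          · rw [glue_of_le (by omega), glue_of_le (by omega),
              store_of_le _ _ (by change 1 ≤ r - K; omega),
              store_of_le _ _ (by change 1 ≤ r - K; omega)]
  obtain ⟨t', ht', hr'⟩ := loop w x
  refine ⟨_, ?_, .seq hr hr'⟩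
  change t + t' + 1 ≤ (C + 1) * _ + foldCost f T Φ w x
  rw [Nat.add_mul]
  omega

end Comp

end StackProg

/-! ### Second-order polynomial bounds -/

namespace SecondOrderPoly

theorem eval_mono (P : SecondOrderPoly) {L : ℕ → ℕ} (hL : Monotone L) : Monotone (P.eval L) := by
  intro m n h
  induction P with
  | const => exact le_rfl
  | var => exact h
  | add P Q hP hQ => exact Nat.add_le_add hP hQ
  | mul P Q hP hQ => exact Nat.mul_le_mul hP hQ
  | app P hP => exact hL hP

/-- Substitution of `Q` for the number variable. -/
def subst (P Q : SecondOrderPoly) : SecondOrderPoly :=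
  match P with
  | const m => const m
  | var => Q
  | add P P' => add (P.subst Q) (P'.subst Q)
  | mul P P' => mul (P.subst Q) (P'.subst Q)
  | app P => app (P.subst Q)

theorem eval_subst (P Q : SecondOrderPoly) (L : ℕ → ℕ) (n : ℕ) :
    (P.subst Q).eval L n = P.eval L (Q.eval L n) := by
  induction P with
  | const => rfl
  | var => rfl
  | add P P' h h' => simp only [subst, eval, h, h']
  | mul P P' h h' => simp only [subst, eval, h, h']
  | app P h => simp only [subst, eval, h]

end SecondOrderPoly

theorem LengthMonotone.fnLength_mono {Φ : StrFun} (h : LengthMonotone Φ) :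
    Monotone (fnLength Φ) := fun m n hmn => h _ _ (by simpa [unary] using hmn)

/-- Words of equal length have answers of equal length, by monotonicity in both directions. Thus the
size of an oracle answer is governed by the length of the query, and second-order polynomials can
bound it. -/
theorem LengthMonotone.length_eq {Φ : StrFun} (h : LengthMonotone Φ) (w : Word) :
    (Φ w).length = fnLength Φ w.length :=
  le_antisymm (h _ _ (by simp [unary])) (h _ _ (by simp [unary]))

namespace StackProg

open Function Data

variable {α β γ : Type} [Data α] [Data β] [Data γ]

/-- `T` is bounded by a second-order polynomial in the lengths of the oracle and of the argument. -/
def Bdd (T : StrFun → α → ℕ) : Prop :=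
  ∃ P : SecondOrderPoly, ∀ Φ, LengthMonotone Φ → ∀ x, T Φ x ≤ P.eval (fnLength Φ) (size x)

namespace Bdd

theorem mono {T T' : StrFun → α → ℕ} (h : Bdd T')
    (hT : ∀ Φ, LengthMonotone Φ → ∀ x, T Φ x ≤ T' Φ x) : Bdd T := by
  obtain ⟨P, hP⟩ := h
  exact ⟨P, fun Φ hΦ x => (hT Φ hΦ x).trans (hP Φ hΦ x)⟩

theorem const (m : ℕ) : Bdd fun _ (_ : α) => m := ⟨.const m, fun _ _ _ => le_rfl⟩

theorem size : Bdd fun _ (x : α) => size x := ⟨.var, fun _ _ _ => le_rfl⟩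

theorem add {T U : StrFun → α → ℕ} (hT : Bdd T) (hU : Bdd U) : Bdd fun Φ x => T Φ x + U Φ x := by
  obtain ⟨P, hP⟩ := hT
  obtain ⟨Q, hQ⟩ := hU
  exact ⟨.add P Q, fun Φ hΦ x => Nat.add_le_add (hP Φ hΦ x) (hQ Φ hΦ x)⟩

theorem mul {T U : StrFun → α → ℕ} (hT : Bdd T) (hU : Bdd U) : Bdd fun Φ x => T Φ x * U Φ x := by
  obtain ⟨P, hP⟩ := hT
  obtain ⟨Q, hQ⟩ := hU
  exact ⟨.mul P Q, fun Φ hΦ x => Nat.mul_le_mul (hP Φ hΦ x) (hQ Φ hΦ x)⟩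

theorem fnLength {T : StrFun → α → ℕ} (hT : Bdd T) : Bdd fun Φ x => fnLength Φ (T Φ x) := by
  obtain ⟨P, hP⟩ := hT
  exact ⟨.app P, fun Φ hΦ x => hΦ.fnLength_mono (hP Φ hΦ x)⟩

theorem poly (P : SecondOrderPoly) {T : StrFun → α → ℕ} (hT : Bdd T) :
    Bdd fun Φ x => P.eval (_root_.fnLength Φ) (T Φ x) := by
  obtain ⟨Q, hQ⟩ := hT
  refine ⟨P.subst Q, fun Φ hΦ x => ?_⟩
  rw [SecondOrderPoly.eval_subst]
  exact P.eval_mono hΦ.fnLength_mono (hQ Φ hΦ x)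

theorem comp {T : StrFun → β → ℕ} {f : StrFun → α → β} (hT : Bdd T)
    (hf : Bdd fun Φ x => StackProg.size (f Φ x)) : Bdd fun Φ x => T Φ (f Φ x) := by
  obtain ⟨P, hP⟩ := hT
  exact (poly P hf).mono fun Φ hΦ x => hP Φ hΦ _

end Bdd

/-! ### Second-order polynomial time and its closure properties -/

/-- Functions that are computable in second-order polynomial time. -/
def PT (f : StrFun → α → β) : Prop :=
  (∃ T, Comp f T ∧ Bdd T) ∧ Bdd fun Φ x => size (f Φ x)

theorem Comp.of_store {f : StrFun → α → β} {g : StrFun → α → γ} {T} (h : Comp f T)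
    (hs : ∀ Φ x, store (g Φ x) = store (f Φ x)) : Comp g T := by
  obtain ⟨p, hp⟩ := h
  exact ⟨p, fun Φ hΦ x => by rw [hs]; exact hp Φ hΦ x⟩

/-- The invariant `I` is indexed by the number of letters that are still to come, so it can express
a budget that shrinks during the fold. -/
theorem Comp.foldCost_le {α : Type} {f : StrFun → Bool → α → α} {T : StrFun → Bool → α → ℕ} {Φ : StrFun}
    {B : ℕ} (I : ℕ → α → Prop) (h : ∀ k b x, I (k + 1) x → T Φ b x ≤ B ∧ I k (f Φ b x)) (w : Word) :
    ∀ x, I w.length x → foldCost f T Φ w x ≤ w.length * (B + 1) + 1 := by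
  induction w with
  | nil => intro x _; simp [foldCost]
  | cons b w ih =>
    intro x hx
    obtain ⟨h1, h2⟩ := h _ b x hx
    have := ih _ h2
    simp only [foldCost, List.length_cons, Nat.succ_mul]
    omega

namespace PT

/-- The time for `g` is polynomial in the size of the intermediate value `f Φ x`; the size bound in
`PT` is recorded for this purpose. -/
theorem comp {g : StrFun → β → γ} {f : StrFun → α → β} (hg : PT g) (hf : PT f) :
    PT fun Φ x => g Φ (f Φ x) := by
  obtain ⟨⟨U, hU, hU'⟩, hg⟩ := hg
  obtain ⟨⟨T, hT, hT'⟩, hf⟩ := hf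
  exact ⟨⟨_, hU.comp hT, (hT'.add (hU'.comp hf)).add (.const 1)⟩, hg.comp hf⟩

theorem pair {f : StrFun → α → β} {g : StrFun → α → γ} (hf : PT f) (hg : PT g) :
    PT fun Φ x => (f Φ x, g Φ x) := by
  obtain ⟨⟨T, hT, hT'⟩, hf⟩ := hf
  obtain ⟨⟨U, hU, hU'⟩, hg⟩ := hg
  obtain ⟨C, hC⟩ := hT.pair hU
  exact ⟨⟨_, hC, (hT'.add hU').add ((Bdd.const C).mul (((Bdd.size.add hf).add hg).add (.const 1)))⟩,
    (hf.add hg).mono fun Φ _ x => by rw [size_prod]⟩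

/-- Programs only see registers, so words, unary numbers and one-letter Booleans with the same
contents are interchangeable. -/
theorem of_store {f : StrFun → α → β} {g : StrFun → α → γ} (h : PT f)
    (hs : ∀ Φ x, store (g Φ x) = store (f Φ x))
    (hz : ∀ Φ x, StackProg.size (g Φ x) = StackProg.size (f Φ x)) : PT g := by
  obtain ⟨⟨T, hT, hT'⟩, hf⟩ := h
  exact ⟨⟨T, hT.of_store hs, hT'⟩, hf.mono fun Φ _ x => (hz Φ x).le⟩

theorem wire {f : StrFun → α → β} (ρ : ℕ → ℕ)
    (h : ∀ Φ x, ∀ r < regs β, store (f Φ x) r = store x (ρ r))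
    (hs : Bdd fun Φ x => StackProg.size (f Φ x)) : PT f := by
  obtain ⟨C, hC⟩ := Comp.wire f ρ h
  exact ⟨⟨_, hC, (Bdd.const C).mul (Bdd.size.add (.const 1))⟩, hs⟩

theorem id : PT fun _ (x : α) => x := wire (fun r => r) (fun _ _ _ _ => rfl) .size

theorem fst' : PT fun _ (x : α × β) => x.1 :=
  wire (fun r => r) (fun _ _ _ h => (glue_of_lt h _ _).symm)
    (Bdd.size.mono fun _ _ x => by rw [size_prod]; omega)

theorem snd' : PT fun _ (x : α × β) => x.2 :=
  wire (fun r => regs α + r) (fun _ x r _ => by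
    change _ = glue _ _ _ _
    rw [glue_of_le (Nat.le_add_right _ _), Nat.add_sub_cancel_left])
    (Bdd.size.mono fun _ _ x => by rw [size_prod]; omega)

theorem fst {f : StrFun → γ → α × β} (h : PT f) : PT fun Φ x => (f Φ x).1 := fst'.comp h

theorem snd {f : StrFun → γ → α × β} (h : PT f) : PT fun Φ x => (f Φ x).2 := snd'.comp h

theorem cons (b : Bool) {f : StrFun → α → Word} (h : PT f) : PT fun Φ x => b :: f Φ x :=
  comp (g := fun _ w => b :: w) ⟨⟨_, Comp.cons b, .const 2⟩,
    (Bdd.size.add (.const 1)).mono fun _ _ w => by simp⟩ h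

theorem const (w : Word) : PT fun _ (_ : α) => w := by
  induction w with
  | nil =>
    refine wire (fun _ => regs α) (fun _ x r _ => ?_) (.mono (.const 0) fun _ _ _ => by simp)
    rw [store_of_le x _ le_rfl]
    exact ite_self _
  | cons b w ih => exact ih.cons b

theorem oracle {f : StrFun → α → Word} (h : PT f) : PT fun Φ x => Φ (f Φ x) := by
  obtain ⟨C, hC⟩ := Comp.oracle
  have hb : Bdd fun Φ (w : Word) => (Φ w).length :=
    (Bdd.fnLength Bdd.size).mono fun Φ hΦ w => by rw [hΦ.length_eq, size_word]
  have hw : Bdd fun _ (w : Word) => w.length := Bdd.size.mono fun _ _ w => by simp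
  exact comp (g := fun Φ w => Φ w) ⟨⟨_, hC, (Bdd.const C).mul ((hw.add hb).add (.const 1))⟩,
    hb.mono fun _ _ w => by simp⟩ h

end PT

/-- Case distinction on the first letter of a word. -/
def wcases {β : Type} (w : Word) (a : β) (f0 f1 : Word → β) : β :=
  match w with
  | [] => a
  | false :: w => f0 w
  | true :: w => f1 w

@[simp] theorem wcases_nil {β : Type} (a : β) (f0 f1) : wcases [] a f0 f1 = a := rfl
@[simp] theorem wcases_false {β : Type} (w) (a : β) (f0 f1) :
    wcases (false :: w) a f0 f1 = f0 w := rfl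
@[simp] theorem wcases_true {β : Type} (w) (a : β) (f0 f1) :
    wcases (true :: w) a f0 f1 = f1 w := rfl

namespace PT

theorem wcases {w : StrFun → α → Word} {a : StrFun → α → β} {f0 f1 : StrFun → α → Word → β}
    (hw : PT w) (ha : PT a) (h0 : PT fun Φ (p : α × Word) => f0 Φ p.1 p.2)
    (h1 : PT fun Φ (p : α × Word) => f1 Φ p.1 p.2) :
    PT fun Φ x => wcases (w Φ x) (a Φ x) (f0 Φ x) (f1 Φ x) := by
  have ha : PT fun Φ (p : Word × α) => a Φ p.2 := ha.comp snd'
  have h0 : PT fun Φ (p : Word × α) => f0 Φ p.2 p.1 := h0.comp (snd'.pair fst')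
  have h1 : PT fun Φ (p : Word × α) => f1 Φ p.2 p.1 := h1.comp (snd'.pair fst')
  refine comp (g := fun Φ (p : Word × α) =>
    StackProg.wcases p.1 (a Φ p.2) (f0 Φ p.2) (f1 Φ p.2)) ?_ (hw.pair id)
  obtain ⟨⟨T, hT, P, hP⟩, Q, hQ⟩ := ha
  obtain ⟨⟨T0, hT0, P0, hP0⟩, Q0, hQ0⟩ := h0
  obtain ⟨⟨T1, hT1, P1, hP1⟩, Q1, hQ1⟩ := h1
  have mono : ∀ (P : SecondOrderPoly) Φ, LengthMonotone Φ → ∀ b (w : Word) (x : α),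
      P.eval (fnLength Φ) (StackProg.size (w, x)) ≤
        P.eval (fnLength Φ) (StackProg.size (b :: w, x)) :=
    fun P Φ hΦ b w x => P.eval_mono hΦ.fnLength_mono (by simp)
  constructor
  · refine ⟨fun Φ p => P.eval (fnLength Φ) (StackProg.size p) + P0.eval (fnLength Φ)
      (StackProg.size p) + P1.eval (fnLength Φ) (StackProg.size p) + 1, ?_,
      (((Bdd.poly _ .size).add (.poly _ .size)).add (.poly _ .size)).add (.const 1)⟩
    refine ((hT.uncons hT0 hT1).of_store (g := fun Φ (p : Word × α) =>
      StackProg.wcases p.1 (a Φ p.2) (f0 Φ p.2) (f1 Φ p.2)) ?_).mono ?_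
    · rintro Φ ⟨_ | ⟨_ | _, w⟩, x⟩ <;> rfl
    · rintro Φ hΦ ⟨_ | ⟨_ | _, w⟩, x⟩
      · have := hP Φ hΦ ([], x)
        simp only; omega
      · have := hP0 Φ hΦ (w, x)
        have := mono P0 Φ hΦ false w x
        simp only; omega
      · have := hP1 Φ hΦ (w, x)
        have := mono P1 Φ hΦ true w x
        simp only; omega
  · refine (((Bdd.poly Q .size).add (.poly Q0 .size)).add (.poly Q1 .size)).mono ?_
    rintro Φ hΦ ⟨_ | ⟨_ | _, w⟩, x⟩
    · have : StackProg.size (a Φ x) ≤ _ := hQ Φ hΦ ([], x)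
      simp only [wcases_nil]; omega
    · have : StackProg.size (f0 Φ x w) ≤ _ := hQ0 Φ hΦ (w, x)
      have := mono Q0 Φ hΦ false w x
      simp only [wcases_false]; omega
    · have : StackProg.size (f1 Φ x w) ≤ _ := hQ1 Φ hΦ (w, x)
      have := mono Q1 Φ hΦ true w x
      simp only [wcases_true]; omega

/-- Iteration over the letters of a word, if the state grows by a bounded amount in each step. -/
theorem foldl {w : StrFun → γ → Word} {x : StrFun → γ → α} {f : StrFun → γ → Bool → α → α}
    (hw : PT w) (hx : PT x) (hf : ∀ b, PT fun Φ (p : γ × α) => f Φ p.1 b p.2) {G : StrFun → γ → ℕ}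
    (hG : Bdd G) (h : ∀ Φ, LengthMonotone Φ → ∀ c b a,
      StackProg.size (f Φ c b a) ≤ StackProg.size a + G Φ c) :
    PT fun Φ c => (w Φ c).foldl (fun a b => f Φ c b a) (x Φ c) := by
  have hs : ∀ b, PT fun Φ (p : γ × α) => (p.1, f Φ p.1 b p.2) := fun b => fst'.pair (hf b)
  choose T hT hTB using fun b => (hs b).1
  have hTB' : Bdd fun Φ p => T false Φ p + T true Φ p := (hTB false).add (hTB true)
  obtain ⟨P, hP⟩ := hTB'
  -- The parameter `c` is carried along unchanged as the first component of the state.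
  obtain ⟨C, hC⟩ := Comp.foldl (f := fun Φ b (p : γ × α) => (p.1, f Φ p.1 b p.2))
    (T := fun Φ b p => T b Φ p) hT
  have key : ∀ Φ c (v : Word) a, v.foldl (fun (p : γ × α) b => (p.1, f Φ p.1 b p.2)) (c, a) =
      (c, v.foldl (fun a b => f Φ c b a) a) := by
    intro Φ c v
    induction v with
    | nil => intro a; rfl
    | cons b v ih => intro a; exact ih _
  have hsz : ∀ Φ, LengthMonotone Φ → ∀ c (v : Word) a,
      StackProg.size (v.foldl (fun a b => f Φ c b a) a) ≤ StackProg.size a + v.length * G Φ c := by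
    intro Φ hΦ c v
    induction v with
    | nil => intro a; simp
    | cons b v ih =>
      intro a
      have := ih (f Φ c b a)
      have := h Φ hΦ c b a
      simp only [List.foldl_cons, List.length_cons, Nat.succ_mul]
      omega
  obtain ⟨⟨S, hS, hSB⟩, hSz⟩ := hw.pair (id.pair hx)
  have hwl : Bdd fun Φ c => (w Φ c).length := hw.2.mono fun Φ _ c => by simp
  have hM : Bdd fun Φ c => StackProg.size (x Φ c) + (w Φ c).length * G Φ c :=
    hx.2.add (hwl.mul hG)
  obtain ⟨⟨S', hS', hSB'⟩, -⟩ := (snd' : PT fun _ (p : γ × α) => p.2)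
  refine ⟨⟨_, ((hS'.comp (hC.comp hS)).of_store (g := fun Φ c =>
    (w Φ c).foldl (fun a b => f Φ c b a) (x Φ c)) fun Φ c => by rw [key]).mono
    (T' := fun Φ c => S Φ c + (C * (StackProg.size (w Φ c, c, x Φ c) + 1) +
      ((w Φ c).length * (P.eval (fnLength Φ) (StackProg.size c + (StackProg.size (x Φ c) +
        (w Φ c).length * G Φ c)) + 1) + 1)) + 1 +
      S' Φ (c, (w Φ c).foldl (fun a b => f Φ c b a) (x Φ c)) + 1) ?_, ?_⟩, ?_⟩
  · intro Φ hΦ c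
    -- With `k` letters left, the size of the state plus `k` future growths stays below the initial
    -- size plus the total growth, so one bound serves every round.
    have := Comp.foldCost_le (f := fun Φ b (p : γ × α) => (p.1, f Φ p.1 b p.2))
      (T := fun Φ b p => T b Φ p) (Φ := Φ) (B := P.eval (fnLength Φ) (StackProg.size c +
        (StackProg.size (x Φ c) + (w Φ c).length * G Φ c)))
      (fun k p => p.1 = c ∧ StackProg.size p.2 + k * G Φ c ≤
        StackProg.size (x Φ c) + (w Φ c).length * G Φ c) (by
        rintro k b ⟨c', a⟩ ⟨rfl, ha⟩
        simp only [Nat.succ_mul] at ha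
        refine ⟨?_, rfl, ?_⟩
        · have h1 : T false Φ (c', a) + T true Φ (c', a) ≤ _ := hP Φ hΦ (c', a)
          have h2 : P.eval (fnLength Φ) (StackProg.size (c', a)) ≤ _ :=
            P.eval_mono hΦ.fnLength_mono (show StackProg.size (c', a) ≤ StackProg.size c' +
              (StackProg.size (x Φ c') + (w Φ c').length * G Φ c') by
                rw [size_prod]; simp only; omega)
          cases b <;> simp only <;> omega
        · have := h Φ hΦ c' b a
          simp only; omega) (w Φ c) (c, x Φ c) ⟨rfl, le_rfl⟩
    simp only [key]
    omega
  · refine ((((hSB.add (((Bdd.const C).mul (hSz.add (.const 1))).add ((hwl.mul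
      ((Bdd.poly P (Bdd.size.add hM)).add (.const 1))).add (.const 1)))).add (.const 1)).add
      ((hSB'.comp (f := fun Φ c => (c, (w Φ c).foldl (fun a b => f Φ c b a) (x Φ c)))
        ((Bdd.size.add hM).mono ?_)))).add (.const 1))
    intro Φ hΦ c
    rw [size_prod]
    have := hsz Φ hΦ c (w Φ c) (x Φ c)
    simp only; omega
  · exact hM.mono fun Φ hΦ c => hsz Φ hΦ c _ _

/-! ### Elementary functions -/

theorem nat_to_word {f : StrFun → α → ℕ} (h : PT f) : PT fun Φ x => unary (f Φ x) :=
  h.of_store (fun _ _ => rfl) fun _ _ => by simp [unary]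

theorem zero : PT fun _ (_ : α) => (0 : ℕ) :=
  (const []).of_store (fun _ _ => rfl) fun _ _ => by simp

theorem succ {f : StrFun → α → ℕ} (h : PT f) : PT fun Φ x => f Φ x + 1 :=
  (h.nat_to_word.cons false).of_store (fun _ _ => rfl) fun _ _ => by simp [unary]

theorem nat (n : ℕ) : PT fun _ (_ : α) => n := by
  induction n with
  | zero => exact zero
  | succ n ih => exact ih.succ

theorem bool (b : Bool) : PT fun _ (_ : α) => b :=
  (const [b]).of_store (fun _ _ => rfl) fun _ _ => by simp

theorem cond {b : StrFun → α → Bool} {f g : StrFun → α → β} (hb : PT b) (hf : PT f) (hg : PT g) :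
    PT fun Φ x => cond (b Φ x) (f Φ x) (g Φ x) := by
  have h : PT fun Φ x => ([b Φ x] : Word) := hb.of_store (fun _ _ => rfl) fun _ _ => by simp
  have := wcases h hf (f0 := fun Φ x _ => g Φ x) (f1 := fun Φ x _ => f Φ x)
    (hg.comp fst') (hf.comp fst')
  convert this using 3 with Φ x
  cases b Φ x <;> rfl

theorem and {b c : StrFun → α → Bool} (hb : PT b) (hc : PT c) : PT fun Φ x => b Φ x && c Φ x := by
  convert hb.cond hc (bool false) using 3 with Φ x
  cases b Φ x <;> rfl

theorem not {b : StrFun → α → Bool} (hb : PT b) : PT fun Φ x => !b Φ x := by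
  convert hb.cond (bool false) (bool true) using 3 with Φ x
  cases b Φ x <;> rfl

theorem cons' {b : StrFun → α → Bool} {f : StrFun → α → Word} (hb : PT b) (h : PT f) :
    PT fun Φ x => b Φ x :: f Φ x := by
  convert hb.cond (h.cons true) (h.cons false) using 3 with Φ x
  cases b Φ x <;> rfl

theorem tail {f : StrFun → α → Word} (h : PT f) : PT fun Φ x => (f Φ x).tail := by
  convert h.wcases (const []) (f0 := fun _ _ w => w) (f1 := fun _ _ w => w) snd' snd'
    using 3 with Φ x
  rcases f Φ x with _ | ⟨_ | _, w⟩ <;> rfl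

theorem headD {f : StrFun → α → Word} (h : PT f) : PT fun Φ x => (f Φ x).headD false := by
  convert h.wcases (bool false) (f0 := fun _ _ _ => false) (f1 := fun _ _ _ => true)
    (bool false) (bool true) using 3 with Φ x
  rcases f Φ x with _ | ⟨_ | _, w⟩ <;> rfl

theorem reverseAppend {f g : StrFun → α → Word} (hf : PT f) (hg : PT g) :
    PT fun Φ x => (f Φ x).reverse ++ g Φ x := by
  have := foldl (f := fun _ (_ : α) b (a : Word) => b :: a) hf hg (fun b => snd'.cons b)
    (Bdd.const 1) (fun _ _ _ _ _ => by simp)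
  convert this using 3 with Φ x
  generalize g Φ x = v
  induction f Φ x generalizing v with
  | nil => rfl
  | cons b w ih => simp [← ih]

theorem reverse {f : StrFun → α → Word} (hf : PT f) : PT fun Φ x => (f Φ x).reverse := by
  simpa using hf.reverseAppend (const [])

theorem append {f g : StrFun → α → Word} (hf : PT f) (hg : PT g) :
    PT fun Φ x => f Φ x ++ g Φ x := by
  simpa using hf.reverse.reverseAppend hg

theorem length {f : StrFun → α → Word} (hf : PT f) : PT fun Φ x => (f Φ x).length := by
  have := foldl (f := fun _ (_ : α) _ (a : ℕ) => a + 1) hf zero (fun b => snd'.succ)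
    (Bdd.const 1) (fun _ _ _ _ _ => by simp)
  convert this using 3 with Φ x
  have : ∀ (w : Word) (n : ℕ), w.foldl (fun a _ => a + 1) n = n + w.length := by
    intro w
    induction w with
    | nil => intro n; rfl
    | cons b w ih => intro n; simp only [List.foldl_cons, ih, List.length_cons]; omega
  rw [this, zero_add]

end PT

theorem foldl_unary {α : Type} (f : α → α) (n : ℕ) :
    ∀ x, (unary n).foldl (fun a _ => f a) x = f^[n] x := by
  induction n with
  | zero => intro x; rfl
  | succ n ih => intro x; exact ih _

namespace PT

/-- Iteration, if the state grows by a bounded amount in each step. -/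
theorem iterate {n : StrFun → γ → ℕ} {x : StrFun → γ → α} {f : StrFun → γ → α → α}
    (hn : PT n) (hx : PT x) (hf : PT fun Φ (p : γ × α) => f Φ p.1 p.2) {G : StrFun → γ → ℕ}
    (hG : Bdd G) (h : ∀ Φ, LengthMonotone Φ → ∀ c a,
      StackProg.size (f Φ c a) ≤ StackProg.size a + G Φ c) :
    PT fun Φ c => (f Φ c)^[n Φ c] (x Φ c) := by
  have := foldl (f := fun Φ c _ a => f Φ c a) hn.nat_to_word hx (fun _ => hf) hG
    fun Φ hΦ c _ a => h Φ hΦ c a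
  convert this using 3 with Φ c
  rw [foldl_unary]

theorem add {f g : StrFun → α → ℕ} (hf : PT f) (hg : PT g) : PT fun Φ x => f Φ x + g Φ x := by
  convert (hf.nat_to_word.append hg.nat_to_word).length using 3
  simp [unary]

theorem sub {f g : StrFun → α → ℕ} (hf : PT f) (hg : PT g) : PT fun Φ x => f Φ x - g Φ x := by
  have := iterate (f := fun _ (_ : α) (w : Word) => w.tail) hg hf.nat_to_word snd'.tail
    (Bdd.const 0) (fun _ _ _ w => by simp)
  convert this.length using 3 with Φ x
  have : ∀ n (w : Word), (List.tail^[n] w).length = w.length - n := by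
    intro n
    induction n with
    | zero => intro w; rfl
    | succ n ih => intro w; rw [iterate_succ_apply, ih, List.length_tail]; omega
  rw [this]
  simp [unary]

theorem const_mul (k : ℕ) {f : StrFun → α → ℕ} (hf : PT f) : PT fun Φ x => k * f Φ x := by
  induction k with
  | zero => simpa using zero
  | succ k ih => simpa only [Nat.succ_mul] using ih.add hf

end PT

end StackProg

/-! ## Functions on words -/

namespace StackProg

open Function

variable {α : Type} [Data α]

/-! ### Parsing -/

/-- Removes everything up to and including the first letter `1`. -/
def dropToOne : Word → Word
  | [] => []
  | true :: w => w
  | false :: w => dropToOne w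

/-- Both branches of `fpair` prefix the answer with `0^k 1`, so this recovers a component whatever
the length `k` of the other one is. -/
theorem dropToOne_unary (k : ℕ) (w : Word) : dropToOne (unary k ++ true :: w) = w := by
  induction k with
  | zero => rfl
  | succ k ih => exact ih

/-- The number of rounds of a loop is fixed in advance, so a flag records that the separator has
been passed and freezes the state. -/
def dropToOneStep (x : Bool × Word) : Bool × Word :=
  cond x.1 x (wcases x.2 x (fun w => (false, w)) (fun w => (true, w)))

theorem dropToOneStep_iterate (n : ℕ) (w : Word) (h : w.length ≤ n) :
    (dropToOneStep^[n] (false, w)).2 = dropToOne w := by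
  have done : ∀ n w, dropToOneStep^[n] (true, w) = (true, w) := fun n w => iterate_fixed rfl n
  have nil : ∀ n, dropToOneStep^[n] (false, []) = (false, []) := fun n => iterate_fixed rfl n
  induction n generalizing w with
  | zero => rw [List.eq_nil_of_length_eq_zero (Nat.le_zero.1 h)]; rfl
  | succ n ih =>
    rcases w with _ | ⟨_ | _, w⟩
    · rw [nil]; rfl
    · exact ih w (by simpa using h)
    · rw [iterate_succ_apply]
      change (dropToOneStep^[n] (true, w)).2 = _
      rw [done]; rfl

theorem PT.dropToOne {f : StrFun → α → Word} (hf : PT f) : PT fun Φ x => dropToOne (f Φ x) := by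
  have := PT.iterate (f := fun _ (_ : α) x => dropToOneStep x) hf.length ((PT.bool false).pair hf)
    (PT.snd'.fst.cond PT.snd' (PT.snd'.snd.wcases PT.snd' ((PT.bool false).pair PT.snd')
      ((PT.bool true).pair PT.snd'))) (Bdd.const 0) (by
        rintro _ _ _ ⟨_ | _, _ | ⟨_ | _, w⟩⟩ <;> simp [dropToOneStep])
  convert this.snd using 3 with Φ x
  rw [dropToOneStep_iterate _ _ le_rfl]

/-- The inverse of the pairing of words. -/
def unpair : Word → Word × Word
  | true :: b :: w => (b :: (unpair w).1, (unpair w).2)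
  | false :: t => ([], t)
  | _ => ([], [])

@[simp] theorem unpair_wpair (s t : Word) : unpair (wpair s t) = (s, t) := by
  induction s with
  | nil => rfl
  | cons b s ih => simp [wpair, unpair, ih]

theorem length_unpair_snd (w : Word) : (unpair w).2.length ≤ w.length := by
  fun_induction unpair w with
  | case1 b w ih => simp only [List.length_cons]; omega
  | case2 t => simp
  | case3 => simp

theorem length_wpair (s t : Word) : (wpair s t).length = 2 * s.length + 1 + t.length := by
  induction s with
  | nil => simp [wpair]; omega
  | cons b s ih => simp only [wpair, List.length_cons, ih]; omega

/-- The flag marks the end of the first component, which is collected in reverse order; after that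
nothing changes any more. -/
def unpairStep (x : Bool × Word × Word) : Bool × Word × Word :=
  cond x.1 x (wcases x.2.2 x (fun t => (true, x.2.1, t)) fun w =>
    wcases w (true, x.2.1, []) (fun v => (false, false :: x.2.1, v))
      fun v => (false, true :: x.2.1, v))

theorem unpairStep_iterate (w : Word) : ∀ (n : ℕ) (s : Word), w.length ≤ n →
    (unpairStep^[n] (false, s, w)).2 = ((unpair w).1.reverse ++ s, (unpair w).2) := by
  have done : ∀ n s w, unpairStep^[n] (true, s, w) = (true, s, w) :=
    fun n s w => iterate_fixed rfl n
  fun_induction unpair w with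
  | case1 b w ih =>
    intro n s h
    obtain ⟨n, rfl⟩ : ∃ k, n = k + 1 := ⟨n - 1, by simp at h; omega⟩
    rw [iterate_succ_apply]
    have : unpairStep (false, s, true :: b :: w) = (false, b :: s, w) := by cases b <;> rfl
    rw [this, ih _ _ (by simp at h; omega)]
    simp
  | case2 t =>
    intro n s h
    obtain ⟨n, rfl⟩ : ∃ k, n = k + 1 := ⟨n - 1, by simp at h; omega⟩
    rw [iterate_succ_apply]
    change (unpairStep^[n] (true, s, t)).2 = _
    rw [done]; rfl
  | case3 w h1 h2 =>
    intro n s h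
    rcases w with _ | ⟨_ | _, w⟩
    · have : unpairStep^[n] (false, s, []) = (false, s, []) := iterate_fixed rfl n
      rw [this]; rfl
    · exact absurd rfl (h2 w)
    · rcases w with _ | ⟨b, w⟩
      · obtain ⟨n, rfl⟩ : ∃ k, n = k + 1 := ⟨n - 1, by simp at h; omega⟩
        rw [iterate_succ_apply]
        change (unpairStep^[n] (true, s, [])).2 = _
        rw [done]; rfl
      · exact absurd rfl (h1 b w)

theorem PT.unpair {f : StrFun → α → Word} (hf : PT f) : PT fun Φ x => unpair (f Φ x) := by
  have := PT.iterate (f := fun _ (_ : α) x => unpairStep x) hf.length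
    ((PT.bool false).pair ((PT.const []).pair hf))
    (PT.snd'.fst.cond PT.snd' (PT.snd'.snd.snd.wcases PT.snd'
      ((PT.bool true).pair (PT.fst'.snd.snd.fst.pair PT.snd'))
      (PT.snd'.wcases ((PT.bool true).pair (PT.fst'.snd.snd.fst.pair (PT.const [])))
        ((PT.bool false).pair ((PT.fst'.fst.snd.snd.fst.cons false).pair PT.snd'))
        ((PT.bool false).pair ((PT.fst'.fst.snd.snd.fst.cons true).pair PT.snd')))))
    (Bdd.const 1) (by
      rintro _ _ _ ⟨_ | _, s, _ | ⟨_ | _, _ | ⟨_ | _, w⟩⟩⟩ <;> simp [unpairStep] <;> omega)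
  convert this.snd.fst.reverse.pair this.snd.snd using 3 with Φ x
  rw [unpairStep_iterate _ _ _ le_rfl]
  simp

theorem PT.wpair {f g : StrFun → α → Word} (hf : PT f) (hg : PT g) :
    PT fun Φ x => wpair (f Φ x) (g Φ x) := by
  have := PT.foldl (f := fun _ (_ : α) b (a : Word) => true :: b :: a) hf.reverse (hg.cons false)
    (fun b => (PT.snd'.cons b).cons true) (Bdd.const 2) (fun _ _ _ _ _ => by simp)
  convert this using 3 with Φ x
  rw [List.foldl_reverse]
  induction f Φ x with
  | nil => rfl
  | cons b w ih => simp [_root_.wpair, ih]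

theorem PT.drop {n : StrFun → α → ℕ} {f : StrFun → α → Word} (hn : PT n) (hf : PT f) :
    PT fun Φ x => (f Φ x).drop (n Φ x) := by
  have := PT.iterate (f := fun _ (_ : α) (w : Word) => w.tail) hn hf PT.snd'.tail
    (Bdd.const 0) (fun _ _ _ w => by simp)
  convert this using 3 with Φ x
  generalize f Φ x = w
  induction n Φ x generalizing w with
  | zero => rfl
  | succ n ih => rw [iterate_succ_apply, ← ih]; simp

/-! ### Serial arithmetic -/

/-- Processes the digits of two words one after the other with a carry. The result has the length
of the first word; the second word is truncated or continued by zeros. -/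
def serial (op : Bool → Bool → Bool → Bool × Bool) : Bool → Word → Word → Word × Bool
  | c, [], _ => ([], c)
  | c, x :: a, b => ((op c x (b.headD false)).1 :: (serial op (op c x (b.headD false)).2 a b.tail).1,
      (serial op (op c x (b.headD false)).2 a b.tail).2)

@[simp] theorem length_serial (op) (c : Bool) (a b : Word) :
    (serial op c a b).1.length = a.length := by
  induction a generalizing b c with
  | nil => rfl
  | cons x a ih => simp [serial, ih]

theorem PT.bool₂ (g : Bool → Bool → Bool) {b c : StrFun → α → Bool} (hb : PT b) (hc : PT c) :
    PT fun Φ x => g (b Φ x) (c Φ x) := by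
  convert hb.cond (hc.cond (PT.bool (g true true)) (PT.bool (g true false)))
    (hc.cond (PT.bool (g false true)) (PT.bool (g false false))) using 3 with Φ x
  cases b Φ x <;> cases c Φ x <;> rfl

theorem PT.serial (op) (c : Bool) {f g : StrFun → α → Word} (hf : PT f) (hg : PT g) :
    PT fun Φ x => serial op c (f Φ x) (g Φ x) := by
  have := PT.foldl (f := fun _ (_ : α) x (s : Bool × Word × Word) =>
      ((op s.1 x (s.2.1.headD false)).2, s.2.1.tail,
        (op s.1 x (s.2.1.headD false)).1 :: s.2.2)) hf
    ((PT.bool c).pair (hg.pair (PT.const [])))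
    (fun x => (PT.bool₂ (fun c y => (op c x y).2) PT.snd'.fst PT.snd'.snd.fst.headD).pair
      (PT.snd'.snd.fst.tail.pair
        ((PT.bool₂ (fun c y => (op c x y).1) PT.snd'.fst PT.snd'.snd.fst.headD).cons'
          PT.snd'.snd.snd))) (Bdd.const 1) (by
      rintro _ _ _ _ ⟨_, b, s⟩; simp; omega)
  convert this.snd.snd.reverse.pair this.fst using 3 with Φ x
  have key : ∀ (a : Word) (c : Bool) (b s : Word),
      a.foldl (fun (s : Bool × Word × Word) x => ((op s.1 x (s.2.1.headD false)).2, s.2.1.tail,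
        (op s.1 x (s.2.1.headD false)).1 :: s.2.2)) (c, b, s) =
      ((StackProg.serial op c a b).2, b.drop a.length,
        (StackProg.serial op c a b).1.reverse ++ s) := by
    intro a
    induction a with
    | nil => intro c b s; rfl
    | cons x a ih =>
      intro c b s
      rw [List.foldl_cons, ih]
      simp [StackProg.serial]
  rw [key]
  simp

/-! ### Binary numerals: value, padding, addition, subtraction, counting -/

/-- The number with a given binary expansion, least significant digit first. -/
def val (w : Word) : ℕ := w.foldr Nat.bit 0

@[simp] theorem val_nil : val [] = 0 := rfl

theorem val_cons (b : Bool) (w : Word) : val (b :: w) = b.toNat + 2 * val w := by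
  change Nat.bit b (val w) = _
  rw [Nat.bit_val, add_comm]

theorem val_headD_tail (w : Word) : val w = (w.headD false).toNat + 2 * val w.tail := by
  cases w with
  | nil => rfl
  | cons b w => exact val_cons b w

theorem val_lt (w : Word) : val w < 2 ^ w.length := by
  induction w with
  | nil => simp
  | cons b w ih =>
    rw [val_cons, List.length_cons, pow_succ]
    have := Bool.toNat_le b
    omega

theorem val_injective {v w : Word} (hl : v.length = w.length) (h : val v = val w) : v = w := by
  induction v generalizing w with
  | nil => exact (List.eq_nil_of_length_eq_zero hl.symm).symm
  | cons b v ih =>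
    cases w with
    | nil => simp at hl
    | cons c w =>
      simp only [val_cons] at h
      have h1 : b = c := by
        cases b <;> cases c <;> simp only [Bool.toNat_false, Bool.toNat_true] at h ⊢ <;> omega
      subst h1
      rw [ih (by simpa using hl) (by omega)]

@[simp] theorem val_unary_append (k : ℕ) (w : Word) : val (unary k ++ w) = 2 ^ k * val w := by
  induction k with
  | zero => simp [unary]
  | succ k ih =>
    have : unary (k + 1) ++ w = false :: (unary k ++ w) := rfl
    rw [this, val_cons, ih, pow_succ]
    simp only [Bool.toNat_false]
    ring

@[simp] theorem length_unary (k : ℕ) : (unary k).length = k := List.length_replicate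

@[simp] theorem val_unary (k : ℕ) : val (unary k) = 0 := by
  simpa using val_unary_append k []

theorem exists_val {L n : ℕ} (h : n < 2 ^ L) : ∃ w : Word, w.length = L ∧ val w = n := by
  induction L generalizing n with
  | zero => exact ⟨[], rfl, by simp at h; simp [h]⟩
  | succ L ih =>
    obtain ⟨w, hw, hv⟩ := ih (n := n / 2) (by rw [pow_succ] at h; omega)
    refine ⟨decide (n % 2 = 1) :: w, by simp [hw], ?_⟩
    rw [val_cons, hv]
    rcases Nat.mod_two_eq_zero_or_one n with h' | h' <;> simp [h'] <;> omega

/-- The first `L` letters of a word, continued by zeros if necessary. -/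
def padTo (L : ℕ) (w : Word) : Word := (serial (fun c _ y => (y, c)) false (unary L) w).1

@[simp] theorem length_padTo (L : ℕ) (w : Word) : (padTo L w).length = L := by simp [padTo]

theorem padTo_succ (L : ℕ) (w : Word) : padTo (L + 1) w = w.headD false :: padTo L w.tail := rfl

theorem val_padTo {L : ℕ} {w : Word} (h : w.length ≤ L) : val (padTo L w) = val w := by
  induction L generalizing w with
  | zero => rw [List.eq_nil_of_length_eq_zero (Nat.le_zero.1 h)]; rfl
  | succ L ih =>
    rw [padTo_succ, val_cons, ih (by simp; omega), ← val_headD_tail]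

theorem padTo_append {v : Word} {L : ℕ} (h : v.length = L) (w : Word) : padTo L (v ++ w) = v := by
  induction v generalizing L with
  | nil => subst h; rfl
  | cons b v ih =>
    obtain ⟨L, rfl⟩ : ∃ k, L = k + 1 := ⟨L - 1, by simp at h; omega⟩
    rw [padTo_succ, List.cons_append, List.tail_cons, ih (by simpa using h)]
    rfl

theorem PT.padTo {n : StrFun → α → ℕ} {f : StrFun → α → Word} (hn : PT n) (hf : PT f) :
    PT fun Φ x => padTo (n Φ x) (f Φ x) :=
  (PT.serial _ _ hn.nat_to_word hf).fst

def addDigit (c x y : Bool) : Bool × Bool := (xor c (xor x y), (x && y) || (c && (x || y)))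

def subDigit (c x y : Bool) : Bool × Bool := (xor c (xor x y), (!x && (y || c)) || (y && c))

/-- Each digit step is a full adder, and the identity of one step propagates through the digits; the
last carry counts with weight `2 ^ a.length`. -/
theorem val_serial_add (a : Word) : ∀ (c : Bool) (b : Word), b.length ≤ a.length →
    val (serial addDigit c a b).1 + 2 ^ a.length * (serial addDigit c a b).2.toNat =
      val a + val b + c.toNat := by
  induction a with
  | nil =>
    intro c b h
    rw [List.eq_nil_of_length_eq_zero (Nat.le_zero.1 h)]
    simp [serial]
  | cons x a ih =>
    intro c b h
    have := ih (addDigit c x (b.headD false)).2 b.tail (by simp at h ⊢; omega)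
    simp only [serial, val_cons, List.length_cons, val_headD_tail b, pow_succ]
    rw [mul_comm _ 2, mul_assoc]
    have h2 : (addDigit c x (b.headD false)).1.toNat + 2 * (addDigit c x (b.headD false)).2.toNat =
        c.toNat + x.toNat + (b.headD false).toNat := by
      generalize b.headD false = y
      cases c <;> cases x <;> cases y <;> rfl
    omega

/-- Here the carry is a borrow, and the last borrow is set exactly if the subtraction underflows.
One pass therefore yields both the difference and the comparison `ltW`. -/
theorem val_serial_sub (a : Word) : ∀ (c : Bool) (b : Word), b.length ≤ a.length →
    val (serial subDigit c a b).1 + val b + c.toNat =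
      val a + 2 ^ a.length * (serial subDigit c a b).2.toNat := by
  induction a with
  | nil =>
    intro c b h
    rw [List.eq_nil_of_length_eq_zero (Nat.le_zero.1 h)]
    simp [serial]
  | cons x a ih =>
    intro c b h
    have := ih (subDigit c x (b.headD false)).2 b.tail (by simp at h ⊢; omega)
    simp only [serial, val_cons, List.length_cons, val_headD_tail b, pow_succ]
    rw [mul_comm _ 2, mul_assoc]
    have h2 : (subDigit c x (b.headD false)).1.toNat + c.toNat + (b.headD false).toNat =
        x.toNat + 2 * (subDigit c x (b.headD false)).2.toNat := by
      generalize b.headD false = y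
      cases c <;> cases x <;> cases y <;> rfl
    omega

/-- Addition modulo `2 ^ a.length`. -/
def addW (a b : Word) : Word := (serial addDigit false a b).1

/-- Subtraction modulo `2 ^ a.length`. -/
def subW (a b : Word) : Word := (serial subDigit false a b).1

def ltW (a b : Word) : Bool := (serial subDigit false a b).2

@[simp] theorem length_addW (a b : Word) : (addW a b).length = a.length := length_serial ..

@[simp] theorem length_subW (a b : Word) : (subW a b).length = a.length := length_serial ..

theorem val_addW {a b : Word} (h : b.length ≤ a.length) (hv : val a + val b < 2 ^ a.length) :
    val (addW a b) = val a + val b := by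
  have := val_serial_add a false b h
  change val (addW a b) + _ * _ = _ at this
  cases hc : (serial addDigit false a b).2 <;> rw [hc] at this <;> simp at this <;> omega

theorem val_subW {a b : Word} (h : b.length ≤ a.length) (hv : val b ≤ val a) :
    val (subW a b) = val a - val b := by
  have := val_serial_sub a false b h
  have h2 := val_lt (subW a b)
  rw [length_subW] at h2
  change val (subW a b) + _ + _ = _ + _ at this
  cases hc : (serial subDigit false a b).2 <;> rw [hc] at this <;> simp at this <;> omega

theorem ltW_iff {a b : Word} (h : b.length ≤ a.length) : ltW a b = true ↔ val a < val b := by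
  have := val_serial_sub a false b h
  have h2 := val_lt (subW a b)
  rw [length_subW] at h2
  change val (subW a b) + _ + _ = _ + _ * (ltW a b).toNat at this
  cases hc : ltW a b <;> rw [hc] at this <;> simp at this ⊢ <;> omega

theorem PT.addW {f g : StrFun → α → Word} (hf : PT f) (hg : PT g) :
    PT fun Φ x => addW (f Φ x) (g Φ x) := (PT.serial _ _ hf hg).fst

theorem PT.subW {f g : StrFun → α → Word} (hf : PT f) (hg : PT g) :
    PT fun Φ x => subW (f Φ x) (g Φ x) := (PT.serial _ _ hf hg).fst

theorem PT.ltW {f g : StrFun → α → Word} (hf : PT f) (hg : PT g) :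
    PT fun Φ x => ltW (f Φ x) (g Φ x) := (PT.serial _ _ hf hg).snd

/-- The successor modulo `2 ^ c.length`. -/
def incr (c : Word) : Word := addW c (padTo c.length [true])

@[simp] theorem length_incr (c : Word) : (incr c).length = c.length := length_addW ..

theorem PT.incr {f : StrFun → α → Word} (hf : PT f) : PT fun Φ x => incr (f Φ x) :=
  hf.addW (hf.length.padTo (PT.const [true]))

theorem length_incr_iterate (n : ℕ) (c : Word) : (incr^[n] c).length = c.length := by
  induction n with
  | zero => rfl
  | succ n ih => rw [iterate_succ_apply', length_incr, ih]

theorem val_incr_iterate {n W : ℕ} (h : n < 2 ^ W) : val (incr^[n] (unary W)) = n := by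
  induction n with
  | zero => simp
  | succ n ih =>
    have hn := ih (by omega)
    have hl : (incr^[n] (unary W)).length = W := by simp [length_incr_iterate]
    have hW : 1 ≤ W := by
      by_contra h0
      rw [show W = 0 by omega] at h
      simp at h
    have h1 : val (padTo W [true]) = 1 := by rw [val_padTo (by simpa using hW)]; rfl
    rw [iterate_succ_apply', incr, hl, val_addW (by simp [hl]), hn, h1]
    rw [hl, hn, h1]; exact h

/-- A counter of fixed width that starts at zero runs through every word of that width. This is what
makes the loop of trials exhaustive. -/
theorem exists_incr_iterate (c : Word) : ∃ n < 2 ^ c.length, incr^[n] (unary c.length) = c :=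
  ⟨val c, val_lt c, val_injective (by simp [length_incr_iterate]) (val_incr_iterate (val_lt c))⟩

end StackProg

/-! ## Comparison and enumeration of dyadic vectors -/

namespace StackProg

open Function

variable {α : Type} [Data α]

/-! ### Comparing dyadic vectors -/

/-- The absolute value of a nonnegative sign-magnitude numeral. -/
def magPos (u : Word) : Word := wcases u [] (fun m => m) fun _ => []

/-- The absolute value of a nonpositive sign-magnitude numeral. -/
def magNeg (u : Word) : Word := wcases u [] (fun _ => []) fun m => m

/-- A signed number becomes a difference of two naturals, so inequalities between signed numbers can
be decided by unsigned addition and comparison after moving negative parts to the other side. -/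
theorem intVal_eq (u : Word) : intVal u = (val (magPos u) : ℤ) - val (magNeg u) := by
  rcases u with _ | ⟨_ | _, m⟩ <;> simp [intVal, magPos, magNeg, val]

theorem length_magPos (u : Word) : (magPos u).length ≤ u.length := by
  rcases u with _ | ⟨_ | _, m⟩ <;> simp [magPos]

theorem length_magNeg (u : Word) : (magNeg u).length ≤ u.length := by
  rcases u with _ | ⟨_ | _, m⟩ <;> simp [magNeg]

theorem PT.magPos {f : StrFun → α → Word} (hf : PT f) : PT fun Φ x => magPos (f Φ x) :=
  hf.wcases (PT.const []) PT.snd' (PT.const [])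

theorem PT.magNeg {f : StrFun → α → Word} (hf : PT f) : PT fun Φ x => magNeg (f Φ x) :=
  hf.wcases (PT.const []) (PT.const []) PT.snd'

def shiftPad (L k : ℕ) (w : Word) : Word := padTo L (unary k ++ w)

@[simp] theorem length_shiftPad (L k : ℕ) (w : Word) : (shiftPad L k w).length = L :=
  length_padTo ..

theorem val_shiftPad {L k : ℕ} {w : Word} (h : k + w.length ≤ L) :
    val (shiftPad L k w) = 2 ^ k * val w := by
  rw [shiftPad, val_padTo (by simpa using h), val_unary_append]

theorem PT.shiftPad {l k : StrFun → α → ℕ} {f : StrFun → α → Word} (hl : PT l) (hk : PT k)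
    (hf : PT f) : PT fun Φ x => shiftPad (l Φ x) (k Φ x) (f Φ x) :=
  hl.padTo (hk.nat_to_word.append hf)

/-- `x₁ + x₂ ≤ y₁ + y₂ + t`. -/
def leSum (x₁ x₂ y₁ y₂ t : Word) : Bool := !ltW (addW (addW y₁ y₂) t) (addW x₁ x₂)

theorem leSum_iff {L : ℕ} {x₁ x₂ y₁ y₂ t : Word} (hx₁ : x₁.length = L + 2) (hx₂ : x₂.length = L + 2)
    (hy₁ : y₁.length = L + 2) (hy₂ : y₂.length = L + 2) (ht : t.length = L + 2)
    (vx₁ : val x₁ < 2 ^ L) (vx₂ : val x₂ < 2 ^ L) (vy₁ : val y₁ < 2 ^ L) (vy₂ : val y₂ < 2 ^ L)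
    (vt : val t < 2 ^ L) :
    leSum x₁ x₂ y₁ y₂ t = true ↔ val x₁ + val x₂ ≤ val y₁ + val y₂ + val t := by
  -- Two spare digits suffice, since at most three numbers below `2 ^ L` are added.
  have h4 : 2 ^ (L + 2) = 4 * 2 ^ L := by ring
  have hy : val (addW y₁ y₂) = val y₁ + val y₂ := val_addW (by omega) (by rw [hy₁]; omega)
  have hx : val (addW x₁ x₂) = val x₁ + val x₂ := val_addW (by omega) (by rw [hx₁]; omega)
  have hyt : val (addW (addW y₁ y₂) t) = val y₁ + val y₂ + val t := by
    rw [val_addW (by simp; omega) (by rw [length_addW, hy₁]; omega), hy]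
  have := ltW_iff (a := addW (addW y₁ y₂) t) (b := addW x₁ x₂) (by simp; omega)
  rw [hx, hyt] at this
  rw [leSum, Bool.not_eq_true', ← Bool.not_eq_true, this]
  omega

theorem PT.leSum {x₁ x₂ y₁ y₂ t : StrFun → α → Word} (hx₁ : PT x₁) (hx₂ : PT x₂) (hy₁ : PT y₁)
    (hy₂ : PT y₂) (ht : PT t) :
    PT fun Φ x => leSum (x₁ Φ x) (x₂ Φ x) (y₁ Φ x) (y₂ Φ x) (t Φ x) :=
  (((hy₁.addW hy₂).addW ht).ltW (hx₁.addW hx₂)).not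

/-- `|A / 2 ^ a - B / 2 ^ b| ≤ 2 ^ (2 - i)` for sign-magnitude numerals `A` and `B`. -/
def nearNum (L : ℕ) (A B : Word) (a b i : ℕ) : Bool :=
  leSum (shiftPad L (b + i) (magPos A)) (shiftPad L (a + i) (magNeg B))
    (shiftPad L (b + i) (magNeg A)) (shiftPad L (a + i) (magPos B))
    (shiftPad L (a + b + 2) [true]) &&
  leSum (shiftPad L (b + i) (magNeg A)) (shiftPad L (a + i) (magPos B))
    (shiftPad L (b + i) (magPos A)) (shiftPad L (a + i) (magNeg B))
    (shiftPad L (a + b + 2) [true])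

/-- Multiplication by `2 ^ (a + b + i)` clears all denominators and turns the tolerance into `2 ^ (a
+ b + 2)`. The condition on `L` ensures that all shifted numerals fit with two digits to spare. -/
theorem nearNum_iff {L : ℕ} {A B : Word} {a b i : ℕ} (hL : A.length + B.length + a + b + i + 5 ≤ L) :
    nearNum L A B a b i = true ↔
      |(intVal A : ℝ) / 2 ^ a - (intVal B : ℝ) / 2 ^ b| ≤ 4 * (1 / 2 : ℝ) ^ i := by
  obtain ⟨L, rfl⟩ : ∃ k, L = k + 2 := ⟨L - 2, by omega⟩
  have h1 := length_magPos A
  have h2 := length_magNeg A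
  have h3 := length_magPos B
  have h4 := length_magNeg B
  have bd : ∀ (k : ℕ) (w : Word), k + w.length ≤ L → val (shiftPad (L + 2) k w) < 2 ^ L := by
    intro k w h
    rw [val_shiftPad (by omega)]
    calc 2 ^ k * val w < 2 ^ k * 2 ^ w.length := by
          exact Nat.mul_lt_mul_of_pos_left (val_lt w) (by positivity)
      _ ≤ 2 ^ L := by rw [← pow_add]; exact Nat.pow_le_pow_right (by omega) h
  rw [nearNum, Bool.and_eq_true]
  rw [leSum_iff (L := L), leSum_iff (L := L), val_shiftPad, val_shiftPad, val_shiftPad,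
    val_shiftPad, val_shiftPad, intVal_eq, intVal_eq]
  rotate_left
  iterate 5 first | (simp only [List.length_cons, List.length_nil]; omega) | omega
  all_goals try exact length_shiftPad ..
  all_goals try (apply bd; simp only [List.length_cons, List.length_nil]; omega)
  all_goals try (apply bd; omega)
  generalize val (magPos A) = p
  generalize val (magNeg A) = n
  generalize val (magPos B) = p'
  generalize val (magNeg B) = n'
  have ht : val [true] = 1 := rfl
  rw [ht, abs_le]
  have hpos : (0 : ℝ) < 2 ^ (a + b + i) := by positivity
  have e1 : (((p : ℤ) - n : ℤ) : ℝ) / 2 ^ a - (((p' : ℤ) - n' : ℤ) : ℝ) / 2 ^ b =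
      ((2 ^ (b + i) * p + 2 ^ (a + i) * n' : ℕ) - (2 ^ (b + i) * n + 2 ^ (a + i) * p' : ℕ) : ℝ) /
        2 ^ (a + b + i) := by
    push_cast
    rw [pow_add, pow_add, pow_add, pow_add]
    field_simp
    ring
  have e2 : 4 * (1 / 2 : ℝ) ^ i = ((2 ^ (a + b + 2) * 1 : ℕ) : ℝ) / 2 ^ (a + b + i) := by
    push_cast
    rw [one_div, inv_pow, pow_add, pow_add, pow_add, pow_add]
    field_simp
    ring
  rw [e1, e2, ← neg_div, div_le_div_iff_of_pos_right hpos, div_le_div_iff_of_pos_right hpos]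
  generalize 2 ^ (b + i) * p + 2 ^ (a + i) * n' = X
  generalize 2 ^ (b + i) * n + 2 ^ (a + i) * p' = Y
  generalize 2 ^ (a + b + 2) * 1 = T
  constructor
  · rintro ⟨h1, h2⟩
    have h1 : (X : ℝ) ≤ Y + T := by exact_mod_cast h1
    have h2 : (Y : ℝ) ≤ X + T := by exact_mod_cast h2
    constructor <;> linarith
  · rintro ⟨h1, h2⟩
    have h1 : (Y : ℝ) ≤ X + T := by linarith
    have h2 : (X : ℝ) ≤ Y + T := by linarith
    exact ⟨by exact_mod_cast h2, by exact_mod_cast h1⟩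

theorem PT.nearNum {l a b i : StrFun → α → ℕ} {A B : StrFun → α → Word} (hl : PT l) (hA : PT A)
    (hB : PT B) (ha : PT a) (hb : PT b) (hi : PT i) :
    PT fun Φ x => nearNum (l Φ x) (A Φ x) (B Φ x) (a Φ x) (b Φ x) (i Φ x) :=
  have t := hl.shiftPad ((ha.add hb).add (PT.nat 2)) (PT.const [true])
  have pA := hl.shiftPad (hb.add hi) hA.magPos
  have nA := hl.shiftPad (hb.add hi) hA.magNeg
  have pB := hl.shiftPad (ha.add hi) hB.magPos
  have nB := hl.shiftPad (ha.add hi) hB.magNeg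
  (PT.leSum pA nB nA pB t).and (PT.leSum nA pB pA nB t)

/-- `|x - y| ≤ 2 ^ (2 - i)` for codes of dyadic numbers. -/
def near₁ (v w : Word) (i : ℕ) : Bool :=
  nearNum ((unpair v).1.length + (unpair w).1.length + (unpair v).2.length + (unpair w).2.length +
    i + 5) (unpair v).1 (unpair w).1 (unpair v).2.length (unpair w).2.length i

theorem near₁_iff {v w : Word} {x y : ℝ} (hv : IsDyadicCode₁ v x) (hw : IsDyadicCode₁ w y) (i : ℕ) :
    near₁ v w i = true ↔ |x - y| ≤ 4 * (1 / 2 : ℝ) ^ i := by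
  obtain ⟨A, a, rfl, rfl⟩ := hv
  obtain ⟨B, b, rfl, rfl⟩ := hw
  rw [near₁, nearNum_iff le_rfl]
  simp

theorem PT.near₁ {v w : StrFun → α → Word} {i : StrFun → α → ℕ} (hv : PT v) (hw : PT w)
    (hi : PT i) : PT fun Φ x => near₁ (v Φ x) (w Φ x) (i Φ x) :=
  PT.nearNum (((((hv.unpair.fst.length.add hw.unpair.fst.length).add hv.unpair.snd.length).add
    hw.unpair.snd.length).add hi).add (PT.nat 5)) hv.unpair.fst hw.unpair.fst
    hv.unpair.snd.length hw.unpair.snd.length hi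

/-- `‖x - y‖ ≤ 2 ^ (2 - i)` for codes of dyadic vectors. -/
def near : ℕ → Word → Word → ℕ → Bool
  | 0, _, _, _ => true
  | 1, v, w, i => near₁ v w i
  | e + 2, v, w, i =>
      near₁ (unpair v).1 (unpair w).1 i && near (e + 1) (unpair v).2 (unpair w).2 i

theorem near_iff : ∀ (e : ℕ) {v w : Word} {x y : Fin e → ℝ}, IsDyadicCode e v x →
    IsDyadicCode e w y → ∀ i, near e v w i = true ↔ ∀ l, |x l - y l| ≤ 4 * (1 / 2 : ℝ) ^ i
  | 0, _, _, _, _, _, _, _ => by simp [near]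
  | 1, _, _, _, _, hv, hw, i => by rw [near, near₁_iff hv hw]; simp
  | e + 2, _, _, x, y, hv, hw, i => by
    obtain ⟨v₁, v₂, rfl, hv₁, hv₂⟩ := hv
    obtain ⟨w₁, w₂, rfl, hw₁, hw₂⟩ := hw
    rw [near, Bool.and_eq_true, unpair_wpair, unpair_wpair, near₁_iff hv₁ hw₁,
      near_iff (e + 1) hv₂ hw₂, Fin.forall_fin_succ (P := fun l => |x l - y l| ≤ _)]

theorem near_iff_norm {e : ℕ} {v w : Word} {x y : Fin e → ℝ} (hv : IsDyadicCode e v x)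
    (hw : IsDyadicCode e w y) (i : ℕ) :
    near e v w i = true ↔ ‖x - y‖ ≤ 4 * (1 / 2 : ℝ) ^ i := by
  rw [near_iff e hv hw, pi_norm_le_iff_of_nonneg (by positivity)]
  rfl

theorem PT.near (e : ℕ) {v w : StrFun → α → Word} {i : StrFun → α → ℕ} (hv : PT v) (hw : PT w)
    (hi : PT i) : PT fun Φ x => near e (v Φ x) (w Φ x) (i Φ x) := by
  induction e using Nat.strong_induction_on generalizing v w i with
  | _ e ih =>
    match e with
    | 0 => exact PT.bool true
    | 1 => exact hv.near₁ hw hi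
    | e + 2 =>
      exact (hv.unpair.fst.near₁ hw.unpair.fst hi).and
        (ih (e + 1) (by omega) hv.unpair.snd hw.unpair.snd hi)

/-! ### Vectors in fixed-point format -/

/-- `w` is the code of `a / 2 ^ J` whose numeral has exactly `N` binary digits. -/
def Fmt₁ (J N : ℕ) (w : Word) (a : ℤ) : Prop :=
  ∃ (s : Bool) (m : Word), w = wpair (s :: m) (unary J) ∧ m.length = N ∧ a = intVal (s :: m)

/-- `w` is the code of the vector `a / 2 ^ J` whose numerals have exactly `N` binary digits. -/
def Fmt (J N : ℕ) : (d : ℕ) → Word → (Fin d → ℤ) → Prop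
  | 0, w, _ => w = []
  | 1, w, a => Fmt₁ J N w (a 0)
  | d + 2, w, a => ∃ u v : Word, w = wpair u v ∧ Fmt₁ J N u (a 0) ∧
      Fmt J N (d + 1) v fun i => a i.succ

variable {J N : ℕ}

theorem Fmt.isDyadicCode : ∀ {d : ℕ} {w : Word} {a : Fin d → ℤ}, Fmt J N d w a →
    IsDyadicCode d w fun i => (a i : ℝ) / 2 ^ J
  | 0, _, _, h => h
  | 1, _, _, ⟨s, m, hw, _, ha⟩ => ⟨s :: m, J, hw, congrArg (fun z : ℤ => (z : ℝ) / 2 ^ J) ha⟩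
  | _ + 2, _, _, ⟨u, v, hw, ⟨s, m, hu, _, ha⟩, hv⟩ =>
    ⟨u, v, hw, ⟨s :: m, J, hu, congrArg (fun z : ℤ => (z : ℝ) / 2 ^ J) ha⟩, hv.isDyadicCode⟩

/-- The length of a code is determined by `J`, `N` and the dimension; hence the centres of a search
all have the same length. -/
theorem Fmt.length_eq : ∀ {d : ℕ} {w w' : Word} {a a' : Fin d → ℤ}, Fmt J N d w a →
    Fmt J N d w' a' → w.length = w'.length
  | 0, _, _, _, _, h, h' => by rw [h, h']
  | 1, _, _, _, _, ⟨s, m, hw, hm, _⟩, ⟨s', m', hw', hm', _⟩ => by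
    rw [hw, hw', length_wpair, length_wpair, List.length_cons, List.length_cons, hm, hm']
  | _ + 2, _, _, _, _, ⟨u, v, hw, ⟨s, m, hu, hm, _⟩, hv⟩, ⟨u', v', hw', ⟨s', m', hu', hm', _⟩, hv'⟩ => by
    rw [hw, hw', length_wpair, length_wpair, hv.length_eq hv', hu, hu', length_wpair, length_wpair,
      List.length_cons, List.length_cons, hm, hm']

/-- The code of the zero vector. -/
def zeroCode : ℕ → ℕ → ℕ → Word
  | 0, _, _ => []
  | 1, J, N => wpair (unary (N + 1)) (unary J)
  | d + 2, J, N => wpair (wpair (unary (N + 1)) (unary J)) (zeroCode (d + 1) J N)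

theorem fmt_zeroCode : ∀ d : ℕ, Fmt J N d (zeroCode d J N) 0
  | 0 => rfl
  | 1 => ⟨false, unary N, rfl, length_unary N, by
      change 0 = ((val (unary N) : ℕ) : ℤ); rw [val_unary]; rfl⟩
  | d + 2 => ⟨_, _, rfl, ⟨false, unary N, rfl, length_unary N, by
      change 0 = ((val (unary N) : ℕ) : ℤ); rw [val_unary]; rfl⟩, fmt_zeroCode (d + 1)⟩

theorem PT.zeroCode (d : ℕ) {j n : StrFun → α → ℕ} (hj : PT j) (hn : PT n) :
    PT fun Φ x => zeroCode d (j Φ x) (n Φ x) := by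
  have h := hn.succ.nat_to_word.wpair hj.nat_to_word
  induction d using Nat.strong_induction_on with
  | _ d ih =>
    match d with
    | 0 => exact PT.const []
    | 1 => exact h
    | d + 2 => exact h.wpair (ih (d + 1) (by omega))

/-! ### Moving fixed-point vectors by words of digits -/

/-- Changes a dyadic number in fixed-point format: the first letter of `c` is the new sign, and the
second one decides whether the number with the following `h` digits, times `2 ^ sh`, is added to or
subtracted from the absolute value. -/
def shift₁ (p : Word) (sh h : ℕ) (c : Word) : Word :=
  wpair (c.headD false :: cond (c.tail.headD false)
    (addW (unpair p).1.tail (unary sh ++ padTo h c.tail.tail))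
    (subW (unpair p).1.tail (unary sh ++ padTo h c.tail.tail))) (unpair p).2

/-- Changes all coordinates of a dyadic vector in fixed-point format. -/
def shift : ℕ → Word → ℕ → ℕ → Word → Word
  | 0, _, _, _, _ => []
  | 1, p, sh, h, c => shift₁ p sh h c
  | d + 2, p, sh, h, c => wpair (shift₁ (unpair p).1 sh h c)
      (shift (d + 1) (unpair p).2 sh h (c.drop (h + 2)))

theorem PT.shift₁ {p c : StrFun → α → Word} {sh h : StrFun → α → ℕ} (hp : PT p) (hsh : PT sh)
    (hh : PT h) (hc : PT c) : PT fun Φ x => shift₁ (p Φ x) (sh Φ x) (h Φ x) (c Φ x) :=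
  have δ := hsh.nat_to_word.append (hh.padTo hc.tail.tail)
  (hc.headD.cons' (hc.tail.headD.cond (hp.unpair.fst.tail.addW δ)
    (hp.unpair.fst.tail.subW δ))).wpair hp.unpair.snd

theorem PT.shift (d : ℕ) {p c : StrFun → α → Word} {sh h : StrFun → α → ℕ} (hp : PT p)
    (hsh : PT sh) (hh : PT h) (hc : PT c) :
    PT fun Φ x => shift d (p Φ x) (sh Φ x) (h Φ x) (c Φ x) := by
  induction d using Nat.strong_induction_on generalizing p c with
  | _ d ih =>
    match d with
    | 0 => exact PT.const []
    | 1 => exact hp.shift₁ hsh hh hc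
    | d + 2 =>
      exact (hp.unpair.fst.shift₁ hsh hh hc).wpair
        (ih (d + 1) (by omega) hp.unpair.snd ((hh.add (PT.nat 2)).drop hc))

/-- Addition and subtraction keep the length of their first argument, so even a shift that overflows
produces a code of the same format. Its value is irrelevant here. -/
theorem Fmt₁.shift₁ {p : Word} {a : ℤ} (hp : Fmt₁ J N p a) (sh h : ℕ) (c : Word) :
    ∃ a', Fmt₁ J N (shift₁ p sh h c) a' := by
  obtain ⟨s, m, rfl, hm, -⟩ := hp
  refine ⟨_, _, _, by rw [StackProg.shift₁, unpair_wpair], ?_, rfl⟩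
  cases c.tail.headD false <;> simp [hm]

theorem Fmt.shift : ∀ {d : ℕ} {p : Word} {a : Fin d → ℤ}, Fmt J N d p a → ∀ (sh h : ℕ) (c : Word),
    ∃ a', Fmt J N d (shift d p sh h c) a'
  | 0, _, a, _, _, _, _ => ⟨a, rfl⟩
  | 1, _, _, hp, sh, h, c => by
    obtain ⟨a', ha'⟩ := Fmt₁.shift₁ hp sh h c
    exact ⟨fun _ => a', ha'⟩
  | d + 2, _, _, ⟨u, v, hw, hu, hv⟩, sh, h, c => by
    subst hw
    obtain ⟨a', ha'⟩ := hu.shift₁ sh h c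
    obtain ⟨b, hb⟩ := hv.shift sh h (c.drop (h + 2))
    exact ⟨Fin.cons a' b, _, _, by rw [StackProg.shift, unpair_wpair], ha', hb⟩

theorem natAbs_intVal_cons (s : Bool) (m : Word) : (intVal (s :: m)).natAbs = val m := by
  cases s
  · change ((val m : ℕ) : ℤ).natAbs = _; simp
  · change (-((val m : ℕ) : ℤ)).natAbs = _; simp

/-- The sign is chosen freely, so only the absolute value has to be reached. Since `||a'| - |a|| ≤
|a' - a| < 2 ^ (sh + h)` and both are multiples of `2 ^ sh`, the quotient of their difference by `2
^ sh` has at most `h` digits. -/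
theorem Fmt₁.exists_shift₁ {p : Word} {a a' : ℤ} {sh h : ℕ} (hp : Fmt₁ J N p a) (hN : sh + h ≤ N)
    (ha : (2 : ℤ) ^ sh ∣ a) (ha' : (2 : ℤ) ^ sh ∣ a') (hlt : |a'| < 2 ^ N)
    (hd : |a' - a| < 2 ^ (sh + h)) :
    ∃ c : Word, c.length = h + 2 ∧ ∀ c', Fmt₁ J N (StackProg.shift₁ p sh h (c ++ c')) a' := by
  obtain ⟨s, m, rfl, hm, rfl⟩ := hp
  obtain ⟨k, hk⟩ : 2 ^ sh ∣ val m := by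
    rw [← natAbs_intVal_cons s m]
    exact_mod_cast Int.natAbs_dvd_natAbs.2 ha
  obtain ⟨k', hk'⟩ : 2 ^ sh ∣ a'.natAbs := by exact_mod_cast Int.natAbs_dvd_natAbs.2 ha'
  have hlt' : a'.natAbs < 2 ^ N := by
    zify; exact hlt
  have habs : |(2 ^ sh * k' : ℤ) - 2 ^ sh * k| < 2 ^ (sh + h) := by
    have e1 : (2 ^ sh * k' : ℤ) = |a'| := by
      rw [Int.abs_eq_natAbs, hk']; push_cast; rfl
    have e2 : (2 ^ sh * k : ℤ) = |intVal (s :: m)| := by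
      rw [Int.abs_eq_natAbs, natAbs_intVal_cons, hk]; push_cast; rfl
    rw [e1, e2]
    exact (abs_abs_sub_abs_le _ _).trans_lt hd
  rw [← mul_sub, abs_mul, abs_of_pos (by positivity : (0 : ℤ) < 2 ^ sh), pow_add] at habs
  have hδ : |(k' : ℤ) - k| < 2 ^ h := lt_of_mul_lt_mul_left habs (by positivity)
  have hm' := val_lt m
  rw [hm] at hm'
  have fin : ∀ m' : Word, m'.length = N → val m' = a'.natAbs →
      a' = intVal (decide (a' < 0) :: m') := by
    intro m' _ hv
    by_cases h0 : a' < 0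
    · simp only [h0, decide_true]
      change a' = -((val m' : ℕ) : ℤ)
      omega
    · simp only [h0, decide_false]
      change a' = ((val m' : ℕ) : ℤ)
      omega
  rcases le_total k k' with hkk | hkk
  · obtain ⟨w, hw, hv⟩ := exists_val (L := h) (n := k' - k) (by
      zify [hkk]; rwa [abs_of_nonneg (by omega)] at hδ)
    refine ⟨decide (a' < 0) :: true :: w, by simp [hw], fun c' => ⟨_, _, by
      rw [StackProg.shift₁, unpair_wpair], ?_, ?_⟩⟩
    · simp [hm]
    · refine fin _ (by simp [hm]) ?_
      simp only [List.cons_append, List.tail_cons, List.headD_cons, cond_true, padTo_append hw]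
      have hle : k ≤ k' := hkk
      have e : val m + val (unary sh ++ w) = a'.natAbs := by
        rw [val_unary_append, hv, hk, hk', ← mul_add]; congr 1; omega
      rw [val_addW (by simp [hw, hm]; omega) (by rw [e, hm]; exact hlt'), e]
  · obtain ⟨w, hw, hv⟩ := exists_val (L := h) (n := k - k') (by
      zify [hkk]; rwa [abs_of_nonpos (by omega), neg_sub] at hδ)
    refine ⟨decide (a' < 0) :: false :: w, by simp [hw], fun c' => ⟨_, _, by
      rw [StackProg.shift₁, unpair_wpair], ?_, ?_⟩⟩
    · simp [hm]
    · refine fin _ (by simp [hm]) ?_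
      simp only [List.cons_append, List.tail_cons, List.headD_cons, cond_false, padTo_append hw]
      have e : val (unary sh ++ w) = val m - a'.natAbs := by
        rw [val_unary_append, hv, hk, hk', ← Nat.mul_sub]
      have h2 : a'.natAbs ≤ val m := by rw [hk, hk']; exact Nat.mul_le_mul_left _ hkk
      rw [val_subW (by simp [hw, hm]; omega) (by omega), e]
      omega

theorem Fmt.exists_shift {sh h : ℕ} (hN : sh + h ≤ N) : ∀ {d : ℕ} {p : Word} {a a' : Fin d → ℤ},
    Fmt J N d p a → (∀ l, (2 : ℤ) ^ sh ∣ a l) → (∀ l, (2 : ℤ) ^ sh ∣ a' l) →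
    (∀ l, |a' l| < 2 ^ N) → (∀ l, |a' l - a l| < 2 ^ (sh + h)) →
    ∃ c : Word, c.length = d * (h + 2) ∧ Fmt J N d (StackProg.shift d p sh h c) a'
  | 0, _, _, _, _, _, _, _, _ => ⟨[], by simp, rfl⟩
  | 1, _, _, _, hp, ha, ha', hlt, hd => by
    obtain ⟨c, hc, hf⟩ := Fmt₁.exists_shift₁ hp hN (ha 0) (ha' 0) (hlt 0) (hd 0)
    exact ⟨c, by simp [hc], by have := hf []; rwa [List.append_nil] at this⟩
  | d + 2, _, _, _, ⟨u, v, hw, hu, hv⟩, ha, ha', hlt, hd => by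
    subst hw
    obtain ⟨c, hc, hf⟩ := hu.exists_shift₁ hN (ha 0) (ha' 0) (hlt 0) (hd 0)
    obtain ⟨c', hc', hf'⟩ := hv.exists_shift hN (fun l => ha l.succ) (fun l => ha' l.succ)
      (fun l => hlt l.succ) (fun l => hd l.succ)
    refine ⟨c ++ c', by rw [List.length_append, hc, hc']; ring, _, _, by
      rw [StackProg.shift, unpair_wpair], hf c', ?_⟩
    rw [← hc, List.drop_left]
    exact hf'

end StackProg

/-! ## Iteration with exponential running time -/

namespace StackProg

open Function Data

variable {α β γ : Type} [Data α] [Data β] [Data γ]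

namespace Comp

theorem iso {α' β' : Type} [Data α'] [Data β'] {f : StrFun → α → β} {T} (hf : Comp f T)
    (i : α' → α) (hi : ∀ x, store x = store (i x)) {g : StrFun → α' → β'}
    (hg : ∀ Φ x, store (g Φ x) = store (f Φ (i x))) : Comp g fun Φ x => T Φ (i x) := by
  obtain ⟨p, hp⟩ := hf
  refine ⟨p, fun Φ hΦ x => ?_⟩
  rw [hi, hg]
  exact hp Φ hΦ _

theorem foldCost_unary {α : Type} (f : StrFun → α → α) (T : StrFun → α → ℕ) (Φ : StrFun) (n : ℕ) :
    ∀ x, foldCost (fun Φ _ => f Φ) (fun Φ _ => T Φ) Φ (unary n) x =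
      ∑ k ∈ Finset.range n, (T Φ ((f Φ)^[k] x) + 1) + 1 := by
  induction n with
  | zero => intro x; rfl
  | succ n ih =>
    intro x
    have : unary (n + 1) = false :: unary n := rfl
    rw [this, foldCost, ih, Finset.sum_range_succ']
    simp only [iterate_succ_apply, iterate_zero, id_eq]
    omega

theorem iterate {f : StrFun → α → α} {T} (hf : Comp f T) {n : StrFun → γ → ℕ} {Tn} (hn : Comp n Tn)
    {x : StrFun → γ → α} {Tx} (hx : Comp x Tx) :
    ∃ C, Comp (fun Φ c => (f Φ)^[n Φ c] (x Φ c)) fun Φ c => Tn Φ c + Tx Φ c +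
      C * (size c + n Φ c + size (x Φ c) + 1) +
        ∑ k ∈ Finset.range (n Φ c), (T Φ ((f Φ)^[k] (x Φ c)) + 1) := by
  obtain ⟨C, hC⟩ := hn.pair hx
  obtain ⟨C', hC'⟩ := Comp.foldl (f := fun Φ _ => f Φ) (T := fun Φ _ => T Φ) fun _ => hf
  have h := hC'.iso (fun p : ℕ × α => (unary p.1, p.2)) (fun _ => rfl)
    (g := fun Φ p => (f Φ)^[p.1] p.2) (fun Φ p => by rw [foldl_unary])
  refine ⟨C + C' + 2, (h.comp hC).mono fun Φ _ c => ?_⟩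
  simp only [foldCost_unary, size_prod, size_word, length_unary, size_nat]
  have a : C' * (n Φ c + size (x Φ c) + 1) ≤ C' * (size c + n Φ c + size (x Φ c) + 1) :=
    Nat.mul_le_mul_left _ (by omega)
  rw [Nat.add_mul, Nat.add_mul]
  omega

theorem succ : Comp (fun _ (n : ℕ) => n + 1) fun _ _ => 2 :=
  (Comp.cons false).iso unary (fun _ => rfl) fun _ _ => rfl

theorem double : ∃ C, Comp (fun _ (n : ℕ) => 2 * n) fun _ n => C * (n + 1) := by
  obtain ⟨C, hC⟩ := Comp.wire (fun _ (n : ℕ) => (unary n, (0 : ℕ))) (fun r => r) (by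
    intro _ n r hr
    match r with
    | 0 => rfl
    | 1 => rfl
    | r + 2 => exact absurd hr (by change ¬ r + 2 < 1 + 1; omega))
  obtain ⟨C', hC'⟩ := Comp.foldl (f := fun _ _ (a : ℕ) => a + 1 + 1) (T := fun _ _ _ => 2 + 2 + 1)
    fun _ => succ.comp succ
  refine ⟨C + C' + 8, ((hC'.comp hC).of_store (g := fun _ (n : ℕ) => 2 * n) ?_).mono ?_⟩
  · intro Φ n
    simp only
    rw [foldl_unary (fun a : ℕ => a + 1 + 1)]
    congr 1
    have : ∀ a, (fun a : ℕ => a + 1 + 1)^[n] a = a + 2 * n := by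
      induction n with
      | zero => intro a; rfl
      | succ n ih => intro a; rw [iterate_succ_apply, ih]; ring
    rw [this, zero_add]
  · intro Φ _ n
    have := foldCost_le (f := fun _ _ (a : ℕ) => a + 1 + 1) (T := fun _ _ _ => 2 + 2 + 1) (Φ := Φ)
      (B := 5) (fun _ _ => True) (fun _ _ _ _ => ⟨le_rfl, trivial⟩) (unary n) 0 trivial
    simp only [length_unary] at this
    simp only [size_prod, size_word, length_unary, size_nat, add_zero]
    rw [Nat.add_mul, Nat.add_mul]
    omega

/-- Repeated doubling of a unary number: the costs form a geometric sum, so the total is linear in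
the result `2 ^ n`. -/
theorem two_pow : ∃ C, Comp (fun _ (n : ℕ) => 2 ^ n) fun _ n => C * 2 ^ n := by
  obtain ⟨C, hC⟩ := double
  obtain ⟨C1, h1⟩ := Comp.wire (fun _ (n : ℕ) => n) (fun r => r) fun _ _ _ _ => rfl
  obtain ⟨C2, h2⟩ := Comp.wire (fun _ (_ : ℕ) => (0 : ℕ)) (fun _ => 1) (by
    intro _ n r hr
    change (if r = 0 then [] else []) = _
    rw [ite_self]; rfl)
  obtain ⟨C3, h3⟩ := hC.iterate h1 (succ.comp h2)
  have hit : ∀ n, (fun n => 2 * n)^[n] (0 + 1) = 2 ^ n := by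
    intro n
    induction n with
    | zero => rfl
    | succ n ih => rw [iterate_succ_apply', ih, pow_succ, mul_comm]
  refine ⟨2 * C1 + 2 * C2 + 3 * C3 + 3 + 2 * C + 1, (h3.of_store (g := fun _ (n : ℕ) => 2 ^ n)
    fun _ n => by rw [hit]).mono fun Φ _ n => ?_⟩
  simp only [size_nat]
  have hn : n + 1 ≤ 2 ^ n := Nat.lt_two_pow_self
  have hs : ∑ k ∈ Finset.range n, (C * ((fun n => 2 * n)^[k] (0 + 1) + 1) + 1) ≤
      (2 * C + 1) * 2 ^ n := by
    calc _ ≤ ∑ k ∈ Finset.range n, (2 * C + 1) * 2 ^ k := Finset.sum_le_sum fun k _ => by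
          rw [hit]
          have : 1 ≤ 2 ^ k := Nat.one_le_two_pow
          nlinarith [Nat.zero_le C]
      _ = (2 * C + 1) * ∑ k ∈ Finset.range n, 2 ^ k := by rw [Finset.mul_sum]
      _ ≤ _ := Nat.mul_le_mul_left _ (by
          have := Nat.geomSum_eq (le_refl 2) n
          simp only [Nat.reduceSub, Nat.div_one] at this
          omega)
  have a1 : C1 * (n + 1) ≤ C1 * 2 ^ n := Nat.mul_le_mul_left _ hn
  have a2 : C2 * (n + 1) ≤ C2 * 2 ^ n := Nat.mul_le_mul_left _ hn
  have a3 : C3 * (n + n + (0 + 1) + 1) ≤ C3 * (3 * 2 ^ n) := Nat.mul_le_mul_left _ (by omega)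
  nlinarith [Nat.zero_le (C1 * 2 ^ n), Nat.zero_le (C2 * 2 ^ n)]

end Comp

/-! ### Second-order polynomial time with an exponential factor -/

/-- Functions that are computable in second-order polynomial time times `2 ^ W`, with values of
second-order polynomial size. -/
def XT (W : StrFun → α → ℕ) (f : StrFun → α → β) : Prop :=
  (∃ T, Bdd T ∧ Comp f fun Φ x => T Φ x * 2 ^ W Φ x) ∧ Bdd fun Φ x => size (f Φ x)

namespace XT

theorem of_PT {f : StrFun → α → β} (hf : PT f) (W : StrFun → α → ℕ) : XT W f := by
  obtain ⟨⟨T, hT, hB⟩, hs⟩ := hf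
  exact ⟨⟨T, hB, hT.mono fun Φ _ x => Nat.le_mul_of_pos_right _ (by positivity)⟩, hs⟩

theorem PT_comp {W : StrFun → α → ℕ} {g : StrFun → β → γ} {f : StrFun → α → β} (hg : PT g)
    (hf : XT W f) : XT W fun Φ x => g Φ (f Φ x) := by
  obtain ⟨⟨U, hU, hU'⟩, hg⟩ := hg
  obtain ⟨⟨T, hT, hT'⟩, hf⟩ := hf
  refine ⟨⟨fun Φ x => T Φ x + U Φ (f Φ x) + 1, (hT.add (hU'.comp hf)).add (.const 1),
    (hU.comp hT').mono fun Φ _ x => ?_⟩, hg.comp hf⟩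
  have h1 : U Φ (f Φ x) ≤ U Φ (f Φ x) * 2 ^ W Φ x := Nat.le_mul_of_pos_right _ (by positivity)
  have h2 : 1 ≤ 2 ^ W Φ x := Nat.one_le_two_pow
  rw [Nat.add_mul, Nat.add_mul]
  omega

theorem pair {W : StrFun → α → ℕ} {f : StrFun → α → β} {g : StrFun → α → γ} (hf : XT W f)
    (hg : XT W g) : XT W fun Φ x => (f Φ x, g Φ x) := by
  obtain ⟨⟨T, hT, hT'⟩, hf⟩ := hf
  obtain ⟨⟨U, hU, hU'⟩, hg⟩ := hg
  obtain ⟨C, hC⟩ := hT'.pair hU'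
  have hB := (Bdd.const C).mul (((Bdd.size.add hf).add hg).add (.const 1))
  refine ⟨⟨_, (hT.add hU).add hB, hC.mono fun Φ _ x => ?_⟩,
    (hf.add hg).mono fun Φ _ x => by rw [size_prod]⟩
  have := Nat.le_mul_of_pos_right (C * (size x + size (f Φ x) + size (g Φ x) + 1))
    (show 0 < 2 ^ W Φ x by positivity)
  rw [Nat.add_mul, Nat.add_mul]
  omega

/-- Iteration of a polynomial-time function `2 ^ W` times. -/
theorem iterate_two_pow {f : StrFun → α → α} (hf : PT f) {W : StrFun → γ → ℕ} (hW : PT W)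
    {x : StrFun → γ → α} (hx : PT x) {S : StrFun → γ → ℕ} (hS : Bdd S)
    (h : ∀ Φ, LengthMonotone Φ → ∀ c k, size ((f Φ)^[k] (x Φ c)) ≤ S Φ c) :
    XT W fun Φ c => (f Φ)^[2 ^ W Φ c] (x Φ c) := by
  obtain ⟨⟨T, hT, P, hP⟩, -⟩ := hf
  obtain ⟨⟨TW, hTW, hTW'⟩, hW⟩ := hW
  obtain ⟨⟨Tx, hTx, hTx'⟩, hx⟩ := hx
  obtain ⟨C, hC⟩ := Comp.two_pow
  obtain ⟨C', hC'⟩ := hT.iterate (hC.comp hTW) hTx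
  have hb : Bdd fun Φ c => C' * (size c + size (x Φ c) + 2) :=
    (Bdd.const C').mul ((Bdd.size.add hx).add (.const 2))
  refine ⟨⟨fun Φ c => TW Φ c + C + 1 + Tx Φ c + C' * (size c + size (x Φ c) + 2) +
    (P.eval (fnLength Φ) (S Φ c) + 1), ((((hTW'.add (.const C)).add (.const 1)).add hTx').add
    hb).add ((Bdd.poly P hS).add (.const 1)), hC'.mono fun Φ hΦ c => ?_⟩,
    hS.mono fun Φ hΦ c => h Φ hΦ c _⟩
  have hE : 1 ≤ 2 ^ W Φ c := Nat.one_le_two_pow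
  generalize hEE : 2 ^ W Φ c = E at hE ⊢
  have hsum : ∑ k ∈ Finset.range E, (T Φ ((f Φ)^[k] (x Φ c)) + 1) ≤
      E * (P.eval (fnLength Φ) (S Φ c) + 1) := by
    calc _ ≤ ∑ _k ∈ Finset.range E, (P.eval (fnLength Φ) (S Φ c) + 1) :=
          Finset.sum_le_sum fun k _ => Nat.add_le_add_right ((hP Φ hΦ _).trans
            (P.eval_mono hΦ.fnLength_mono (h Φ hΦ c k))) 1
      _ = _ := by simp
  have a1 := Nat.le_mul_of_pos_right (TW Φ c) hE
  have a2 := Nat.le_mul_of_pos_right (Tx Φ c) hE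
  have a3 : C' * (size c + E + size (x Φ c) + 1) ≤ C' * (size c + size (x Φ c) + 2) * E := by
    rw [mul_assoc]
    refine Nat.mul_le_mul_left _ ?_
    have := Nat.le_mul_of_pos_right (size c) hE
    have := Nat.le_mul_of_pos_right (size (x Φ c)) hE
    rw [Nat.add_mul, Nat.add_mul]
    omega
  rw [mul_comm E] at hsum
  simp only [Nat.add_mul _ _ E]
  rw [Nat.add_mul] at hsum
  omega

/-- Iteration of a function of exponential running time. -/
theorem iterate {V : StrFun → α → ℕ} {f : StrFun → α → α} (hf : XT V f) {n : StrFun → γ → ℕ}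
    (hn : PT n) {x : StrFun → γ → α} (hx : PT x) {S W : StrFun → γ → ℕ} (hS : Bdd S)
    (h : ∀ Φ, LengthMonotone Φ → ∀ c, ∀ k ≤ n Φ c, size ((f Φ)^[k] (x Φ c)) ≤ S Φ c)
    (hV : ∀ Φ, LengthMonotone Φ → ∀ c, ∀ k < n Φ c, V Φ ((f Φ)^[k] (x Φ c)) ≤ W Φ c) :
    XT W fun Φ c => (f Φ)^[n Φ c] (x Φ c) := by
  obtain ⟨⟨T, ⟨P, hP⟩, hT⟩, -⟩ := hf
  obtain ⟨⟨Tn, hTn, hTn'⟩, hn⟩ := hn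
  obtain ⟨⟨Tx, hTx, hTx'⟩, hx⟩ := hx
  obtain ⟨C, hC⟩ := hT.iterate hTn hTx
  have hn' : Bdd n := hn.mono fun Φ _ c => by simp
  refine ⟨⟨_, ((hTn'.add hTx').add ((Bdd.const C).mul (((Bdd.size.add hn').add hx).add
    (.const 1)))).add (hn'.mul ((Bdd.poly P hS).add (.const 1))), hC.mono fun Φ hΦ c => ?_⟩,
    hS.mono fun Φ hΦ c => h Φ hΦ c _ le_rfl⟩
  have hE : 1 ≤ 2 ^ W Φ c := Nat.one_le_two_pow
  generalize hEE : 2 ^ W Φ c = E at hE ⊢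
  have hsum : ∑ k ∈ Finset.range (n Φ c), (T Φ ((f Φ)^[k] (x Φ c)) * 2 ^ V Φ ((f Φ)^[k] (x Φ c)) + 1) ≤
      n Φ c * (P.eval (fnLength Φ) (S Φ c) + 1) * E := by
    calc _ ≤ ∑ _k ∈ Finset.range (n Φ c), (P.eval (fnLength Φ) (S Φ c) + 1) * E := by
          refine Finset.sum_le_sum fun k hk => ?_
          rw [Finset.mem_range] at hk
          rw [Nat.add_mul]
          refine Nat.add_le_add (Nat.mul_le_mul ((hP Φ hΦ _).trans
            (P.eval_mono hΦ.fnLength_mono (h Φ hΦ c k hk.le))) ?_) (by omega)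
          rw [← hEE]
          exact Nat.pow_le_pow_right (by omega) (hV Φ hΦ c k hk)
      _ = _ := by simp [mul_assoc]
  have a1 := Nat.le_mul_of_pos_right (Tn Φ c) hE
  have a2 := Nat.le_mul_of_pos_right (Tx Φ c) hE
  have a3 := Nat.le_mul_of_pos_right (C * (size c + n Φ c + size (x Φ c) + 1)) hE
  simp only [Nat.add_mul _ _ E]
  omega

/-- The exponent is that of the branch taken, so a query for a modulus does not inherit the exponent
of the search. -/
theorem wcases {W0 W1 : StrFun → Word → ℕ} (a : StrFun → Word → β) {f0 f1 : StrFun → Word → β}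
    (ha : PT a) (h0 : XT W0 f0) (h1 : XT W1 f1) :
    XT (fun Φ w => wcases w 0 (W0 Φ) (W1 Φ))
      fun Φ w => wcases w (a Φ []) (f0 Φ) (f1 Φ) := by
  obtain ⟨⟨Ta, hTa, Pa, hPa⟩, Qa, hQa⟩ := ha
  obtain ⟨⟨T0, ⟨P0, hP0⟩, hT0⟩, Q0, hQ0⟩ := h0
  obtain ⟨⟨T1, ⟨P1, hP1⟩, hT1⟩, Q1, hQ1⟩ := h1
  -- `Comp.uncons` expects a word paired with further data; `Unit` occupies no register and serves
  -- as an empty remainder.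
  have hst : ∀ w : Word, store (w, ()) = store w := by
    intro w
    funext r
    change glue 1 (store w) (fun _ => []) r = _
    by_cases hr : r < 1
    · rw [glue_of_lt hr]
    · rw [glue_of_le (by omega)]
      exact (if_neg (by omega)).symm
  have hna := hTa.iso (fun p : Word × Unit => p.1) (fun p => hst p.1)
    (g := fun Φ (p : Word × Unit) => a Φ p.1) fun _ _ => rfl
  have hn0 := hT0.iso (fun p : Word × Unit => p.1) (fun p => hst p.1)
    (g := fun Φ (p : Word × Unit) => f0 Φ p.1) fun _ _ => rfl
  have hn1 := hT1.iso (fun p : Word × Unit => p.1) (fun p => hst p.1)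
    (g := fun Φ (p : Word × Unit) => f1 Φ p.1) fun _ _ => rfl
  have hu := (hna.uncons hn0 hn1).iso (fun w => (w, ())) (fun w => (hst w).symm)
    (g := fun Φ w => StackProg.wcases w (a Φ []) (f0 Φ) (f1 Φ)) (by
      rintro Φ (_ | ⟨_ | _, w⟩) <;> rfl)
  have mono : ∀ (P : SecondOrderPoly) Φ, LengthMonotone Φ → ∀ b (w : Word),
      P.eval (fnLength Φ) (size w) ≤ P.eval (fnLength Φ) (size (b :: w)) :=
    fun P Φ hΦ b w => P.eval_mono hΦ.fnLength_mono (by simp)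
  refine ⟨⟨_, (((Bdd.poly Pa .size).add (.poly P0 .size)).add (.poly P1 .size)).add (.const 1),
    hu.mono ?_⟩, (((Bdd.poly Qa .size).add (.poly Q0 .size)).add (.poly Q1 .size)).mono ?_⟩
  · rintro Φ hΦ (_ | ⟨_ | _, w⟩)
    · have := hPa Φ hΦ []
      simp only [wcases_nil, pow_zero, mul_one]; omega
    · have := Nat.mul_le_mul_right (2 ^ W0 Φ w) ((hP0 Φ hΦ w).trans (mono P0 Φ hΦ false w))
      have h1 : 1 ≤ 2 ^ W0 Φ w := Nat.one_le_two_pow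
      simp only [wcases_false]
      rw [Nat.add_mul, Nat.add_mul, Nat.add_mul]
      omega
    · have := Nat.mul_le_mul_right (2 ^ W1 Φ w) ((hP1 Φ hΦ w).trans (mono P1 Φ hΦ true w))
      have h1 : 1 ≤ 2 ^ W1 Φ w := Nat.one_le_two_pow
      simp only [wcases_true]
      rw [Nat.add_mul, Nat.add_mul, Nat.add_mul]
      omega
  · rintro Φ hΦ (_ | ⟨_ | _, w⟩)
    · have : size (a Φ []) ≤ _ := hQa Φ hΦ []
      simp only [wcases_nil]; omega
    · have : size (f0 Φ w) ≤ _ := (hQ0 Φ hΦ w).trans (mono Q0 Φ hΦ false w)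
      simp only [wcases_false]; omega
    · have : size (f1 Φ w) ≤ _ := (hQ1 Φ hΦ w).trans (mono Q1 Φ hΦ true w)
      simp only [wcases_true]; omega

end XT

end StackProg

/-! ## The search algorithm -/

namespace InverseSearch

open Function StackProg

variable {α : Type} [Data α]

/-! ### Access to the parts of a name -/

/-- The grid name that is part of `Φ`. -/
def getPsi (Φ : StrFun) (w : Word) : Word := dropToOne (Φ (true :: w))

/-- The approximation function that is part of `Φ`. -/
def getPhi (Φ : StrFun) (w : Word) : Word :=
  dropToOne (dropToOne (dropToOne (Φ (false :: false :: false :: w))))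

/-- The modulus of continuity that is part of `Φ`. -/
def getMc (Φ : StrFun) (n : ℕ) : ℕ :=
  (dropToOne (dropToOne (dropToOne (Φ (false :: false :: true :: unary n))))).length

/-- The modulus of unicity that is part of `Φ`. -/
def getMu (Φ : StrFun) (n : ℕ) : ℕ :=
  (dropToOne (dropToOne (Φ (false :: true :: unary n)))).length

section SetName

variable (φ : StrFun) (μc μu : ℕ → ℕ) (ψ : StrFun)

theorem getPsi_setName (w : Word) : getPsi (setName φ μc μu ψ) w = ψ w :=
  dropToOne_unary _ _

theorem getPhi_setName (w : Word) : getPhi (setName φ μc μu ψ) w = φ w := by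
  simp only [getPhi, setName, fpair, parName, dropToOne_unary]

theorem getMc_setName (n : ℕ) : getMc (setName φ μc μu ψ) n = μc n := by
  simp only [getMc, setName, fpair, parName, dropToOne_unary, modulusFun, length_unary]

theorem getMu_setName (n : ℕ) : getMu (setName φ μc μu ψ) n = μu n := by
  simp only [getMu, setName, fpair, parName, dropToOne_unary, modulusFun, length_unary]

end SetName

theorem PT.getPsi {f : StrFun → α → Word} (hf : PT f) : PT fun Φ x => getPsi Φ (f Φ x) :=
  (hf.cons true).oracle.dropToOne

theorem PT.getPhi {f : StrFun → α → Word} (hf : PT f) : PT fun Φ x => getPhi Φ (f Φ x) :=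
  (((hf.cons false).cons false).cons false).oracle.dropToOne.dropToOne.dropToOne

theorem PT.getMc {f : StrFun → α → ℕ} (hf : PT f) : PT fun Φ x => getMc Φ (f Φ x) :=
  (((hf.nat_to_word.cons true).cons false).cons false).oracle.dropToOne.dropToOne.dropToOne.length

theorem PT.getMu {f : StrFun → α → ℕ} (hf : PT f) : PT fun Φ x => getMu Φ (f Φ x) :=
  ((hf.nat_to_word.cons true).cons false).oracle.dropToOne.dropToOne.length

/-- `Equiv.intEquivNat` sends `m` to `2 * m` and `-(m + 1)` to `2 * m + 1`. Hence the positive part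
of the coded integer is half of an even code and zero for an odd one, and parity and half are
tracked together. -/
def halfStep (x : Bool × ℕ) : Bool × ℕ := cond x.1 (false, x.2 + 1) (true, x.2)

theorem halfStep_iterate (n : ℕ) : halfStep^[n] (false, 0) = (decide (n % 2 = 1), n / 2) := by
  induction n with
  | zero => rfl
  | succ n ih =>
    rw [iterate_succ_apply', ih]
    rcases Nat.mod_two_eq_zero_or_one n with h | h
    · have h1 : (n + 1) % 2 = 1 := by omega
      have h2 : (n + 1) / 2 = n / 2 := by omega
      simp [halfStep, h, h1, h2]
    · have h1 : ¬ (n + 1) % 2 = 1 := by omega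
      have h2 : (n + 1) / 2 = n / 2 + 1 := by omega
      simp [halfStep, h, h1, h2]

/-- The positive part of the outer radius parameter that is part of `Φ`. -/
def radius (Φ : StrFun) : ℕ :=
  cond (halfStep^[(getPsi Φ []).length] (false, 0)).1 0
    (halfStep^[(getPsi Φ []).length] (false, 0)).2

theorem radius_setName (φ : StrFun) (μc μu : ℕ → ℕ) (ψ : StrFun) :
    radius (setName φ μc μu ψ) = (outerRadius ψ).toNat := by
  rw [radius, getPsi_setName, halfStep_iterate, outerRadius]
  generalize (ψ []).length = k
  rcases Nat.even_or_odd' k with ⟨m, rfl | rfl⟩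
  · have : Equiv.intEquivNat.symm (2 * m) = (m : ℤ) := by
      rw [Equiv.symm_apply_eq]; rfl
    rw [this]; simp
  · have : Equiv.intEquivNat.symm (2 * m + 1) = Int.negSucc m := by
      rw [Equiv.symm_apply_eq]; rfl
    rw [this]; simp

theorem PT.radius : PT fun Φ (_ : α) => radius Φ := by
  have h := PT.iterate (f := fun _ (_ : α) x => halfStep x) (PT.getPsi (PT.const [])).length
    ((PT.bool false).pair PT.zero) (PT.snd'.fst.cond ((PT.bool false).pair PT.snd'.snd.succ)
      ((PT.bool true).pair PT.snd'.snd)) (Bdd.const 1) (by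
      rintro _ _ _ ⟨_ | _, n⟩ <;> simp [halfStep]; omega)
  exact h.fst.cond PT.zero h.snd

/-! ### One level of the search -/

/-- The width of the grid on level `r` is `2 ^ (-gridLevel Φ r)`. -/
def gridLevel (Φ : StrFun) (r : ℕ) : ℕ := getMc Φ (getMu Φ r + 4)

/-- The number of digits by which a coordinate may change on level `r`. -/
def chunk (Φ : StrFun) (r : ℕ) : ℕ := radius Φ + gridLevel Φ r + 4 - r

def width (d : ℕ) (Φ : StrFun) (r : ℕ) : ℕ := d * (chunk Φ r + 2)

theorem PT.gridLevel {r : StrFun → α → ℕ} (hr : PT r) : PT fun Φ x => gridLevel Φ (r Φ x) :=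
  PT.getMc ((PT.getMu hr).add (PT.nat 4))

theorem PT.chunk {r : StrFun → α → ℕ} (hr : PT r) : PT fun Φ x => chunk Φ (r Φ x) :=
  ((PT.radius.add (PT.gridLevel hr)).add (PT.nat 4)).sub hr

theorem PT.width (d : ℕ) {r : StrFun → α → ℕ} (hr : PT r) : PT fun Φ x => width d Φ (r Φ x) :=
  ((PT.chunk hr).add (PT.nat 2)).const_mul d

/-- The parameters of a search: the code of the target, the code of the centre, the exponent of the
step width, the number of digits by which a coordinate may change, the level of the grid and the
precision of the evaluation. -/
abbrev Ctx : Type := Word × Word × ℕ × ℕ × ℕ × ℕ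

def trialPoint (d : ℕ) (x : Ctx) (c : Word) : Word := shift d x.2.1 x.2.2.1 x.2.2.2.1 c

/-- The point with code `p` belongs to the grid set, and its approximate image is close to the
target. -/
def accepts (e : ℕ) (Φ : StrFun) (x : Ctx) (p : Word) : Bool :=
  (getPsi Φ (wpair p (unary x.2.2.2.2.1))).headD false &&
    near e x.1 (getPhi Φ (wpair p (unary x.2.2.2.2.2))) x.2.2.2.2.2

/-- Tests the trial point given by a counter and increases the counter. -/
def trial (d e : ℕ) (Φ : StrFun) (x : Ctx × Word × Word) : Ctx × Word × Word :=
  (x.1, incr x.2.1, cond (accepts e Φ x.1 (trialPoint d x.1 x.2.1))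
    (trialPoint d x.1 x.2.1) x.2.2)

theorem PT.trialPoint (d : ℕ) {x : StrFun → α → Ctx} {c : StrFun → α → Word} (hx : PT x)
    (hc : PT c) : PT fun Φ y => trialPoint d (x Φ y) (c Φ y) :=
  PT.shift d hx.snd.fst hx.snd.snd.fst hx.snd.snd.snd.fst hc

theorem PT.accepts (e : ℕ) {x : StrFun → α → Ctx} {p : StrFun → α → Word} (hx : PT x)
    (hp : PT p) : PT fun Φ y => accepts e Φ (x Φ y) (p Φ y) :=
  (PT.getPsi (hp.wpair hx.snd.snd.snd.snd.fst.nat_to_word)).headD.and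
    (PT.near e hx.fst (PT.getPhi (hp.wpair hx.snd.snd.snd.snd.snd.nat_to_word))
      hx.snd.snd.snd.snd.snd)

theorem PT.trial (d e : ℕ) : PT (trial d e) :=
  have hp := PT.trialPoint d (PT.fst' (α := Ctx) (β := Word × Word)) PT.snd'.fst
  PT.fst'.pair (PT.snd'.fst.incr.pair ((PT.accepts e PT.fst' hp).cond hp PT.snd'.snd))

/-- A later accepted point overwrites an earlier one. Which of them survives does not matter,
because acceptance alone guarantees closeness to the solution. -/
theorem trial_iterate (d e : ℕ) (Φ : StrFun) (x : Ctx) (c b : Word) (k : ℕ) :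
    ∃ b', (trial d e Φ)^[k] (x, c, b) = (x, incr^[k] c, b') ∧
      (b' = b ∧ (∀ m < k, accepts e Φ x (trialPoint d x (incr^[m] c)) = false) ∨
        ∃ m < k, b' = trialPoint d x (incr^[m] c) ∧ accepts e Φ x b' = true) := by
  induction k with
  | zero => exact ⟨b, rfl, Or.inl ⟨rfl, by simp⟩⟩
  | succ k ih =>
    obtain ⟨b', h, h'⟩ := ih
    rw [iterate_succ_apply', h]
    refine ⟨_, by rw [trial, iterate_succ_apply'], ?_⟩
    cases hacc : accepts e Φ x (trialPoint d x (incr^[k] c)) with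
    | true =>
      simp only [cond_true]
      exact Or.inr ⟨k, by omega, rfl, hacc⟩
    | false =>
      simp only [cond_false]
      rcases h' with ⟨rfl, h'⟩ | ⟨m, hm, hb, ha⟩
      · refine Or.inl ⟨rfl, fun m hm => ?_⟩
        rcases Nat.lt_succ_iff_lt_or_eq.1 hm with hm | rfl
        · exact h' m hm
        · exact hacc
      · exact Or.inr ⟨m, by omega, hb, ha⟩

/-- The parameters of the search on level `x.2.1` with target `x.1.1` around the centre `x.2.2`,
where `2 ^ x.1.2` is the common denominator. -/
def ctx (Φ : StrFun) (x : (Word × ℕ) × ℕ × Word) : Ctx :=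
  (x.1.1, x.2.2, x.1.2 - gridLevel Φ x.2.1, chunk Φ x.2.1, gridLevel Φ x.2.1, getMu Φ x.2.1 + 3)

/-- The new centre. -/
def refineCentre (d e : ℕ) (Φ : StrFun) (x : (Word × ℕ) × ℕ × Word) : Word :=
  ((trial d e Φ)^[2 ^ width d Φ x.2.1] (ctx Φ x, unary (width d Φ x.2.1), x.2.2)).2.2

theorem refineCentre_spec (d e : ℕ) (Φ : StrFun) (x : (Word × ℕ) × ℕ × Word) :
    refineCentre d e Φ x = x.2.2 ∧ (∀ c : Word, c.length = width d Φ x.2.1 →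
        accepts e Φ (ctx Φ x) (trialPoint d (ctx Φ x) c) = false) ∨
      ∃ c : Word, refineCentre d e Φ x = trialPoint d (ctx Φ x) c ∧
        accepts e Φ (ctx Φ x) (refineCentre d e Φ x) = true := by
  obtain ⟨b', h, h'⟩ := trial_iterate d e Φ (ctx Φ x) (unary (width d Φ x.2.1)) x.2.2
    (2 ^ width d Φ x.2.1)
  have hb : refineCentre d e Φ x = b' := by rw [refineCentre, h]
  rw [hb]
  rcases h' with ⟨rfl, h'⟩ | ⟨m, _, h1, h2⟩
  · refine Or.inl ⟨rfl, fun c hc => ?_⟩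
    obtain ⟨m, hm, hm'⟩ := exists_incr_iterate c
    rw [hc] at hm hm'
    rw [← hm']
    exact h' m hm
  · exact Or.inr ⟨_, h1, h2⟩

theorem XT.refineCentre (d e : ℕ) : XT (fun Φ x => width d Φ x.2.1) (refineCentre d e) := by
  have hr : PT fun _ (x : (Word × ℕ) × ℕ × Word) => x.2.1 := PT.snd'.fst
  have hctx : PT ctx := PT.fst'.fst.pair (PT.snd'.snd.pair ((PT.fst'.snd.sub
    (PT.gridLevel hr)).pair ((PT.chunk hr).pair ((PT.gridLevel hr).pair
      ((PT.getMu hr).add (PT.nat 3))))))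
  have hW := PT.width d hr
  have hx : PT fun Φ (x : (Word × ℕ) × ℕ × Word) =>
      (ctx Φ x, unary (width d Φ x.2.1), x.2.2) := hctx.pair (hW.nat_to_word.pair PT.snd'.snd)
  obtain ⟨P, hP⟩ := (PT.trialPoint d (PT.fst' (α := Ctx) (β := Word)) PT.snd').2
  -- During the exponentially many rounds nothing accumulates: the counter has fixed length, and the
  -- stored word is the old centre or one trial point computed from it.
  have h := XT.iterate_two_pow (PT.trial d e) hW hx (hx.2.add (Bdd.poly P hx.2)) (by
    intro Φ hΦ x k
    obtain ⟨b', h, h'⟩ := trial_iterate d e Φ (ctx Φ x) (unary (width d Φ x.2.1)) x.2.2 k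
    rw [h]
    simp only [size_prod (α := Ctx), size_prod (α := Word) (β := Word), size_word,
      length_incr_iterate]
    rcases h' with ⟨rfl, -⟩ | ⟨m, _, rfl, -⟩
    · exact Nat.le_add_right _ _
    · have h1 : size (trialPoint d (ctx Φ x) (incr^[m] (unary (width d Φ x.2.1)))) ≤ _ :=
        hP Φ hΦ (ctx Φ x, incr^[m] (unary (width d Φ x.2.1)))
      have h2 := P.eval_mono hΦ.fnLength_mono (show size (ctx Φ x, incr^[m] (unary
        (width d Φ x.2.1))) ≤ size (ctx Φ x) + ((unary (width d Φ x.2.1)).length +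
          x.2.2.length) by
          rw [size_prod (α := Ctx), size_word, length_incr_iterate]; simp only; omega)
      rw [size_word] at h1
      omega)
  exact XT.PT_comp (g := fun _ (x : Ctx × Word × Word) => x.2.2) PT.snd'.snd h

/-! ### The complete search -/

def refineStep (d e : ℕ) (Φ : StrFun) (x : (Word × ℕ) × ℕ × Word) : (Word × ℕ) × ℕ × Word :=
  (x.1, x.2.1 + 1, refineCentre d e Φ x)

/-- The common denominator is `2 ^ maxLevel Φ u`. -/
def maxLevel (Φ : StrFun) (u : Word) : ℕ := gridLevel Φ (u.length + 2)

/-- Grid points next to `S` have coordinates of absolute value at most `2 ^ b + 1 < 2 ^ (b + 4)`,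
with `b = radius Φ`; scaled by the common denominator they fit into this many digits. -/
def digits (Φ : StrFun) (u : Word) : ℕ := maxLevel Φ u + radius Φ + 4

def startCode (d : ℕ) (Φ : StrFun) (u : Word) : Word :=
  zeroCode d (maxLevel Φ u) (digits Φ u)

def startState (d : ℕ) (Φ : StrFun) (u : Word) : (Word × ℕ) × ℕ × Word :=
  (((unpair u).1, maxLevel Φ u), 0, startCode d Φ u)

/-- An approximate preimage, computed from a code of the target and a precision. -/
def solve (d e : ℕ) (Φ : StrFun) (u : Word) : Word :=
  ((refineStep d e Φ)^[(unpair u).2.length + 3] (startState d Φ u)).2.2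

/-- The centre before level `k`. -/
def centre (d e : ℕ) (Φ : StrFun) (u : Word) (k : ℕ) : Word :=
  ((refineStep d e Φ)^[k] (startState d Φ u)).2.2

theorem refineStep_iterate (d e : ℕ) (Φ : StrFun) (u : Word) (k : ℕ) :
    (refineStep d e Φ)^[k] (startState d Φ u) =
      (((unpair u).1, maxLevel Φ u), k, centre d e Φ u k) := by
  induction k with
  | zero => rfl
  | succ k ih =>
    have : centre d e Φ u (k + 1) =
      ((refineStep d e Φ)^[k + 1] (startState d Φ u)).2.2 := rfl
    rw [this, iterate_succ_apply', ih]
    rfl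

theorem centre_succ (d e : ℕ) (Φ : StrFun) (u : Word) (k : ℕ) : centre d e Φ u (k + 1) =
    refineCentre d e Φ (((unpair u).1, maxLevel Φ u), k, centre d e Φ u k) := by
  rw [centre, iterate_succ_apply', refineStep_iterate]
  rfl

/-- Shifts preserve the format unconditionally, so no assumption on the oracle or on the target is
needed. -/
theorem fmt_centre (d e : ℕ) (Φ : StrFun) (u : Word) (k : ℕ) :
    ∃ a, Fmt (maxLevel Φ u) (digits Φ u) d (centre d e Φ u k) a := by
  induction k with
  | zero => exact ⟨0, fmt_zeroCode d⟩
  | succ k ih =>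
    obtain ⟨a, ha⟩ := ih
    rw [centre_succ]
    rcases refineCentre_spec d e Φ (((unpair u).1, maxLevel Φ u), k, centre d e Φ u k) with
      ⟨h, -⟩ | ⟨c, h, -⟩
    · rw [h]; exact ⟨a, ha⟩
    · rw [h]; exact ha.shift _ _ _

theorem length_centre (d e : ℕ) (Φ : StrFun) (u : Word) (k : ℕ) :
    (centre d e Φ u k).length = (startCode d Φ u).length := by
  obtain ⟨a, ha⟩ := fmt_centre d e Φ u k
  exact ha.length_eq (fmt_zeroCode d)

/-- The length depends on `u` through `u.length` alone, because `maxLevel` is taken at `u.length +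
2` and not at the requested precision plus two. This gives length-monotonicity and lets the padding
be computed without searching. -/
theorem length_solve (d e : ℕ) (Φ : StrFun) (u : Word) :
    (solve d e Φ u).length = (startCode d Φ u).length := length_centre ..

theorem PT.startCode (d : ℕ) {u : StrFun → α → Word} (hu : PT u) :
    PT fun Φ x => startCode d Φ (u Φ x) :=
  have hm := PT.gridLevel (hu.length.add (PT.nat 2))
  PT.zeroCode d hm ((hm.add PT.radius).add (PT.nat 4))

/-- The largest counter that is used in the search. -/
def solveWidth (d : ℕ) (Φ : StrFun) (u : Word) : ℕ :=
  (Finset.range ((unpair u).2.length + 3)).sup (width d Φ)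

theorem XT.solve (d e : ℕ) : XT (solveWidth d) (solve d e) := by
  have hn : PT fun _ (u : Word) => (unpair u).2.length + 3 :=
    PT.id.unpair.snd.length.add (PT.nat 3)
  have hs : PT (startState d) := (PT.id.unpair.fst.pair
    (PT.gridLevel (PT.id.length.add (PT.nat 2)))).pair (PT.zero.pair (PT.startCode d PT.id))
  have hstep : XT (fun Φ x => width d Φ x.2.1) (refineStep d e) :=
    (XT.of_PT PT.fst' _).pair ((XT.of_PT PT.snd'.fst.succ _).pair (XT.refineCentre d e))
  refine XT.PT_comp (g := fun _ (x : (Word × ℕ) × ℕ × Word) => x.2.2) PT.snd'.snd (XT.iterate hstep hn hs (hs.2.add (hn.2)) ?_ ?_)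
  · intro Φ _ u k hk
    rw [refineStep_iterate]
    simp only [startState, size_prod, size_word, size_nat, length_centre]
    omega
  · intro Φ _ u k hk
    rw [refineStep_iterate]
    exact Finset.le_sup (Finset.mem_range.2 hk)

/-! ### The name of the inverse -/

/-- The modulus of continuity of the inverse. -/
def outModulus (Φ : StrFun) (n : ℕ) : ℕ := getMu Φ (n + 1) + 3

/-- The length of the inner pair at a nonempty word with tail `u`, which is the same for both first
letters. -/
def innerLength (d : ℕ) (Φ : StrFun) (u : Word) : ℕ :=
  (startCode d Φ u).length + 1 + outModulus Φ u.length

/-- The paired name of the inverse with all padding lengths in closed form; only words that begin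
with `00` start a search. -/
def mainFun (d e : ℕ) (Φ : StrFun) (s : Word) : Word :=
  wcases s [] (fun v => wcases v (unary (getMc Φ 0) ++ [true])
      (fun u => unary (getMc Φ (u.length + 1)) ++
        true :: (unary (outModulus Φ u.length) ++ true :: solve d e Φ u))
      (fun u => unary (getMc Φ (u.length + 1)) ++
        true :: (unary (startCode d Φ u).length ++ true :: unary (outModulus Φ u.length))))
    (fun v => unary (wcases v 0 (innerLength d Φ) (innerLength d Φ)) ++
      true :: unary (getMc Φ v.length))

theorem mainFun_eq (d e : ℕ) (Φ : StrFun) :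
    mainFun d e Φ = parName (solve d e Φ) (outModulus Φ) (getMc Φ) := by
  funext s
  match s with
  | [] => rfl
  | [false] => simp [mainFun, parName, fpair, modulusFun]
  | false :: false :: u => simp [mainFun, parName, fpair, modulusFun]
  | false :: true :: u => simp [mainFun, parName, fpair, modulusFun, length_solve]
  | [true] => rfl
  | true :: false :: u =>
    simp only [mainFun, parName, fpair, modulusFun, innerLength, wcases_true, wcases_false,
      List.length_append, List.length_cons, length_unary, length_solve]
    congr 2; omega
  | true :: true :: u =>
    simp only [mainFun, parName, fpair, modulusFun, innerLength, wcases_true,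
      List.length_append, List.length_cons, length_unary, length_solve]
    congr 2; omega

theorem PT.outModulus {n : StrFun → α → ℕ} (hn : PT n) : PT fun Φ x => outModulus Φ (n Φ x) :=
  (PT.getMu hn.succ).add (PT.nat 3)

def mainWidth (d : ℕ) (Φ : StrFun) (s : Word) : ℕ :=
  wcases s 0 (fun v => wcases v 0 (solveWidth d Φ) fun _ => 0) fun _ => 0

theorem XT.mainFun (d e : ℕ) : XT (mainWidth d) (mainFun d e) := by
  have hmc : PT fun Φ (u : Word) => getMc Φ (u.length + 1) := PT.getMc PT.id.length.succ
  have hom : PT fun Φ (u : Word) => outModulus Φ u.length := PT.outModulus PT.id.length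
  have hsc : PT fun Φ (u : Word) => (InverseSearch.startCode d Φ u).length :=
    (PT.startCode d PT.id).length
  have hil : PT fun Φ (u : Word) => innerLength d Φ u := hsc.succ.add hom
  have h0 : XT (solveWidth d) fun Φ u => unary (getMc Φ (u.length + 1)) ++
      true :: (unary (InverseSearch.outModulus Φ u.length) ++ true :: InverseSearch.solve d e Φ u) := by
    have hg : PT fun Φ (x : Word × Word) => unary (getMc Φ (x.1.length + 1)) ++
        true :: (unary (InverseSearch.outModulus Φ x.1.length) ++ true :: x.2) :=
      (PT.getMc PT.fst'.length.succ).nat_to_word.append (PT.cons true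
        ((PT.outModulus PT.fst'.length).nat_to_word.append (PT.snd'.cons true)))
    exact XT.PT_comp hg ((XT.of_PT PT.id _).pair (XT.solve d e))
  refine XT.wcases (fun _ _ => []) (PT.const []) (XT.wcases (fun Φ _ => unary (getMc Φ 0) ++ [true])
    ((PT.getMc PT.zero).nat_to_word.append (PT.const [true])) h0 (XT.of_PT ?_ _)) (XT.of_PT ?_ _)
  · exact hmc.nat_to_word.append (PT.cons true (hsc.nat_to_word.append
      (hom.nat_to_word.cons true)))
  · exact (PT.nat_to_word (PT.wcases PT.id PT.zero (hil.comp PT.snd')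
      (hil.comp PT.snd'))).append ((PT.getMc PT.id.length).nat_to_word.cons true)

/-- The search algorithm as an oracle machine. -/
theorem exists_machine (d e : ℕ) : ∃ (M : OracleTM) (P : SecondOrderPoly), ∀ Φ, LengthMonotone Φ →
    ∀ s, ∃ t ≤ P.eval (fnLength Φ) s.length * 2 ^ mainWidth d Φ s, M.HaltsIn Φ s t ∧
      OracleTM.readWord ((M.run Φ s t).tape 2) = mainFun d e Φ s := by
  -- Two empty words in front place the result in register `2`, which is the output tape.
  have h : XT (mainWidth d) fun Φ s => (([] : Word), ([] : Word), mainFun d e Φ s) :=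
    (XT.of_PT (PT.const []) _).pair ((XT.of_PT (PT.const []) _).pair (XT.mainFun d e))
  obtain ⟨⟨T, ⟨P, hP⟩, p, hp⟩, -⟩ := h
  refine ⟨machine p, P, fun Φ hΦ s => ?_⟩
  obtain ⟨t, ht, hr⟩ := hp Φ hΦ s
  have hP' := hP Φ hΦ s
  rw [size_word] at hP'
  exact ⟨t, ht.trans (Nat.mul_le_mul_right _ hP'), machine_halts hr⟩

end InverseSearch

/-! ## Correctness of the search -/

namespace InverseSearch

open Function StackProg

variable {d e : ℕ} {f : (Fin d → ℝ) →. (Fin e → ℝ)} {S : Set (Fin d → ℝ)} {φ ψ : StrFun}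
  {μc μu : ℕ → ℕ}

theorem half_pow_le {m n : ℕ} (h : m ≤ n) : (1 / 2 : ℝ) ^ n ≤ (1 / 2 : ℝ) ^ m :=
  pow_le_pow_of_le_one (by norm_num) (by norm_num) h

/-- Two preimages of the same value satisfy the hypothesis of unicity for every `n`, so their
distance is below every `2 ^ (-n)`. -/
theorem unicity_eq (h : IsModulusOfUnicity f μu) {x x' : Fin d → ℝ} {y : Fin e → ℝ} (hx : y ∈ f x)
    (hx' : y ∈ f x') : x = x' := by
  have : ∀ n : ℕ, ‖x - x'‖ ≤ (1 / 2 : ℝ) ^ n := fun n =>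
    h n x x' y y hx hx' (by rw [sub_self, norm_zero]; positivity)
  have h0 := ge_of_tendsto' (tendsto_pow_atTop_nhds_zero_of_lt_one (r := (1 / 2 : ℝ))
    (by norm_num) (by norm_num)) this
  exact sub_eq_zero.1 (norm_eq_zero.1 (le_antisymm h0 (norm_nonneg _)))

theorem norm_le_radius (h : IsSetInvName f S φ μc μu ψ) {x : Fin d → ℝ} (hx : x ∈ S) :
    ‖x‖ ≤ 2 ^ (outerRadius ψ).toNat := by
  have h1 := h.gridName.bounded hx
  rw [mem_closedBall_zero_iff] at h1
  refine h1.trans ?_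
  rw [← zpow_natCast]
  exact zpow_le_zpow_right₀ (by norm_num) (Int.self_le_toNat _)

theorem two_mul_half_pow_le {μ : ℕ → ℕ} (hμ : StrictMono μ) (i : ℕ) :
    2 * (1 / 2 : ℝ) ^ μ (i + 1) ≤ (1 / 2 : ℝ) ^ μ i := by
  have h1 : μ i + 1 ≤ μ (i + 1) := hμ (Nat.lt_succ_self i)
  have h2 := half_pow_le h1
  rw [pow_succ] at h2
  linarith

theorem gridLevel_setName (r : ℕ) :
    gridLevel (setName φ μc μu ψ) r = μc (μu r + 4) := by
  rw [gridLevel, getMc_setName, getMu_setName]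

theorem le_gridLevel (h : IsSetInvName f S φ μc μu ψ) (r : ℕ) : r ≤ μc (μu r + 4) :=
  (h.parInvName.strict_unicity.le_apply).trans
    ((Nat.le_add_right _ 4).trans h.parInvName.strict_continuity.le_apply)

theorem gridLevel_mono (h : IsSetInvName f S φ μc μu ψ) : Monotone fun r => μc (μu r + 4) :=
  fun _ _ hr => h.parInvName.strict_continuity.monotone
    (Nat.add_le_add_right (h.parInvName.strict_unicity.monotone hr) 4)

/-- The point that belongs to a vector of integers and a common denominator. -/
noncomputable def point (J : ℕ) (a : Fin d → ℤ) : Fin d → ℝ := fun l => (a l : ℝ) / 2 ^ J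

/-! ### Soundness and completeness of the acceptance test -/

/-- Accepted points are close to the solution. -/
theorem accepts_sound (h : IsSetInvName f S φ μc μu ψ) {x : Fin d → ℝ} {y q : Fin e → ℝ}
    (hy : y ∈ f x) {w : Word} (hw : IsDyadicCode e w q) {r : ℕ}
    (hq : ‖y - q‖ ≤ (1 / 2 : ℝ) ^ (μu r + 3)) {J N : ℕ} {p : Word} {a : Fin d → ℤ}
    (hp : Fmt J N d p a) {X : Ctx} (hX₁ : X.1 = w) (hX₂ : X.2.2.2.2 = (μc (μu r + 4), μu r + 3))
    (hJ : μc (μu r + 4) ≤ J) (hacc : accepts e (setName φ μc μu ψ) X p = true) :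
    (∀ l, (2 : ℤ) ^ (J - μc (μu r + 4)) ∣ a l) ∧
      ‖point J a - x‖ ≤ (1 / 2 : ℝ) ^ r + (1 / 2 : ℝ) ^ μc (μu r + 4) := by
  rw [accepts, Bool.and_eq_true, hX₁, hX₂, getPsi_setName, getPhi_setName] at hacc
  obtain ⟨B, hB₁, hB₂, -, hB₄⟩ := h.gridName.grid
  have hcode : IsDyadicCode d p (point J a) := hp.isDyadicCode
  have hmem : point J a ∈ B (μc (μu r + 4)) := by
    by_contra hn
    have := hacc.1
    rw [(hB₂ p _ _ hcode).2 hn] at this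
    exact absurd this (by simp)
  refine ⟨fun l => ?_, ?_⟩
  · obtain ⟨z, hz⟩ := hB₁ _ hmem l
    refine ⟨z, ?_⟩
    have h1 : (a l : ℝ) = 2 ^ (J - μc (μu r + 4)) * z := by
      have h2 : (2 : ℝ) ^ J = 2 ^ (J - μc (μu r + 4)) * 2 ^ μc (μu r + 4) := by
        rw [← pow_add, Nat.sub_add_cancel hJ]
      rw [point, h2] at hz
      field_simp at hz
      linarith
    exact_mod_cast h1
  -- A member of the grid set has a point of `S` within `2 ^ (-μc (μu r + 4))`, so the specification
  -- of `φ` at precision `μu r + 3` applies. It speaks of some nearby `x₂` in the domain, not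
  -- necessarily in `S`.
  · obtain ⟨x₁, hx₁, hd₁⟩ := hB₄ _ _ hmem
    obtain ⟨v, hv, x₂, ⟨-, hx₂⟩, y₂, hy₂, hvy⟩ := h.parInvName.approx p (point J a) (μu r + 3) hcode
      ⟨x₁, h.subset_dom hx₁, by rw [Metric.mem_closedBall, dist_eq_norm, norm_sub_rev]; exact hd₁⟩
    rw [Metric.mem_closedBall, dist_eq_norm] at hx₂
    have hnear := (near_iff_norm hw hv _).1 hacc.2
    have e1 : (1 / 2 : ℝ) ^ (μu r + 3) = (1 / 2 : ℝ) ^ μu r / 8 := by rw [pow_add]; ring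
    have e2 : (1 / 2 : ℝ) ^ (μu r + 3 + 1) = (1 / 2 : ℝ) ^ μu r / 16 := by
      rw [pow_add, pow_add]; ring
    rw [e1] at hnear hq
    rw [e2] at hvy
    have hpos : (0 : ℝ) < (1 / 2 : ℝ) ^ μu r := by positivity
    -- In units of `2 ^ (-(μu r + 3))` the three errors are 1/2 (for `φ`), 4 (for the test) and 1
    -- (for `q`), together less than 8.
    have hyy : ‖y₂ - y‖ ≤ (1 / 2 : ℝ) ^ μu r := by
      calc ‖y₂ - y‖ = ‖-(v - y₂) - (q - v) - (y - q)‖ := by congr 1; abel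
        _ ≤ ‖v - y₂‖ + ‖q - v‖ + ‖y - q‖ := by
          refine (norm_sub_le _ _).trans (add_le_add_left ((norm_sub_le _ _).trans ?_) _)
          rw [norm_neg]
        _ ≤ _ := by linarith
    have hxx := h.parInvName.unicity r x₂ x y₂ y hy₂ hy hyy
    calc ‖point J a - x‖ = ‖(x₂ - x) - (x₂ - point J a)‖ := by congr 1; abel
      _ ≤ ‖x₂ - x‖ + ‖x₂ - point J a‖ := norm_sub_le _ _
      _ ≤ _ := add_le_add hxx hx₂

/-- Grid points that are close to the solution are accepted. -/
theorem accepts_complete (h : IsSetInvName f S φ μc μu ψ) {x : Fin d → ℝ} {y q : Fin e → ℝ}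
    (hx : x ∈ S) (hy : y ∈ f x) {w : Word} (hw : IsDyadicCode e w q) {r : ℕ}
    (hq : ‖y - q‖ ≤ (1 / 2 : ℝ) ^ (μu r + 3)) {p : Word} {z : Fin d → ℝ} (hp : IsDyadicCode d p z)
    {B : ℕ → Set (Fin d → ℝ)} (hz : z ∈ B (μc (μu r + 4)))
    (hB : ∀ (w : Word) (q : Fin d → ℝ) (n : ℕ), IsDyadicCode d w q →
      (q ∈ B n → ψ (wpair w (unary n)) = [true]) ∧ (q ∉ B n → ψ (wpair w (unary n)) = [false]))
    (hd : ‖z - x‖ ≤ (1 / 2 : ℝ) ^ μc (μu r + 4)) {X : Ctx} (hX₁ : X.1 = w)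
    (hX₂ : X.2.2.2.2 = (μc (μu r + 4), μu r + 3)) :
    accepts e (setName φ μc μu ψ) X p = true := by
  rw [accepts, Bool.and_eq_true, hX₁, hX₂, getPsi_setName, getPhi_setName]
  refine ⟨by rw [(hB p z _ hp).1 hz]; rfl, ?_⟩
  obtain ⟨v, hv, x₂, ⟨-, hx₂⟩, y₂, hy₂, hvy⟩ := h.parInvName.approx p z (μu r + 3) hp
    ⟨x, h.subset_dom hx, by rw [Metric.mem_closedBall, dist_eq_norm, norm_sub_rev]; exact hd⟩
  rw [Metric.mem_closedBall, dist_eq_norm] at hx₂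
  refine (near_iff_norm hw hv _).2 ?_
  -- Both points lie in the ball of radius `2 ^ (-μc (μu r + 4))` around `z`; strict monotonicity of
  -- `μc` absorbs the factor two at the price of one in the argument.
  have hxx : ‖x₂ - x‖ ≤ (1 / 2 : ℝ) ^ μc (μu r + 3) := by
    calc ‖x₂ - x‖ = ‖(x₂ - z) + (z - x)‖ := by congr 1; abel
      _ ≤ ‖x₂ - z‖ + ‖z - x‖ := norm_add_le _ _
      _ ≤ 2 * (1 / 2 : ℝ) ^ μc (μu r + 3 + 1) := by rw [two_mul]; exact add_le_add hx₂ hd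
      _ ≤ _ := two_mul_half_pow_le h.parInvName.strict_continuity _
  have hyy := h.parInvName.continuity _ x₂ x y₂ y hy₂ hy hxx
  have hpos : (0 : ℝ) < (1 / 2 : ℝ) ^ (μu r + 3) := by positivity
  rw [pow_succ] at hvy
  -- The errors are 1, 1 and 1/2 units, within the tolerance of 4.
  calc ‖q - v‖ = ‖-(y - q) - (y₂ - y) - (v - y₂)‖ := by congr 1; abel
    _ ≤ ‖y - q‖ + ‖y₂ - y‖ + ‖v - y₂‖ := by
      refine (norm_sub_le _ _).trans (add_le_add_left ((norm_sub_le _ _).trans ?_) _)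
      rw [norm_neg]
    _ ≤ _ := by linarith

/-- One level of the search. -/
theorem refineCentre_near (h : IsSetInvName f S φ μc μu ψ) {x : Fin d → ℝ} {y q : Fin e → ℝ}
    (hx : x ∈ S) (hy : y ∈ f x) {w : Word} (hw : IsDyadicCode e w q) {r J : ℕ}
    (hq : ‖y - q‖ ≤ (1 / 2 : ℝ) ^ (μu r + 3)) {p : Word} {a : Fin d → ℤ}
    (hp : Fmt J (J + (outerRadius ψ).toNat + 4) d p a) (hJ : μc (μu r + 4) ≤ J)
    (ha : ∀ l, (2 : ℤ) ^ (J - μc (μu r + 4)) ∣ a l)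
    (hd : ‖point J a - x‖ ≤ 2 ^ ((outerRadius ψ).toNat + 2) * (1 / 2 : ℝ) ^ r) :
    ∃ a', Fmt J (J + (outerRadius ψ).toNat + 4) d
        (refineCentre d e (setName φ μc μu ψ) ((w, J), r, p)) a' ∧
      (∀ l, (2 : ℤ) ^ (J - μc (μu r + 4)) ∣ a' l) ∧
      ‖point J a' - x‖ ≤ (1 / 2 : ℝ) ^ r + (1 / 2 : ℝ) ^ μc (μu r + 4) := by
  have hX₁ : (ctx (setName φ μc μu ψ) ((w, J), r, p)).1 = w := rfl
  have hX₂ : (ctx (setName φ μc μu ψ) ((w, J), r, p)).2.2.2.2 = (μc (μu r + 4), μu r + 3) := by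
    simp only [ctx, gridLevel_setName, getMu_setName]
  rcases refineCentre_spec d e (setName φ μc μu ψ) ((w, J), r, p) with ⟨-, hno⟩ | ⟨c, hc, hacc⟩
  -- It is impossible that every trial fails: the grid point `z` next to `x` is among the trial
  -- points and passes the test.
  · exfalso
    obtain ⟨B, hB₁, hB₂, hB₃, -⟩ := h.gridName.grid
    obtain ⟨z, hz, hzx⟩ := hB₃ (μc (μu r + 4)) x hx
    choose k hk using hB₁ _ hz
    have hrj := le_gridLevel h r
    have hxb := norm_le_radius h hx
    generalize hb : (outerRadius ψ).toNat = b at *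
    generalize hj : μc (μu r + 4) = j at *
    have hch : chunk (setName φ μc μu ψ) r = b + j + 4 - r := by
      rw [chunk, radius_setName, gridLevel_setName, hb, hj]
    have hzp : z = point J fun l => 2 ^ (J - j) * k l := by
      funext l
      have h2 : (2 : ℝ) ^ J = 2 ^ (J - j) * 2 ^ j := by rw [← pow_add, Nat.sub_add_cancel hJ]
      rw [hk, point, h2]
      push_cast
      field_simp
    have hJpos : (0 : ℝ) < 2 ^ J := by positivity
    have hbpos : (1 : ℝ) ≤ 2 ^ b := one_le_pow₀ (by norm_num)
    have hj1 : (1 / 2 : ℝ) ^ j ≤ 1 := pow_le_one₀ (by norm_num) (by norm_num)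
    have hjr := half_pow_le hrj
    have hrpos : (0 : ℝ) < (1 / 2 : ℝ) ^ r := by positivity
    obtain ⟨c, hc, hcf⟩ := hp.exists_shift (sh := J - j) (h := b + j + 4 - r)
      (a' := fun l => 2 ^ (J - j) * k l) (by omega) ha (fun l => Dvd.intro _ rfl) (by
        intro l
        have h1 : |z l| ≤ 2 ^ b + 1 := by
          calc |z l| ≤ ‖z‖ := norm_le_pi_norm z l
            _ = ‖x + (z - x)‖ := by congr 1; abel
            _ ≤ ‖x‖ + ‖z - x‖ := norm_add_le _ _
            _ ≤ _ := by linarith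
        have h2 : ((2 ^ (J - j) * k l : ℤ) : ℝ) = z l * 2 ^ J := by
          rw [hzp, point]; field_simp
        have h3 : |((2 ^ (J - j) * k l : ℤ) : ℝ)| < 2 ^ (J + b + 4) := by
          rw [h2, abs_mul, abs_of_pos hJpos, pow_add, pow_add]
          nlinarith [mul_le_mul_of_nonneg_right h1 hJpos.le, mul_le_mul_of_nonneg_right hbpos hJpos.le]
        exact_mod_cast h3) (by
        intro l
        have h1 : |z l - point J a l| ≤ (1 / 2 : ℝ) ^ r + 2 ^ (b + 2) * (1 / 2 : ℝ) ^ r := by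
          calc |z l - point J a l| ≤ ‖z - point J a‖ := norm_le_pi_norm (z - point J a) l
            _ = ‖(z - x) - (point J a - x)‖ := by congr 1; abel
            _ ≤ ‖z - x‖ + ‖point J a - x‖ := norm_sub_le _ _
            _ ≤ _ := by linarith
        have h2 : ((2 ^ (J - j) * k l - a l : ℤ) : ℝ) = (z l - point J a l) * 2 ^ J := by
          rw [hzp, point, point, sub_mul]
          push_cast
          field_simp
        have h4 : (2 : ℝ) ^ (J - j + (b + j + 4 - r)) = 2 ^ J * 2 ^ b * 16 * (1 / 2 : ℝ) ^ r := by
          rw [show J - j + (b + j + 4 - r) = J + b + 4 - r by omega,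
            pow_sub₀ _ (by norm_num) (by omega), pow_add, pow_add, one_div, inv_pow]
          norm_num
        have h3 : |((2 ^ (J - j) * k l - a l : ℤ) : ℝ)| < 2 ^ (J - j + (b + j + 4 - r)) := by
          rw [h2, abs_mul, abs_of_pos hJpos, h4]
          -- After division by `2 ^ (-r)` this is `1 + 4 * 2 ^ b < 16 * 2 ^ b`, the reason for the
          -- summand `4` in `chunk`.
          have h5 : (1 / 2 : ℝ) ^ r + 2 ^ (b + 2) * (1 / 2 : ℝ) ^ r <
              2 ^ b * 16 * (1 / 2 : ℝ) ^ r := by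
            rw [pow_add]
            nlinarith [mul_le_mul_of_nonneg_right hbpos hrpos.le]
          calc |z l - point J a l| * 2 ^ J < (2 ^ b * 16 * (1 / 2 : ℝ) ^ r) * 2 ^ J :=
                mul_lt_mul_of_pos_right (h1.trans_lt h5) hJpos
            _ = _ := by ring
        exact_mod_cast h3)
    have hno' := hno c (by rw [hc]; simp only [width]; rw [hch])
    have htp : trialPoint d (ctx (setName φ μc μu ψ) ((w, J), r, p)) c =
        shift d p (J - j) (b + j + 4 - r) c := by
      simp only [trialPoint, ctx, hch, gridLevel_setName, hj]
    rw [htp] at hno'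
    have hcode : IsDyadicCode d (shift d p (J - j) (b + j + 4 - r) c) z := by
      have := hcf.isDyadicCode
      rw [hzp]; exact this
    subst hj
    rw [accepts_complete h hx hy hw hq hcode hz hB₂ hzx hX₁ hX₂] at hno'
    exact absurd hno' (by simp)
  · have hf : ∃ a', Fmt J (J + (outerRadius ψ).toNat + 4) d
        (refineCentre d e (setName φ μc μu ψ) ((w, J), r, p)) a' := by
      rw [hc]; exact hp.shift _ _ _
    obtain ⟨a', ha'⟩ := hf
    exact ⟨a', ha', accepts_sound h hy hw hq ha' hX₁ hX₂ hJ hacc⟩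

/-- The search finds an approximation of the solution. -/
theorem solve_near (h : IsSetInvName f S φ μc μu ψ) {x : Fin d → ℝ} {y q : Fin e → ℝ}
    (hx : x ∈ S) (hy : y ∈ f x) {w : Word} (hw : IsDyadicCode e w q) {n : ℕ}
    (hq : ‖y - q‖ ≤ (1 / 2 : ℝ) ^ (μu (n + 2) + 3)) :
    ∃ v, IsDyadicCode d (solve d e (setName φ μc μu ψ) (wpair w (unary n))) v ∧
      ‖v - x‖ ≤ (1 / 2 : ℝ) ^ (n + 1) := by
  set Φ := setName φ μc μu ψ with hΦ
  set u := wpair w (unary n) with hu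
  set J := maxLevel Φ u with hJ
  have hnu : n ≤ u.length := by rw [hu, length_wpair, length_unary]; omega
  have hdig : digits Φ u = J + (outerRadius ψ).toNat + 4 := by rw [digits, radius_setName]
  have hjJ : ∀ r ≤ n + 2, μc (μu r + 4) ≤ J := by
    intro r hr
    rw [hJ, maxLevel, gridLevel_setName]
    exact gridLevel_mono h (by omega)
  have hqr : ∀ r ≤ n + 2, ‖y - q‖ ≤ (1 / 2 : ℝ) ^ (μu r + 3) := fun r hr =>
    hq.trans (half_pow_le (Nat.add_le_add_right (h.parInvName.strict_unicity.monotone hr) 3))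
  have hpow : ∀ m r : ℕ, (2 : ℝ) ^ 2 * (1 / 2 : ℝ) ^ r ≤ 2 ^ (m + 2) * (1 / 2 : ℝ) ^ r :=
    fun m r => mul_le_mul_of_nonneg_right (pow_le_pow_right₀ (by norm_num) (by omega))
      (by positivity)
  have step : ∀ r ≤ n + 2, (∃ a, Fmt J (J + (outerRadius ψ).toNat + 4) d (centre d e Φ u r) a ∧
      (∀ l, (2 : ℤ) ^ (J - μc (μu r + 4)) ∣ a l) ∧
      ‖point J a - x‖ ≤ 2 ^ ((outerRadius ψ).toNat + 2) * (1 / 2 : ℝ) ^ r) →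
      ∃ a, Fmt J (J + (outerRadius ψ).toNat + 4) d (centre d e Φ u (r + 1)) a ∧
      (∀ l, (2 : ℤ) ^ (J - μc (μu r + 4)) ∣ a l) ∧
      ‖point J a - x‖ ≤ (1 / 2 : ℝ) ^ r + (1 / 2 : ℝ) ^ μc (μu r + 4) := by
    rintro r hr ⟨a, hf, ha, hd⟩
    rw [centre_succ]
    have hw' : (unpair u).1 = w := by rw [hu, unpair_wpair]
    rw [hw']
    exact refineCentre_near h hx hy hw (hqr r hr) hf (hjJ r hr) ha hd
  have inv : ∀ r ≤ n + 2, ∃ a, Fmt J (J + (outerRadius ψ).toNat + 4) d (centre d e Φ u r) a ∧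
      (∀ l, (2 : ℤ) ^ (J - μc (μu r + 4)) ∣ a l) ∧
      ‖point J a - x‖ ≤ 2 ^ ((outerRadius ψ).toNat + 2) * (1 / 2 : ℝ) ^ r := by
    intro r
    induction r with
    | zero =>
      intro _
      refine ⟨0, ?_, fun l => dvd_zero _, ?_⟩
      · rw [← hdig]; exact fmt_zeroCode d
      · have h0 : point J (0 : Fin d → ℤ) = 0 := by funext l; simp [point]
        rw [h0, zero_sub, norm_neg, pow_zero, mul_one]
        exact (norm_le_radius h hx).trans (pow_le_pow_right₀ (by norm_num) (by omega))
    | succ r ih =>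
      intro hr
      obtain ⟨a, hf, ha, hd⟩ := step r (by omega) (ih (by omega))
      -- The grids are nested, so the new centre also lies on the finer grid of the next level.
      refine ⟨a, hf, fun l => (pow_dvd_pow _ ?_).trans (ha l), ?_⟩
      · have := gridLevel_mono h (show r ≤ r + 1 by omega)
        simp only at this
        omega
      -- The error is at most `2 * 2 ^ (-r) = 4 * 2 ^ (-(r + 1))`; the factor 4 accounts for the `+
      -- 2` in the invariant.
      · have h1 := half_pow_le (le_gridLevel h r)
        refine le_trans ?_ (hpow _ _)
        rw [pow_succ (1 / 2 : ℝ) r]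
        linarith
  obtain ⟨a, hf, -, hd⟩ := step (n + 2) le_rfl (inv (n + 2) le_rfl)
  refine ⟨point J a, ?_, ?_⟩
  · have hs : solve d e Φ u = centre d e Φ u (n + 2 + 1) := by
      rw [solve, centre, hu, unpair_wpair, length_unary]
    rw [hs]
    exact hf.isDyadicCode
  · have h1 := half_pow_le (le_gridLevel h (n + 2))
    refine hd.trans ?_
    rw [pow_succ (1 / 2 : ℝ) (n + 1)] at h1 ⊢
    linarith

/-! ### The name of the inverse -/

theorem lengthMonotone_fpair {φ ψ : StrFun} (hφ : LengthMonotone φ) (hψ : LengthMonotone ψ) :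
    LengthMonotone (fpair φ ψ) := by
  have key : ∀ b s, (fpair φ ψ (b :: s)).length = (φ s).length + (ψ s).length + 1 := by
    intro b s
    cases b <;> simp only [fpair, List.length_append, length_unary, List.length_cons] <;> omega
  intro s t hst
  match s, t with
  | [], _ => exact Nat.zero_le _
  | b :: s, [] => simp at hst
  | b :: s, c :: t =>
    have h : s.length ≤ t.length := by simpa using hst
    have h1 := hφ s t h
    have h2 := hψ s t h
    rw [key, key]
    omega

theorem lengthMonotone_modulusFun {μ : ℕ → ℕ} (h : Monotone μ) : LengthMonotone (modulusFun μ) :=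
  fun s t hst => by simpa [modulusFun] using h hst

theorem length_zeroCode_mono : ∀ (d : ℕ) {J J' N N' : ℕ}, J ≤ J' → N ≤ N' →
    (zeroCode d J N).length ≤ (zeroCode d J' N').length
  | 0, _, _, _, _, _, _ => le_rfl
  | 1, _, _, _, _, hJ, hN => by
    simp only [zeroCode, length_wpair, length_unary]; omega
  | d + 2, _, _, _, _, hJ, hN => by
    have := length_zeroCode_mono (d + 1) hJ hN
    simp only [zeroCode, length_wpair, length_unary]; omega

theorem lengthMonotone_solve (h : IsSetInvName f S φ μc μu ψ) :
    LengthMonotone (solve d e (setName φ μc μu ψ)) := by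
  intro s t hst
  rw [length_solve, length_solve]
  have hm : maxLevel (setName φ μc μu ψ) s ≤ maxLevel (setName φ μc μu ψ) t := by
    rw [maxLevel, maxLevel, gridLevel_setName, gridLevel_setName]
    exact gridLevel_mono h (by omega)
  exact length_zeroCode_mono d hm (by simp only [digits]; omega)

/-- The domain is the image of the compact set `S` under the extension of `f` by zero, and the
modulus makes this extension continuous on `S`. -/
theorem isCompact_dom_inversion (h : IsSetInvName f S φ μc μu ψ) :
    IsCompact (inversion f S).Dom := by
  classical
  let F : (Fin d → ℝ) → (Fin e → ℝ) := fun x => if hx : (f x).Dom then (f x).get hx else 0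
  have hF : ∀ x ∈ S, F x ∈ f x := by
    intro x hx
    have hd : (f x).Dom := h.subset_dom hx
    simp only [F, dif_pos hd]
    exact Part.get_mem hd
  have himg : (inversion f S).Dom = F '' S := by
    ext y
    constructor
    · rintro ⟨x, hx, hy⟩
      exact ⟨x, hx, Part.mem_unique (hF x hx) hy⟩
    · rintro ⟨x, hx, rfl⟩
      exact ⟨x, hx, hF x hx⟩
  rw [himg]
  refine h.gridName.compact.image_of_continuousOn (Metric.continuousOn_iff.2 fun x hx ε hε => ?_)
  obtain ⟨n, hn⟩ := exists_pow_lt_of_lt_one hε (show (1 / 2 : ℝ) < 1 by norm_num)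
  refine ⟨(1 / 2 : ℝ) ^ μc n, by positivity, fun x' hx' hd => ?_⟩
  rw [dist_eq_norm] at hd ⊢
  exact (h.parInvName.continuity n x' x _ _ (hF x' hx') (hF x hx) hd.le).trans_lt hn

/-- Continuity of the inverse is unicity of `f` and conversely. The shift in `outModulus` is made
for the approximation clause: at `n + 1` it equals `μu (n + 2) + 3`, the accuracy of the target that
`solve_near` requires. -/
theorem isParInvName_inversion (h : IsSetInvName f S φ μc μu ψ) :
    IsParInvName (inversion f S) (solve d e (setName φ μc μu ψ))
      (outModulus (setName φ μc μu ψ)) (getMc (setName φ μc μu ψ)) := by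
  have hinj : ∀ x ∈ S, ∀ x' ∈ S, ∀ y, y ∈ f x → y ∈ f x' → x = x' :=
    fun x _ x' _ y hy hy' => unicity_eq h.parInvName.unicity hy hy'
  have hmc : getMc (setName φ μc μu ψ) = μc := funext fun n => getMc_setName ..
  have hom : ∀ n, outModulus (setName φ μc μu ψ) n = μu (n + 1) + 3 := fun n => by
    rw [outModulus, getMu_setName]
  have hsm : StrictMono (outModulus (setName φ μc μu ψ)) := by
    intro m n hmn
    rw [hom, hom]
    have := h.parInvName.strict_unicity (show m + 1 < n + 1 by omega)
    omega
  rw [hmc]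
  refine ⟨isCompact_dom_inversion h, ?_, ?_, hsm, h.parInvName.strict_continuity, ?_, ?_⟩
  · intro n y y' x x' hx hx' hd
    rw [mem_inversion hinj] at hx hx'
    refine h.parInvName.unicity n x x' y y' hx.2 hx'.2 (hd.trans (half_pow_le ?_))
    rw [hom]
    have := h.parInvName.strict_unicity.monotone (show n ≤ n + 1 by omega)
    omega
  · intro n y y' x x' hx hx' hd
    rw [mem_inversion hinj] at hx hx'
    exact h.parInvName.continuity n x x' y y' hx.2 hx'.2 hd
  · rintro w q n hw ⟨y, ⟨x, hx, hy⟩, hyq⟩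
    have hyq' := hyq
    rw [Metric.mem_closedBall, dist_eq_norm, hom] at hyq'
    obtain ⟨v, hv, hvx⟩ := solve_near h hx hy hw hyq'
    exact ⟨v, hv, y, ⟨⟨x, hx, hy⟩, hyq⟩, x, (mem_inversion hinj).2 ⟨hx, hy⟩, hvx⟩
  · exact lengthMonotone_fpair (lengthMonotone_fpair (lengthMonotone_solve h)
      (lengthMonotone_modulusFun hsm.monotone))
      (lengthMonotone_modulusFun h.parInvName.strict_continuity.monotone)

/-! ### Bounds for the running time -/

/-- Only levels up to the coded precision plus two are searched, and the precision coded in a word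
never exceeds its length; this covers both readings of `n`. -/
theorem mainWidth_le {Φ : StrFun} {s : Word} {n B : ℕ} (hs : IsQueryOfPrecision s n ∨ n = s.length)
    (hB : ∀ r ≤ n + 2, width d Φ r ≤ B) : mainWidth d Φ s ≤ B := by
  match s with
  | [] => exact Nat.zero_le _
  | [false] => exact Nat.zero_le _
  | true :: _ => exact Nat.zero_le _
  | false :: true :: _ => exact Nat.zero_le _
  | false :: false :: u =>
    have hn : (unpair u).2.length ≤ n := by
      rcases hs with ⟨w, hw⟩ | rfl
      · simp only [List.cons.injEq, true_and] at hw
        rw [hw, unpair_wpair, length_unary]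
      · have := length_unpair_snd u
        simp only [List.length_cons]
        omega
    change solveWidth d Φ u ≤ B
    unfold solveWidth
    refine Finset.sup_le fun r hr => hB r ?_
    rw [Finset.mem_range] at hr
    omega

theorem width_setName (r : ℕ) : width d (setName φ μc μu ψ) r =
    d * ((outerRadius ψ).toNat + μc (μu r + 4) + 4 - r + 2) := by
  rw [width, chunk, radius_setName, gridLevel_setName]

theorem width_le (h : IsSetInvName f S φ μc μu ψ) {r n : ℕ} (hr : r ≤ n + 2) :
    width d (setName φ μc μu ψ) r ≤ d * ((outerRadius ψ).toNat + μc (μu (n + 2) + 4) + 6) := by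
  rw [width_setName]
  refine Nat.mul_le_mul_left _ ?_
  have := gridLevel_mono h hr
  simp only at this
  omega

theorem add_le_strictMono {μ : ℕ → ℕ} (hμ : StrictMono μ) (m k : ℕ) : μ m + k ≤ μ (m + k) := by
  induction k with
  | zero => exact le_rfl
  | succ k ih =>
    have := hμ (Nat.lt_succ_self (m + k))
    have e : m + (k + 1) = (m + k).succ := rfl
    rw [e]
    omega

/-- The additive constants are absorbed into the shift by `c`: `μu (n + 2) + 4 ≤ μu (n + 6) ≤ μu (μc
(n + c))`. The inner `μc` is used only through `n + 6 ≤ μc (n + c)`. -/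
theorem width_le_general (h : IsSetInvName f S φ μc μu ψ) {r n c : ℕ} (hr : r ≤ n + 2)
    (hc : 6 ≤ c) (hcd : 6 * d ≤ c) : width d (setName φ μc μu ψ) r ≤
      c * (μc (μu (μc (n + c))) + (outerRadius ψ).toNat + 1) := by
  refine (width_le h hr).trans ?_
  have h1 : n + 6 ≤ μc (n + c) := le_trans (by omega) h.parInvName.strict_continuity.le_apply
  have h2 : μu (n + 2) + 4 ≤ μu (μc (n + c)) :=
    (add_le_strictMono h.parInvName.strict_unicity (n + 2) 4).trans
      (h.parInvName.strict_unicity.monotone h1)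
  have h3 := h.parInvName.strict_continuity.monotone h2
  calc _ ≤ d * (6 * (μc (μu (μc (n + c))) + (outerRadius ψ).toNat + 1)) :=
        Nat.mul_le_mul_left _ (by omega)
    _ = 6 * d * (μc (μu (μc (n + c))) + (outerRadius ψ).toNat + 1) := by ring
    _ ≤ _ := Nat.mul_le_mul_right _ hcd

/-- Over the common denominator `α ^ 2 * β` the numerator is at most `n + 2 * k + 8`, since the
exponents are at most one. The search level involves only `μc ∘ μu`, so the second factor `α` is
slack. -/
theorem holder_modulus_le {α β : ℝ} (hα : 0 < α) (hα₁ : α ≤ 1) (hβ : 0 < β) (hβ₁ : β ≤ 1) {n k : ℕ}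
    (hc : ∀ n, μc n ≤ ⌈((n : ℝ) + k) / α⌉₊) (hu : ∀ n, μu n ≤ ⌈((n : ℝ) + k) / β⌉₊) :
    (μc (μu (n + 2) + 4) : ℝ) ≤ 8 * (((n : ℝ) + k + 1) / (α ^ 2 * β)) := by
  have ceil : ∀ (m : ℕ) (x : ℝ), 0 ≤ x → m ≤ ⌈x⌉₊ → (m : ℝ) ≤ x + 1 := fun m x hx hm =>
    (Nat.cast_le.2 hm).trans (Nat.ceil_lt_add_one hx).le
  have h1 : (μu (n + 2) : ℝ) ≤ ((n : ℝ) + 2 + k) / β + 1 := by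
    have := ceil _ _ (by positivity) (hu (n + 2))
    push_cast at this
    exact this
  have h2 : (μc (μu (n + 2) + 4) : ℝ) ≤ ((μu (n + 2) : ℝ) + 4 + k) / α + 1 := by
    have := ceil _ _ (by positivity) (hc (μu (n + 2) + 4))
    push_cast at this
    exact this
  have hD : 0 < α ^ 2 * β := by positivity
  have h3 : (((n : ℝ) + 2 + k) / β + 1 + 4 + k) / α + 1 ≤ 8 * (((n : ℝ) + k + 1) / (α ^ 2 * β)) := by
    have e : (((n : ℝ) + 2 + k) / β + 1 + 4 + k) / α + 1 =
        ((n + 2 + k) * α + (5 + k) * (α * β) + α ^ 2 * β) / (α ^ 2 * β) := by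
      field_simp
      ring
    rw [e, ← mul_div_assoc]
    refine div_le_div_of_nonneg_right ?_ hD.le
    have a1 : ((n : ℝ) + 2 + k) * α ≤ n + 2 + k := mul_le_of_le_one_right (by positivity) hα₁
    have a2 : α * β ≤ 1 := mul_le_one₀ hα₁ hβ.le hβ₁
    have a3 : (5 + (k : ℝ)) * (α * β) ≤ 5 + k := mul_le_of_le_one_right (by positivity) a2
    have a4 : α ^ 2 * β ≤ 1 := mul_le_one₀ (pow_le_one₀ hα.le hα₁) hβ.le hβ₁
    have a5 : (0 : ℝ) ≤ n := Nat.cast_nonneg n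
    have a6 : (0 : ℝ) ≤ k := Nat.cast_nonneg k
    linarith
  refine h2.trans (le_trans ?_ h3)
  gcongr

/-- Here `μc (μu r + 4) ≤ r + 2 * k + 4`, and the subtraction of `r` in `chunk` cancels the level:
each refinement guesses a number of digits independent of the precision. -/
theorem width_le_lipschitz {k r : ℕ} (hc : ∀ n, μc n ≤ n + k) (hu : ∀ n, μu n ≤ n + k) :
    width d (setName φ μc μu ψ) r ≤ d * (2 * (k + (outerRadius ψ).toNat) + 10) := by
  rw [width_setName]
  refine Nat.mul_le_mul_left _ ?_
  have h1 := hc (μu r + 4)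
  have h2 := hu r
  omega

end InverseSearch

theorem theorems (d e : ℕ) (hd : 0 < d) (he : 0 < e) :
    ∃ (M : OracleTM) (P : SecondOrderPoly) (c : ℕ) (τ : ℕ → ℕ),
      -- `M` computes `(f, S) ↦ (f|_S)⁻¹`
      M.Realizes (setInvRep d e) (parInvRep e d) (fun p => inversion p.1 p.2) ∧
      ∀ (f : (Fin d → ℝ) →. (Fin e → ℝ)) (S : Set (Fin d → ℝ)) (φ : StrFun) (μc μu : ℕ → ℕ)
        (ψ : StrFun), IsSetInvName f S φ μc μu ψ →
        -- the running time depends exponentially on `μc ∘ μu ∘ μc`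
        (∀ (s : Word) (n : ℕ), IsQueryOfPrecision s n ∨ n = s.length →
          ∃ t : ℕ, M.HaltsIn (setName φ μc μu ψ) s t ∧
            t ≤ P.eval (fnLength (setName φ μc μu ψ)) s.length *
              2 ^ (c * (μc (μu (μc (n + c))) + (outerRadius ψ).toNat + 1))) ∧
        -- bi-Hölder functions, with Hölder moduli: exponential in `n`
        (∀ (α β : ℝ) (k : ℕ), IsBiHolder α (2 ^ k) β (2 ^ k) f →
          (∀ n, μc n ≤ ⌈((n : ℝ) + k) / α⌉₊) → (∀ n, μu n ≤ ⌈((n : ℝ) + k) / β⌉₊) →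
          ∀ (s : Word) (n : ℕ), IsQueryOfPrecision s n ∨ n = s.length →
            ∃ t : ℕ, M.HaltsIn (setName φ μc μu ψ) s t ∧
              (t : ℝ) ≤ P.eval (fnLength (setName φ μc μu ψ)) s.length *
                (2 : ℝ) ^ (c * (((n : ℝ) + k + 1) / (α ^ 2 * β) + (outerRadius ψ).toNat))) ∧
        -- bi-Lipschitz functions, with Lipschitz moduli: parameterized polynomial time
        (∀ k : ℕ, IsBiLipschitz (2 ^ k) (2 ^ k) f →
          (∀ n, μc n ≤ n + k) → (∀ n, μu n ≤ n + k) →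
          ∀ s : Word, ∃ t : ℕ, M.HaltsIn (setName φ μc μu ψ) s t ∧
            t ≤ τ (k + (outerRadius ψ).toNat) *
              P.eval (fnLength (setName φ μc μu ψ)) s.length) := by
  obtain ⟨M, P, hM⟩ := InverseSearch.exists_machine d e
  -- The general bound needs `c ≥ 6` and `c ≥ 6 * d`. The Hölder bound needs `c ≥ 14 * d`: with `Y =
  -- (n + k + 1) / (α ^ 2 * β) ≥ 1`, the width is at most `d * (b + 8 * Y + 6) ≤ 14 * d * (Y + b)`.
  refine ⟨M, P, 14 * d + 6, fun m => 2 ^ (d * (2 * m + 10)), ?_, ?_⟩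
  · rintro _ ⟨f, S⟩ ⟨φ, μc, μu, ψ, rfl, h⟩
    refine ⟨InverseSearch.mainFun d e (setName φ μc μu ψ), fun s => ?_, _, _, _,
      InverseSearch.mainFun_eq d e _, InverseSearch.isParInvName_inversion h⟩
    obtain ⟨t, -, ht⟩ := hM _ h.lengthMonotone s
    exact ⟨t, ht⟩
  · intro f S φ μc μu ψ h
    refine ⟨fun s n hs => ?_, fun α β k hf hc hu s n hs => ?_, fun k _ hc hu s => ?_⟩
    · obtain ⟨t, ht, hh, -⟩ := hM _ h.lengthMonotone s
      refine ⟨t, hh, ht.trans (Nat.mul_le_mul_left _ (Nat.pow_le_pow_right (by omega) ?_))⟩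
      exact InverseSearch.mainWidth_le hs fun r hr =>
        InverseSearch.width_le_general h hr (by omega) (by omega)
    · obtain ⟨t, ht, hh, -⟩ := hM _ h.lengthMonotone s
      obtain ⟨⟨hα, hα₁, -, -⟩, -, hβ, hβ₁, -, -⟩ := hf
      refine ⟨t, hh, (Nat.cast_le.2 ht).trans ?_⟩
      push_cast
      refine mul_le_mul_of_nonneg_left ?_ (Nat.cast_nonneg _)
      rw [← Real.rpow_natCast]
      refine Real.rpow_le_rpow_of_exponent_le (by norm_num) ?_
      have hW := InverseSearch.mainWidth_le (d := d) hs fun r hr => InverseSearch.width_le h hr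
      have hX := InverseSearch.holder_modulus_le (n := n) hα hα₁ hβ hβ₁ hc hu
      have hD : 0 < α ^ 2 * β := by positivity
      have hD₁ : α ^ 2 * β ≤ 1 := mul_le_one₀ (pow_le_one₀ hα.le hα₁) hβ.le hβ₁
      have h1 : (1 : ℝ) ≤ ((n : ℝ) + k + 1) / (α ^ 2 * β) := by
        rw [le_div_iff₀ hD, one_mul]
        have a5 : (0 : ℝ) ≤ n := Nat.cast_nonneg n
        have a6 : (0 : ℝ) ≤ k := Nat.cast_nonneg k
        linarith
      refine (Nat.cast_le.2 hW).trans ?_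
      push_cast
      have hb : (0 : ℝ) ≤ ((outerRadius ψ).toNat : ℝ) := Nat.cast_nonneg _
      have hd₀ : (0 : ℝ) ≤ d := Nat.cast_nonneg d
      generalize ((n : ℝ) + k + 1) / (α ^ 2 * β) = Y at hX h1 ⊢
      generalize ((outerRadius ψ).toNat : ℝ) = b at hb ⊢
      refine (mul_le_mul_of_nonneg_left (show _ ≤ 14 * (Y + b) by linarith) hd₀).trans ?_
      nlinarith
    · obtain ⟨t, ht, hh, -⟩ := hM _ h.lengthMonotone s
      refine ⟨t, hh, ht.trans ?_⟩
      rw [mul_comm]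
      exact Nat.mul_le_mul_right _ (Nat.pow_le_pow_right (by omega)
        (InverseSearch.mainWidth_le (Or.inr rfl) fun r _ => InverseSearch.width_le_lipschitz hc hu))
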